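/- Let $T>0$, let $(\Omega,\mathcal F,\{\mathcal F_t\}_{0\le t\le T},\mathbb P)$ be a stochastic basis and $W=W(t)$, $0\le t\le T$, a standard Wiener process on it. Let $\Lambda = 1-\frac{T^2}{\pi^2}\frac{d^2}{dt^2}$ on $(0,T)$ with Neumann boundary conditions; its eigenfunctions are the cosine basis $m_1=1/\sqrt T$, $m_k(t)=\sqrt{2/T}\cos(\pi(k-1)t/T)$, $k>1$, of $L_2((0,T))$, with eigenvalues $\lambda_k=1+(k-1)^2$. For $s\in\mathbb R$ put $\|f\|_s^2=\|\Lambda^{s/2}f\|_{L_2((0,T))}^2=\sum_{k\ge1}\lambda_k^{s}\,\big(\int_0^T f m_k\,dt\big)^2\in[0,\infty]$, and for functions on $[0,T]^k$ let $\|\cdot\|_s$ be the corresponding tensor product norm. For $p,q\in\mathbb R$ let $(\mathfrak L)_{p,q}(\mathbb W;\mathbb R)$ be the closure (completion) of the set of random variables $$\eta=\eta_0+\sum_{k=1}^N\int_0^T\int_0^{s_k}\cdots\int_0^{s_2}\eta_k(s_1,\ldots,s_k)\,dW(s_1)\cdots dW(s_k),$$ where $N\ge 1$, $\eta_0\in\mathbb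 R$ and each $\eta_k$ is a smooth symmetric function on $[0,T]^k$ with $\|\eta_k\|_q<\infty$, with respect to the norm $$\|\eta\|_{p,q}^2=|\eta_0|^2+\sum_{k=1}^N\frac{2^{kp}}{(k!)^2}\|\eta_k\|_q^2 .$$ Let $(\mathfrak L)^{p,q}(\mathbb W)$ be the dual of $(\mathfrak L)_{p,q}(\mathbb W;\mathbb R)$ relative to the inner product of $L_2(\mathbb W;\mathbb R)$, the space of square integrable random variables that are measurable with respect to the sigma-algebra generated by $W(t)$, $t\in[0,T]$: a random variable $\zeta\in L_2(\mathbb W;\mathbb R)$ belongs to $(\mathfrak L)^{p,q}(\mathbb W)$ if and only if $\eta\mapsto\mathbb E(\eta\zeta)$ extends from the random variables $\eta$ above to a continuous linear functional on $(\mathfrak L)_{p,q}(\mathbb W;\mathbb R)$. For $h\in L_2((0,T))$ let $$\mathcal E_h=\exp\Big(\int_0^T h(s)\,dW(s)-\frac12\int_0^T|h(s)|^2\,ds\Big).$$ Then, for all $p,q\in\mathbb R$ and every $h\in L_2((0,T))$, $$\mathcal E_h\in(\mathfrak L)^{p,q}(\mathbb W)\quad\Longleftrightarrow\quad \|h\|_{-q}^2<2^p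 .$$ -/

import Mathlib

open MeasureTheory ProbabilityTheory Filter Topology
open scoped ENNReal NNReal

namespace WienerChaos

noncomputable section

/-! ### The operator `Λ = 1 - (T² / π²) d²/dt²` with Neumann boundary conditions -/

/-- The cosine orthonormal basis of `L₂((0,T))`, numbered from `0`. -/
def cosBasis (T : ℝ) (n : ℕ) (t : ℝ) : ℝ :=
  if n = 0 then 1 / √T else √(2 / T) * Real.cos (Real.pi * n * t / T)

/-- The eigenvalue of `Λ` at `cosBasis T n`, see `cosBasis_eigenfunction`. -/
def eigenvalue (n : ℕ) : ℝ := 1 + (n : ℝ) ^ 2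

theorem eigenvalue_pos (n : ℕ) : 0 < eigenvalue n := by
  unfold eigenvalue; positivity

theorem cosBasis_continuous (T : ℝ) (n : ℕ) : Continuous (cosBasis T n) := by
  unfold cosBasis
  split_ifs <;> fun_prop

theorem deriv_cosBasis (T : ℝ) (n : ℕ) :
    deriv (cosBasis T n) = fun t =>
      -(√(2 / T) * (Real.pi * n / T) * Real.sin (Real.pi * n * t / T)) := by
  funext t
  by_cases hn : n = 0
  · have : cosBasis T n = fun _ => 1 / √T := by funext s; simp [cosBasis, hn]
    rw [this]; simp [hn]
  · have h0 : cosBasis T n = fun s => √(2 / T) * Real.cos (Real.pi * n * s / T) := by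
      funext s; simp [cosBasis, hn]
    rw [h0]
    have h1 : HasDerivAt (fun s : ℝ => Real.pi * n * s / T) (Real.pi * n / T) t := by
      simpa using ((hasDerivAt_id t).const_mul (Real.pi * n)).div_const T
    have h2 := (h1.cos).const_mul (√(2 / T))
    rw [h2.deriv]; ring

/-- `cosBasis T n` satisfies the Neumann boundary conditions and
`cosBasis T n - (T² / π²) (cosBasis T n)'' = eigenvalue n • cosBasis T n`. -/
theorem cosBasis_eigenfunction (T : ℝ) (hT : 0 < T) (n : ℕ) :
    deriv (cosBasis T n) 0 = 0 ∧ deriv (cosBasis T n) T = 0 ∧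
      ∀ t, cosBasis T n t - T ^ 2 / Real.pi ^ 2 * deriv (deriv (cosBasis T n)) t =
        eigenvalue n * cosBasis T n t := by
  have hT' : T ≠ 0 := hT.ne'
  refine ⟨by simp [deriv_cosBasis], ?_, fun t => ?_⟩
  · rw [deriv_cosBasis]
    have : Real.pi * n * T / T = n * Real.pi := by field_simp
    simp [this, Real.sin_nat_mul_pi]
  · have h1 : HasDerivAt (fun s : ℝ => Real.pi * n * s / T) (Real.pi * n / T) t := by
      simpa using ((hasDerivAt_id t).const_mul (Real.pi * n)).div_const T
    have h2 := ((h1.sin).const_mul (√(2 / T) * (Real.pi * n / T))).neg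
    rw [deriv_cosBasis]
    have h3 := h2.deriv
    simp only [Pi.neg_def] at h3
    rw [h3]
    unfold cosBasis eigenvalue
    split_ifs with hn
    · simp [hn]
    · have := Real.pi_ne_zero
      field_simp
      ring

/-- `‖h‖_s² = ‖Λ^{s/2} h‖²_{L₂((0,T))}` for a function `h` of one variable and any real `s`,
`Λ^{s/2}` being given by its spectral decomposition; the value `∞` is allowed. -/
def sobolevNormSq (T s : ℝ) (h : ℝ → ℝ) : ℝ≥0∞ :=
  ∑' n : ℕ, ENNReal.ofReal (eigenvalue n ^ s * (∫ t in Set.Icc 0 T, h t * cosBasis T n t) ^ 2)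

/-! ### Kernels: functions on `[0,T]^k` -/

/-- The cube `[0,T]^k`. -/
def cube (T : ℝ) (k : ℕ) : Set (Fin k → ℝ) := Set.univ.pi fun _ => Set.Icc 0 T

/-- The coefficients of a function on `[0,T]^k` in the tensor product cosine basis. -/
def kernelCoef (T : ℝ) {k : ℕ} (f : (Fin k → ℝ) → ℝ) (i : Fin k → ℕ) : ℝ :=
  ∫ x in cube T k, f x * ∏ j, cosBasis T (i j) (x j)

/-- The squared norm of a function on `[0,T]^k` in the `k`-fold Hilbert space tensor power
of `H^s((0,T))`; the value `∞` is allowed. -/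
def kernelNormSq (T s : ℝ) {k : ℕ} (f : (Fin k → ℝ) → ℝ) : ℝ≥0∞ :=
  ∑' i : Fin k → ℕ, ENNReal.ofReal ((∏ j, eigenvalue (i j) ^ s) * kernelCoef T f i ^ 2)

theorem kernelCoef_add (T : ℝ) {k : ℕ} {f g : (Fin k → ℝ) → ℝ} (hf : ContinuousOn f (cube T k))
    (hg : ContinuousOn g (cube T k)) (i : Fin k → ℕ) :
    kernelCoef T (f + g) i = kernelCoef T f i + kernelCoef T g i := by
  have hc : IsCompact (cube T k) := isCompact_univ_pi fun _ => isCompact_Icc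
  have hm : Continuous fun x : Fin k → ℝ => ∏ j, cosBasis T (i j) (x j) :=
    continuous_finsetProd _ fun j _ => (cosBasis_continuous T (i j)).comp (continuous_apply j)
  have h1 : IntegrableOn (fun x => f x * ∏ j, cosBasis T (i j) (x j)) (cube T k) :=
    (hf.mul hm.continuousOn).integrableOn_compact hc
  have h2 : IntegrableOn (fun x => g x * ∏ j, cosBasis T (i j) (x j)) (cube T k) :=
    (hg.mul hm.continuousOn).integrableOn_compact hc
  unfold kernelCoef
  rw [← integral_add h1 h2]
  simp [add_mul]

theorem kernelCoef_smul (T c : ℝ) {k : ℕ} (f : (Fin k → ℝ) → ℝ) (i : Fin k → ℕ) :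
    kernelCoef T (c • f) i = c * kernelCoef T f i := by
  unfold kernelCoef
  rw [← integral_const_mul]
  simp [mul_assoc]

theorem kernelNormSq_eq (T s : ℝ) {k : ℕ} (f : (Fin k → ℝ) → ℝ) :
    kernelNormSq T s f =
      eLpNorm (fun i => √(∏ j, eigenvalue (i j) ^ s) * kernelCoef T f i) 2 Measure.count ^ 2 := by
  rw [eLpNorm_eq_lintegral_rpow_enorm_toReal (by norm_num) (by norm_num), lintegral_count,
    ← ENNReal.rpow_natCast, ← ENNReal.rpow_mul]
  norm_num
  unfold kernelNormSq
  refine tsum_congr fun i => ?_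
  have hp : 0 ≤ ∏ j, eigenvalue (i j) ^ s :=
    Finset.prod_nonneg fun j _ => Real.rpow_nonneg (eigenvalue_pos _).le _
  rw [← enorm_mul, Real.enorm_eq_ofReal_abs, ← ENNReal.ofReal_pow (abs_nonneg _), sq_abs, mul_pow,
    Real.sq_sqrt hp]

/-- `‖f‖_s` as a real number, for kernels with a finite norm. -/
def kernelNorm (T s : ℝ) {k : ℕ} (f : (Fin k → ℝ) → ℝ) : ℝ := √(kernelNormSq T s f).toReal

theorem kernelNorm_eq (T s : ℝ) {k : ℕ} (f : (Fin k → ℝ) → ℝ) :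
    kernelNorm T s f =
      (eLpNorm (fun i => √(∏ j, eigenvalue (i j) ^ s) * kernelCoef T f i) 2
        Measure.count).toReal := by
  rw [kernelNorm, kernelNormSq_eq, ENNReal.toReal_pow, Real.sqrt_sq ENNReal.toReal_nonneg]

theorem kernelNormSq_lt_top (T s : ℝ) {k : ℕ} (f : (Fin k → ℝ) → ℝ) :
    kernelNormSq T s f < ∞ ↔
      eLpNorm (fun i => √(∏ j, eigenvalue (i j) ^ s) * kernelCoef T f i) 2 Measure.count < ∞ := by
  rw [kernelNormSq_eq, ENNReal.pow_lt_top_iff]; simp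

theorem eLpNorm_kernel_add (T s : ℝ) {k : ℕ} {f g : (Fin k → ℝ) → ℝ}
    (hf : ContinuousOn f (cube T k)) (hg : ContinuousOn g (cube T k)) :
    eLpNorm (fun i => √(∏ j, eigenvalue (i j) ^ s) * kernelCoef T (f + g) i) 2 Measure.count ≤
      eLpNorm (fun i => √(∏ j, eigenvalue (i j) ^ s) * kernelCoef T f i) 2 Measure.count +
      eLpNorm (fun i => √(∏ j, eigenvalue (i j) ^ s) * kernelCoef T g i) 2 Measure.count := by
  refine le_trans (le_of_eq ?_) (eLpNorm_add_le (Measurable.of_discrete.aestronglyMeasurable)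
    (Measurable.of_discrete.aestronglyMeasurable) (by norm_num))
  congr 1
  funext i
  simp [kernelCoef_add T hf hg i, mul_add]

theorem eLpNorm_kernel_smul (T s c : ℝ) {k : ℕ} (f : (Fin k → ℝ) → ℝ) :
    eLpNorm (fun i => √(∏ j, eigenvalue (i j) ^ s) * kernelCoef T (c • f) i) 2 Measure.count =
      ‖c‖ₑ *
      eLpNorm (fun i => √(∏ j, eigenvalue (i j) ^ s) * kernelCoef T f i) 2 Measure.count := by
  rw [← eLpNorm_const_smul]
  congr 1
  funext i
  simp [kernelCoef_smul]
  ring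

/-- The smooth symmetric functions on `[0,T]^k` whose norm `‖·‖_q` is finite. For `k = 0` these
are the constants. The values outside the cube play no role. -/
def smoothKernel (T q : ℝ) (k : ℕ) : Submodule ℝ ((Fin k → ℝ) → ℝ) where
  carrier := {f | ContDiffOn ℝ ((⊤ : ℕ∞) : WithTop ℕ∞) f (cube T k) ∧
    (∀ σ : Equiv.Perm (Fin k), ∀ x ∈ cube T k, f (x ∘ σ) = f x) ∧ kernelNormSq T q f < ∞}
  add_mem' := by
    rintro f g ⟨hf, hf', hf''⟩ ⟨hg, hg', hg''⟩
    refine ⟨hf.add hg, fun σ x hx => by simp [hf' σ x hx, hg' σ x hx], ?_⟩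
    rw [kernelNormSq_lt_top] at *
    exact (eLpNorm_kernel_add T q hf.continuousOn hg.continuousOn).trans_lt
      (ENNReal.add_lt_top.2 ⟨hf'', hg''⟩)
  zero_mem' := by
    refine ⟨contDiffOn_const, fun _ _ _ => rfl, ?_⟩
    simp [kernelNormSq, kernelCoef]
  smul_mem' := by
    rintro c f ⟨hf, hf', hf''⟩
    refine ⟨hf.const_smul c, fun σ x hx => by simp [hf' σ x hx], ?_⟩
    rw [kernelNormSq_lt_top] at *
    rw [eLpNorm_kernel_smul]
    exact ENNReal.mul_lt_top (by simp) hf''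

theorem kernelNorm_add_le {T q : ℝ} {k : ℕ} (f g : smoothKernel T q k) :
    kernelNorm T q (f + g : smoothKernel T q k).1 ≤ kernelNorm T q f.1 + kernelNorm T q g.1 := by
  have hf := (kernelNormSq_lt_top T q f.1).1 f.2.2.2
  have hg := (kernelNormSq_lt_top T q g.1).1 g.2.2.2
  simp only [kernelNorm_eq]
  rw [← ENNReal.toReal_add hf.ne hg.ne]
  exact ENNReal.toReal_mono (ENNReal.add_lt_top.2 ⟨hf, hg⟩).ne
    (eLpNorm_kernel_add T q f.2.1.continuousOn g.2.1.continuousOn)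

theorem kernelNorm_smul {T q : ℝ} {k : ℕ} (c : ℝ) (f : smoothKernel T q k) :
    kernelNorm T q (c • f : smoothKernel T q k).1 = |c| * kernelNorm T q f.1 := by
  simp only [kernelNorm_eq]
  have h : ((c • f : smoothKernel T q k) : (Fin k → ℝ) → ℝ) = c • f.1 := rfl
  rw [h, eLpNorm_kernel_smul, ENNReal.toReal_mul]
  simp

/-! ### The space `(𝔏)_{p,q}(𝕎; ℝ)` -/

/-- The finite chaos expansions `η = η₀ + ∑_{k=1}^N ∫_0^T ∫_0^{s_k} ⋯ ∫_0^{s_2} η_k dW ⋯ dW`,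
given by their kernels `(η_k)`, where `η₀` is the kernel in zero variables. The parameter `p`
enters through the norm. The random variable itself is `SimpleElement.toLp` below. -/
def SimpleElement (T _p q : ℝ) : Type := Π₀ k : ℕ, smoothKernel T q k

instance (T p q : ℝ) : AddCommGroup (SimpleElement T p q) :=
  inferInstanceAs (AddCommGroup (Π₀ k : ℕ, smoothKernel T q k))

instance (T p q : ℝ) : Module ℝ (SimpleElement T p q) :=
  inferInstanceAs (Module ℝ (Π₀ k : ℕ, smoothKernel T q k))

namespace SimpleElement

variable {T p q : ℝ}

/-- The kernel `η_k`. -/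
def kernel (η : SimpleElement T p q) (k : ℕ) : smoothKernel T q k :=
  (show Π₀ k : ℕ, smoothKernel T q k from η) k

open Classical in
/-- The finitely many `k` with `η_k ≠ 0`. -/
def support (η : SimpleElement T p q) : Finset ℕ :=
  DFinsupp.support (show Π₀ k : ℕ, smoothKernel T q k from η)

/-- `‖η‖_{p,q}² = ∑_k 2^{kp} / (k!)² ‖η_k‖_q²`. -/
def normSq (η : SimpleElement T p q) : ℝ :=
  ∑ k ∈ η.support,
    (2 : ℝ) ^ ((k : ℝ) * p) / (k.factorial : ℝ) ^ 2 * kernelNorm T q (η.kernel k).1 ^ 2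

theorem kernel_add (η ζ : SimpleElement T p q) (k : ℕ) :
    (η + ζ).kernel k = η.kernel k + ζ.kernel k := rfl

theorem kernel_smul (c : ℝ) (η : SimpleElement T p q) (k : ℕ) :
    (c • η).kernel k = c • η.kernel k := rfl

theorem kernelNorm_of_notMem {η : SimpleElement T p q} {k : ℕ} (hk : k ∉ η.support) :
    kernelNorm T q (η.kernel k).1 = 0 := by
  have : η.kernel k = 0 := by
    classical
    by_contra h
    exact hk (DFinsupp.mem_support_iff.2 h)
  rw [this]
  simp [kernelNorm, kernelNormSq, kernelCoef]

theorem sqrt_normSq_eq (η : SimpleElement T p q) {s : Finset ℕ} (hs : η.support ⊆ s) :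
    √η.normSq = (∑ k ∈ s, (√((2 : ℝ) ^ ((k : ℝ) * p) / (k.factorial : ℝ) ^ 2) *
      kernelNorm T q (η.kernel k).1) ^ (2 : ℝ)) ^ (1 / (2 : ℝ)) := by
  rw [← Real.sqrt_eq_rpow, normSq, Finset.sum_subset hs
    (fun k _ hk => by simp [kernelNorm_of_notMem hk])]
  congr 1
  refine Finset.sum_congr rfl fun k _ => ?_
  rw [Real.rpow_two, mul_pow, Real.sq_sqrt (by positivity)]

/-- `‖·‖_{p,q}` as a seminorm. -/
def seminorm (T p q : ℝ) : Seminorm ℝ (SimpleElement T p q) :=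
  Seminorm.of (fun η => √η.normSq)
    (fun η ζ => by
      have h1 : (η + ζ).support ⊆ (η + ζ).support ∪ (η.support ∪ ζ.support) :=
        Finset.subset_union_left
      have h2 : η.support ⊆ (η + ζ).support ∪ (η.support ∪ ζ.support) :=
        Finset.subset_union_left.trans Finset.subset_union_right
      have h3 : ζ.support ⊆ (η + ζ).support ∪ (η.support ∪ ζ.support) :=
        Finset.subset_union_right.trans Finset.subset_union_right
      have nn : ∀ (ξ : SimpleElement T p q) (k : ℕ), 0 ≤ kernelNorm T q (ξ.kernel k).1 :=
        fun ξ k => Real.sqrt_nonneg _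
      rw [sqrt_normSq_eq _ h1, sqrt_normSq_eq _ h2, sqrt_normSq_eq _ h3]
      refine le_trans ?_ (Real.Lp_add_le_of_nonneg _ one_le_two
        (fun k _ => mul_nonneg (Real.sqrt_nonneg _) (nn η k))
        (fun k _ => mul_nonneg (Real.sqrt_nonneg _) (nn ζ k)))
      refine Real.rpow_le_rpow (Finset.sum_nonneg fun k _ =>
        Real.rpow_nonneg (mul_nonneg (Real.sqrt_nonneg _) (nn _ k)) _) ?_ (by norm_num)
      refine Finset.sum_le_sum fun k _ => ?_
      refine Real.rpow_le_rpow (mul_nonneg (Real.sqrt_nonneg _) (nn _ k)) ?_ (by norm_num)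
      rw [← mul_add, kernel_add]
      exact mul_le_mul_of_nonneg_left (kernelNorm_add_le _ _) (Real.sqrt_nonneg _))
    (fun c η => by
      have h : (c • η).normSq = c ^ 2 * η.normSq := by
        have h1 : (c • η).support ⊆ (c • η).support ∪ η.support := Finset.subset_union_left
        have h2 : η.support ⊆ (c • η).support ∪ η.support := Finset.subset_union_right
        rw [normSq, normSq, Finset.sum_subset h1
          (fun k _ hk => by simp [kernelNorm_of_notMem hk]), Finset.sum_subset h2
          (fun k _ hk => by simp [kernelNorm_of_notMem hk]), Finset.mul_sum]
        refine Finset.sum_congr rfl fun k _ => ?_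
        rw [kernel_smul, kernelNorm_smul, mul_pow, sq_abs]
        ring
      rw [h, Real.sqrt_mul (sq_nonneg c), Real.sqrt_sq_eq_abs, Real.norm_eq_abs])

instance : SeminormedAddCommGroup (SimpleElement T p q) :=
  (seminorm T p q).toAddGroupSeminorm.toSeminormedAddCommGroup

theorem norm_def (η : SimpleElement T p q) : ‖η‖ = √η.normSq := rfl

instance : NormedSpace ℝ (SimpleElement T p q) where
  norm_smul_le c η := le_of_eq ((seminorm T p q).smul' c η)

end SimpleElement

/-- The space `(𝔏)_{p,q}(𝕎; ℝ)`: the closure (completion) of the finite chaos expansions with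
respect to `‖·‖_{p,q}`. -/
abbrev ChaosSpace (T p q : ℝ) : Type := UniformSpace.Completion (SimpleElement T p q)

/-! ### Wiener process and stochastic integrals -/

section Stochastic

variable {Ω : Type*} [mΩ : MeasurableSpace Ω] (P : Measure Ω) [IsProbabilityMeasure P]
  (T : ℝ) (𝓕 : Filtration ℝ mΩ) (W : ℝ → Ω → ℝ)

/-- `W` is a standard Wiener process on the time interval `[0,T]` relative to the filtration
`(𝓕_t)_{0 ≤ t ≤ T}`. Nothing is required of times outside `[0,T]`. -/
structure IsWienerProcess : Prop where
  adapted : ∀ t ∈ Set.Icc 0 T, Measurable[𝓕 t] (W t)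
  zero : ∀ᵐ ω ∂P, W 0 ω = 0
  law : ∀ s ∈ Set.Icc 0 T, ∀ t ∈ Set.Icc 0 T, s ≤ t →
    P.map (fun ω => W t ω - W s ω) = gaussianReal 0 (Real.toNNReal (t - s))
  indep : ∀ s ∈ Set.Icc 0 T, ∀ t ∈ Set.Icc 0 T, s ≤ t →
    Indep (MeasurableSpace.comap (fun ω => W t ω - W s ω) inferInstance) (𝓕 s) P
  continuous_paths : ∀ᵐ ω ∂P, ContinuousOn (fun t => W t ω) (Set.Icc 0 T)

/-- The sigma-algebra generated by `W(t)`, `t ∈ [0,T]`. -/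
abbrev wienerSigma : MeasurableSpace Ω :=
  ⨆ t ∈ Set.Icc 0 T, MeasurableSpace.comap (W t) inferInstance

/-- A bounded simple adapted process `∑_{i<n} c_i 1_{(t_i, t_{i+1}]}` on `[0,t]`, where `c_i` is
`𝓕_{t_i}`-measurable. -/
structure SimpleProcess {Ω : Type*} [mΩ : MeasurableSpace Ω] (𝓕 : Filtration ℝ mΩ) (t : ℝ) where
  n : ℕ
  node : ℕ → ℝ
  node_mono : Monotone node
  node_mem : ∀ i, node i ∈ Set.Icc 0 t
  coef : ℕ → Ω → ℝ
  coef_meas : ∀ i, Measurable[𝓕 (node i)] (coef i)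
  coef_bdd : ∃ C, ∀ i ω, |coef i ω| ≤ C

namespace SimpleProcess

variable {𝓕} {t : ℝ}

/-- The value of a simple process at the time `s`. -/
def value (φ : SimpleProcess 𝓕 t) (s : ℝ) (ω : Ω) : ℝ :=
  ∑ i ∈ Finset.range φ.n, (Set.Ioc (φ.node i) (φ.node (i + 1))).indicator (fun _ => φ.coef i ω) s

/-- The stochastic integral `∑_{i<n} c_i (W(t_{i+1}) - W(t_i))` of a simple process. -/
def integral (φ : SimpleProcess 𝓕 t) (ω : Ω) : ℝ :=
  ∑ i ∈ Finset.range φ.n, φ.coef i ω * (W (φ.node (i + 1)) ω - W (φ.node i) ω)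

end SimpleProcess

/-- `Y = ∫_0^t Φ(s) dW(s)` (Itô integral). The integrand is a process with values in `L₂(Ω)`,
viewed as a measurable curve in `L₂(Ω)`; it is the limit in `L₂([0,t] × Ω)` of simple adapted
processes (so that it is adapted and square integrable itself), and `Y` is the limit in `L₂(Ω)` of
their stochastic integrals. -/
def IsItoIntegral (t : ℝ) (Φ : ℝ → Lp ℝ 2 P) (Y : Lp ℝ 2 P) : Prop :=
  AEStronglyMeasurable Φ (volume.restrict (Set.Icc 0 t)) ∧
  ∃ φ : ℕ → SimpleProcess 𝓕 t,
    Tendsto (fun n => ∫⁻ s in Set.Icc 0 t,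
      eLpNorm (fun ω => (φ n).value s ω - Φ s ω) 2 P ^ 2) atTop (𝓝 0) ∧
    Tendsto (fun n => eLpNorm (fun ω => (φ n).integral W ω - Y ω) 2 P) atTop (𝓝 0)

/-- `Y = ∫_0^t ∫_0^{s_k} ⋯ ∫_0^{s_2} f(s_1, …, s_k) dW(s_1) ⋯ dW(s_{k-1}) dW(s_k)`, by recursion:
the outermost integrand at the time `s_k = s` is the `(k-1)`-fold iterated integral of
`f(·, …, ·, s)` up to the time `s`. -/
def IsIteratedIto : (k : ℕ) → ((Fin k → ℝ) → ℝ) → ℝ → Lp ℝ 2 P → Prop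
  | 0, f, _, Y => Y = Lp.const 2 P (f Fin.elim0)
  | k + 1, f, t, Y => ∃ Φ : ℝ → Lp ℝ 2 P,
      (∀ᵐ s ∂volume.restrict (Set.Icc 0 t),
        IsIteratedIto k (fun x => f (Fin.snoc x s)) s (Φ s)) ∧
      IsItoIntegral P 𝓕 W t Φ Y

open Classical in
/-- The Itô integral `∫_0^t Φ(s) dW(s)` (and `0` if it does not exist). -/
def itoIntegral (t : ℝ) (Φ : ℝ → Lp ℝ 2 P) : Lp ℝ 2 P :=
  if h : ∃ Y, IsItoIntegral P 𝓕 W t Φ Y then h.choose else 0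

open Classical in
/-- The iterated Itô integral of a kernel over `[0,t]` (and `0` if it does not exist). -/
def iteratedIto {k : ℕ} (f : (Fin k → ℝ) → ℝ) (t : ℝ) : Lp ℝ 2 P :=
  if h : ∃ Y, IsIteratedIto P 𝓕 W k f t Y then h.choose else 0

/-- The random variable
`η₀ + ∑_{k=1}^N ∫_0^T ∫_0^{s_k} ⋯ ∫_0^{s_2} η_k(s_1, …, s_k) dW(s_1) ⋯ dW(s_k)`. -/
def SimpleElement.toLp {T p q : ℝ} (η : SimpleElement T p q) : Lp ℝ 2 P :=
  ∑ k ∈ η.support, iteratedIto P 𝓕 W (η.kernel k).1 T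

/-- The random variable `ζ ∈ L₂(𝕎; ℝ)` is an element of `(𝔏)^{p,q}(𝕎)`, the dual space of
`(𝔏)_{p,q}(𝕎; ℝ)` relative to the inner product of `L₂(𝕎; ℝ)`: there is a continuous linear
functional on `(𝔏)_{p,q}(𝕎; ℝ)` that equals `η ↦ E(η ζ)` on the finite chaos expansions. -/
structure MemDual (p q : ℝ) (ζ : Ω → ℝ) : Prop where
  memLp : MemLp ζ 2 P
  measurable : AEStronglyMeasurable[wienerSigma T W] ζ P
  exists_functional : ∃ ℓ : StrongDual ℝ (ChaosSpace T p q), ∀ η : SimpleElement T p q,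
    ℓ (η : ChaosSpace T p q) = ∫ ω, η.toLp P 𝓕 W ω * ζ ω ∂P

/-- The stochastic exponential `exp (∫_0^T h(s) dW(s) - ½ ∫_0^T |h(s)|² ds)`. -/
def stochExp (h : ℝ → ℝ) (ω : Ω) : ℝ :=
  Real.exp (itoIntegral P 𝓕 W T (fun s => Lp.const 2 P (h s)) ω
    - 1 / 2 * ∫ s in Set.Icc 0 T, |h s| ^ 2)

end Stochastic

end

end WienerChaos

/-!
The idea is to compute the functional `η ↦ E(η 𝓔_h)`. For a nonanticipating square integrable
integrand, `E(∫_0^t Φ(s) dW(s) 𝓔_h) = ∫_0^t h(s) E(Φ(s) 𝓔_h) ds`, as one sees on simple processes by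
differentiating the Laplace transform of a Wiener integral; iterating this over the simplex gives
`E(η 𝓔_h) = η_0 + ∑_k (1 / k!) ⟨η_k, h ⊗ ⋯ ⊗ h⟩`, the inner products being over `[0,T]^k`.

The dual of `‖·‖_q` relative to `L₂` is `‖·‖_{-q}` and `‖h ⊗ ⋯ ⊗ h‖_{-q} = ‖h‖_{-q}^k`, so the
squared norm of the functional is the geometric series `∑_k 2^{-kp} ‖h‖_{-q}^{2k}`, which converges
exactly when `‖h‖_{-q}² < 2^p`. Since `‖h‖_{-q}` may be infinite and test kernels have to be smooth,
the divergence is detected with the kernels `g ⊗ ⋯ ⊗ g`, where `g` is a truncation of the cosine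
expansion of `Λ^{-q} h`.
-/

namespace WienerChaos

noncomputable section

section WienerProcess

variable {Ω : Type*} [mΩ : MeasurableSpace Ω] {P : Measure Ω} {T : ℝ} {𝓕 : Filtration ℝ mΩ}
  {W : ℝ → Ω → ℝ}

namespace IsWienerProcess

theorem mono (hW : IsWienerProcess P T 𝓕 W) {t : ℝ} (ht : t ≤ T) : IsWienerProcess P t 𝓕 W := by
  have hsub : Set.Icc 0 t ⊆ Set.Icc 0 T := Set.Icc_subset_Icc_right ht
  exact ⟨fun s hs => hW.adapted s (hsub hs), hW.zero,
    fun s hs t ht => hW.law s (hsub hs) t (hsub ht),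
    fun s hs t ht => hW.indep s (hsub hs) t (hsub ht),
    hW.continuous_paths.mono fun ω hω => hω.mono hsub⟩

theorem measurable_increment (hW : IsWienerProcess P T 𝓕 W) {a b u : ℝ} (ha : a ∈ Set.Icc 0 T)
    (hb : b ∈ Set.Icc 0 T) (hau : a ≤ u) (hbu : b ≤ u) :
    Measurable[𝓕 u] (fun ω => W b ω - W a ω) :=
  ((hW.adapted b hb).mono (𝓕.mono hbu) le_rfl).sub ((hW.adapted a ha).mono (𝓕.mono hau) le_rfl)

theorem measurable_increment' (hW : IsWienerProcess P T 𝓕 W) {a b : ℝ} (ha : a ∈ Set.Icc 0 T)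
    (hb : b ∈ Set.Icc 0 T) : Measurable (fun ω => W b ω - W a ω) :=
  (hW.measurable_increment ha hb (le_max_left a b) (le_max_right a b)).mono (𝓕.le _) le_rfl

theorem indepFun_increment (hW : IsWienerProcess P T 𝓕 W) {β : Type*} [MeasurableSpace β]
    {a b : ℝ} (ha : a ∈ Set.Icc 0 T) (hb : b ∈ Set.Icc 0 T) (hab : a ≤ b) {Z : Ω → β}
    (hZ : Measurable[𝓕 a] Z) : IndepFun Z (fun ω => W b ω - W a ω) P :=
  (IndepFun_iff_Indep _ _ _).2
    (indep_of_indep_of_le_left (hW.indep a ha b hb hab).symm hZ.comap_le)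

theorem memLp_increment (hW : IsWienerProcess P T 𝓕 W) {a b : ℝ} (ha : a ∈ Set.Icc 0 T)
    (hb : b ∈ Set.Icc 0 T) (hab : a ≤ b) : MemLp (fun ω => W b ω - W a ω) 2 P := by
  have h := memLp_id_gaussianReal' (μ := 0) (v := Real.toNNReal (b - a)) 2 (by simp)
  rw [← hW.law a ha b hb hab] at h
  exact (memLp_map_measure_iff (by fun_prop) (hW.measurable_increment' ha hb).aemeasurable).1 h

theorem integral_increment (hW : IsWienerProcess P T 𝓕 W) {a b : ℝ} (ha : a ∈ Set.Icc 0 T)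
    (hb : b ∈ Set.Icc 0 T) (hab : a ≤ b) : ∫ ω, (W b ω - W a ω) ∂P = 0 := by
  have h := integral_id_gaussianReal (μ := 0) (v := Real.toNNReal (b - a))
  rwa [← hW.law a ha b hb hab, integral_map (hW.measurable_increment' ha hb).aemeasurable
    (by fun_prop)] at h

theorem integral_increment_sq (hW : IsWienerProcess P T 𝓕 W) {a b : ℝ} (ha : a ∈ Set.Icc 0 T)
    (hb : b ∈ Set.Icc 0 T) (hab : a ≤ b) : ∫ ω, (W b ω - W a ω) ^ 2 ∂P = b - a := by
  have h := variance_id_gaussianReal (μ := 0) (v := Real.toNNReal (b - a))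
  rw [variance_eq_integral (by fun_prop)] at h
  simp only [id, integral_id_gaussianReal, sub_zero] at h
  rwa [← hW.law a ha b hb hab, integral_map (hW.measurable_increment' ha hb).aemeasurable
    (by fun_prop), Real.coe_toNNReal _ (sub_nonneg.2 hab)] at h

theorem integral_mul_increment (hW : IsWienerProcess P T 𝓕 W) {a b : ℝ}
    (ha : a ∈ Set.Icc 0 T) (hb : b ∈ Set.Icc 0 T) (hab : a ≤ b) {Z : Ω → ℝ}
    (hZ : Measurable[𝓕 a] Z) : ∫ ω, Z ω * (W b ω - W a ω) ∂P = 0 := by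
  rw [(hW.indepFun_increment ha hb hab hZ).integral_fun_mul_eq_mul_integral
    (hZ.mono (𝓕.le _) le_rfl).aestronglyMeasurable
    (hW.measurable_increment' ha hb).aestronglyMeasurable, hW.integral_increment ha hb hab,
    mul_zero]

theorem integral_mul_increment_sq (hW : IsWienerProcess P T 𝓕 W) {a b : ℝ}
    (ha : a ∈ Set.Icc 0 T) (hb : b ∈ Set.Icc 0 T) (hab : a ≤ b) {Z : Ω → ℝ}
    (hZ : Measurable[𝓕 a] Z) :
    ∫ ω, Z ω * (W b ω - W a ω) ^ 2 ∂P = (∫ ω, Z ω ∂P) * (b - a) := by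
  rw [← hW.integral_increment_sq ha hb hab]
  exact ((hW.indepFun_increment ha hb hab hZ).comp measurable_id
    (measurable_id.pow_const 2)).integral_fun_mul_eq_mul_integral
    (hZ.mono (𝓕.le _) le_rfl).aestronglyMeasurable
    ((hW.measurable_increment' ha hb).pow_const 2).aestronglyMeasurable

theorem integrable_mul_increment_mul_increment (hW : IsWienerProcess P T 𝓕 W) {a b c d C : ℝ}
    (ha : a ∈ Set.Icc 0 T) (hb : b ∈ Set.Icc 0 T) (hab : a ≤ b) (hc : c ∈ Set.Icc 0 T)
    (hd : d ∈ Set.Icc 0 T) (hcd : c ≤ d) {Z : Ω → ℝ} (hZ : Measurable Z) (hC : ∀ ω, |Z ω| ≤ C) :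
    Integrable (fun ω => Z ω * ((W b ω - W a ω) * (W d ω - W c ω))) P :=
  ((hW.memLp_increment ha hb hab).integrable_mul (hW.memLp_increment hc hd hcd)).bdd_mul
    hZ.aestronglyMeasurable (.of_forall hC)

theorem integral_mul_increment_mul_increment_of_left_eq (hW : IsWienerProcess P T 𝓕 W)
    {a b c C : ℝ} (ha : a ∈ Set.Icc 0 T) (hb : b ∈ Set.Icc 0 T) (hc : c ∈ Set.Icc 0 T)
    (hab : a ≤ b) (hbc : b ≤ c) {Z : Ω → ℝ} (hZ : Measurable[𝓕 a] Z) (hC : ∀ ω, |Z ω| ≤ C) :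
    ∫ ω, Z ω * ((W b ω - W a ω) * (W c ω - W a ω)) ∂P = (∫ ω, Z ω ∂P) * (b - a) := by
  have hZ' := hZ.mono (𝓕.le _) le_rfl
  have horth := hW.integral_mul_increment hb hc hbc (Z := fun ω => Z ω * (W b ω - W a ω))
    ((hZ.mono (𝓕.mono hab) le_rfl).mul (hW.measurable_increment ha hb hab le_rfl))
  simp only [mul_assoc] at horth
  calc ∫ ω, Z ω * ((W b ω - W a ω) * (W c ω - W a ω)) ∂P
      = ∫ ω, (Z ω * ((W b ω - W a ω) * (W b ω - W a ω)) +
          Z ω * ((W b ω - W a ω) * (W c ω - W b ω))) ∂P := by congr with ω; ring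
    _ = (∫ ω, Z ω ∂P) * (b - a) := by
        rw [integral_add (hW.integrable_mul_increment_mul_increment ha hb hab ha hb hab hZ' hC)
          (hW.integrable_mul_increment_mul_increment ha hb hab hb hc hbc hZ' hC), horth, add_zero]
        simp only [← pow_two]
        exact hW.integral_mul_increment_sq ha hb hab hZ

theorem integral_mul_increment_mul_increment_of_left_le (hW : IsWienerProcess P T 𝓕 W)
    {a b c d C : ℝ} (ha : a ∈ Set.Icc 0 T) (hb : b ∈ Set.Icc 0 T) (hc : c ∈ Set.Icc 0 T)
    (hd : d ∈ Set.Icc 0 T) (hcd : c ≤ d) (hac : a ≤ c) {Z : Ω → ℝ}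
    (hZ : Measurable[𝓕 c] Z) (hC : ∀ ω, |Z ω| ≤ C) :
    ∫ ω, Z ω * ((W b ω - W a ω) * (W d ω - W c ω)) ∂P =
      (∫ ω, Z ω ∂P) * volume.real (Set.Ioc a b ∩ Set.Ioc c d) := by
  have hZ' := hZ.mono (𝓕.le _) le_rfl
  rw [Set.Ioc_inter_Ioc, sup_eq_right.2 hac]
  rcases le_total b c with hbc | hcb
  · have horth := hW.integral_mul_increment hc hd hcd
      (hZ.mul (hW.measurable_increment ha hb hac hbc))
    simp only [Pi.mul_apply, mul_assoc] at horth
    simp [horth, hbc]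
  have horth := hW.integral_mul_increment hc hd hcd
    (hZ.mul (hW.measurable_increment ha hc hac le_rfl))
  simp only [Pi.mul_apply, mul_assoc] at horth
  calc ∫ ω, Z ω * ((W b ω - W a ω) * (W d ω - W c ω)) ∂P
      = ∫ ω, (Z ω * ((W c ω - W a ω) * (W d ω - W c ω)) +
          Z ω * ((W b ω - W c ω) * (W d ω - W c ω))) ∂P := by congr with ω; ring
    _ = ∫ ω, Z ω * ((W b ω - W c ω) * (W d ω - W c ω)) ∂P := by
        rw [integral_add (hW.integrable_mul_increment_mul_increment ha hc hac hc hd hcd hZ' hC)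
          (hW.integrable_mul_increment_mul_increment hc hb hcb hc hd hcd hZ' hC), horth, zero_add]
    _ = (∫ ω, Z ω ∂P) * volume.real (Set.Ioc c (b ⊓ d)) := by
        rcases le_total b d with hbd | hdb
        · rw [inf_eq_left.2 hbd, Real.volume_real_Ioc_of_le hcb,
            hW.integral_mul_increment_mul_increment_of_left_eq hc hb hd hcb hbd hZ hC]
        · simp only [mul_comm (W b _ - W c _)]
          rw [inf_eq_right.2 hdb, Real.volume_real_Ioc_of_le hcd,
            hW.integral_mul_increment_mul_increment_of_left_eq hc hd hb hcd hdb hZ hC]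

theorem integral_mul_increment_mul_mul_increment (hW : IsWienerProcess P T 𝓕 W)
    {a b c d C C' : ℝ} (ha : a ∈ Set.Icc 0 T) (hb : b ∈ Set.Icc 0 T) (hab : a ≤ b)
    (hc : c ∈ Set.Icc 0 T) (hd : d ∈ Set.Icc 0 T) (hcd : c ≤ d) {X Y : Ω → ℝ}
    (hX : Measurable[𝓕 a] X) (hC : ∀ ω, |X ω| ≤ C)
    (hY : Measurable[𝓕 c] Y) (hC' : ∀ ω, |Y ω| ≤ C') :
    ∫ ω, (X ω * (W b ω - W a ω)) * (Y ω * (W d ω - W c ω)) ∂P =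
      (∫ ω, X ω * Y ω ∂P) * volume.real (Set.Ioc a b ∩ Set.Ioc c d) := by
  have hXY : ∀ ω, |X ω * Y ω| ≤ C * C' := fun ω => by
    rw [abs_mul]
    exact mul_le_mul (hC ω) (hC' ω) (abs_nonneg _) ((abs_nonneg _).trans (hC ω))
  rcases le_total a c with hac | hca
  · rw [← hW.integral_mul_increment_mul_increment_of_left_le ha hb hc hd hcd hac
      (Z := fun ω => X ω * Y ω) ((hX.mono (𝓕.mono hac) le_rfl).mul hY) hXY]
    congr with ω; ring
  · rw [Set.inter_comm, ← hW.integral_mul_increment_mul_increment_of_left_le hc hd ha hb hab hca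
      (Z := fun ω => X ω * Y ω) (hX.mul (hY.mono (𝓕.mono hca) le_rfl)) hXY]
    congr with ω; ring

end IsWienerProcess

/-! ### The Itô isometry -/

section L2

variable {α : Type*} [MeasurableSpace α] {μ : Measure α}

theorem eLpNorm_two_sq {E : Type*} [NormedAddCommGroup E] (μ : Measure α) (f : α → E) :
    eLpNorm f 2 μ ^ 2 = ∫⁻ x, ‖f x‖ₑ ^ 2 ∂μ := by
  simpa using eLpNorm_nnreal_pow_eq_lintegral (μ := μ) (f := f) (p := 2) (by norm_num)

theorem inner_toLp_toLp {f g : α → ℝ} (hf : MemLp f 2 μ) (hg : MemLp g 2 μ) :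
    inner ℝ (hf.toLp f) (hg.toLp g) = ∫ x, f x * g x ∂μ := by
  rw [L2.inner_def]
  refine integral_congr_ae ?_
  filter_upwards [hf.coeFn_toLp, hg.coeFn_toLp] with x hx hx'
  simp [hx, hx', mul_comm]

theorem norm_sq_eq_integral {E : Type*} [NormedAddCommGroup E] [InnerProductSpace ℝ E]
    (f : Lp E 2 μ) : ‖f‖ ^ 2 = ∫ x, ‖f x‖ ^ 2 ∂μ := by
  simp only [← real_inner_self_eq_norm_sq, L2.inner_def]

theorem tendsto_sq_nhds_zero_iff {ι : Type*} {l : Filter ι} {u : ι → ℝ≥0∞} :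
    Tendsto (fun i => u i ^ 2) l (𝓝 0) ↔ Tendsto u l (𝓝 0) := by
  refine ⟨fun h => ?_, fun h => by simpa using ENNReal.Tendsto.pow (n := 2) h⟩
  have hroot := ((ENNReal.continuous_rpow_const (y := (1 / 2 : ℝ))).tendsto 0).comp h
  rw [ENNReal.zero_rpow_of_pos (by norm_num)] at hroot
  refine hroot.congr fun i => ?_
  simp only [Function.comp_apply]
  rw [← ENNReal.rpow_natCast, ← ENNReal.rpow_mul]
  norm_num

end L2

/-- The square integrable curves `[0,T] → L₂(Ω)`, the Hilbert space of integrands. -/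
abbrev CurveSpace (P : Measure Ω) (T : ℝ) : Type _ :=
  Lp (Lp ℝ 2 P) 2 (volume.restrict (Set.Icc 0 T))

namespace SimpleProcess

/-- A simple process on `[0,t]` as a simple process on a longer interval `[0,T]`. -/
def extend {t : ℝ} (φ : SimpleProcess 𝓕 t) (ht : t ≤ T) : SimpleProcess 𝓕 T where
  __ := φ
  node_mem i := Set.Icc_subset_Icc_right ht (φ.node_mem i)

theorem value_eq_zero {t : ℝ} (φ : SimpleProcess 𝓕 t) {s : ℝ} (hs : s ∉ Set.Icc 0 t) (ω : Ω) :
    φ.value s ω = 0 :=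
  Finset.sum_eq_zero fun i _ => Set.indicator_of_notMem
    (fun h => hs ⟨(φ.node_mem i).1.trans h.1.le, h.2.trans (φ.node_mem (i + 1)).2⟩) _

theorem measurable_coef (φ : SimpleProcess 𝓕 T) (i : ℕ) : Measurable (φ.coef i) :=
  (φ.coef_meas i).mono (𝓕.le _) le_rfl

theorem memLp_coef [IsFiniteMeasure P] (φ : SimpleProcess 𝓕 T) (p : ℝ≥0∞) (i : ℕ) :
    MemLp (φ.coef i) p P := by
  obtain ⟨C, hC⟩ := φ.coef_bdd
  exact .of_bound (φ.measurable_coef i).aestronglyMeasurable C (.of_forall (hC i))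

theorem memLp_term [IsFiniteMeasure P] (hW : IsWienerProcess P T 𝓕 W) (φ : SimpleProcess 𝓕 T)
    (i : ℕ) : MemLp (fun ω => φ.coef i ω * (W (φ.node (i + 1)) ω - W (φ.node i) ω)) 2 P :=
  (hW.memLp_increment (φ.node_mem i) (φ.node_mem (i + 1)) (φ.node_mono (Nat.le_succ i))).mul
    (φ.memLp_coef ∞ i)

theorem memLp_integral [IsFiniteMeasure P] (hW : IsWienerProcess P T 𝓕 W)
    (φ : SimpleProcess 𝓕 T) : MemLp (φ.integral W) 2 P :=
  memLp_finsetSum _ fun i _ => φ.memLp_term hW i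

theorem measurable_integral (hW : IsWienerProcess P T 𝓕 W) (φ : SimpleProcess 𝓕 T) :
    Measurable[𝓕 T] (φ.integral W) :=
  Finset.measurable_fun_sum _ fun i _ =>
    ((φ.coef_meas i).mono (𝓕.mono (φ.node_mem i).2) le_rfl).mul
      (hW.measurable_increment (φ.node_mem i) (φ.node_mem (i + 1)) (φ.node_mem i).2
        (φ.node_mem (i + 1)).2)

section Lp

variable [IsFiniteMeasure P]

variable (P) in
/-- A simple process as an element of the space of integrands. -/
def curveLp (φ : SimpleProcess 𝓕 T) : CurveSpace P T :=
  ∑ i ∈ Finset.range φ.n,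
    indicatorConstLp 2 (measurableSet_Ioc (a := φ.node i) (b := φ.node (i + 1)))
      (measure_ne_top _ _) (φ.memLp_coef 2 i).toLp

/-- The stochastic integral of a simple process as an element of `L₂(Ω)`. -/
def integralLp (hW : IsWienerProcess P T 𝓕 W) (φ : SimpleProcess 𝓕 T) : Lp ℝ 2 P :=
  (φ.memLp_integral hW).toLp

theorem coeFn_curveLp (φ : SimpleProcess 𝓕 T) :
    ∀ᵐ s ∂volume.restrict (Set.Icc 0 T), φ.curveLp P s =ᵐ[P] φ.value s := by
  have hindicator : ∀ᵐ s ∂volume.restrict (Set.Icc 0 T), ∀ i,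
      indicatorConstLp 2 (measurableSet_Ioc (a := φ.node i) (b := φ.node (i + 1)))
        (measure_ne_top (volume.restrict (Set.Icc 0 T)) _) (φ.memLp_coef (P := P) 2 i).toLp s =
      (Set.Ioc (φ.node i) (φ.node (i + 1))).indicator (fun _ => (φ.memLp_coef 2 i).toLp) s :=
    ae_all_iff.2 fun i => indicatorConstLp_coeFn
  filter_upwards [Lp.coeFn_fun_finsetSum (Finset.range φ.n) fun i => indicatorConstLp 2
    (measurableSet_Ioc (a := φ.node i) (b := φ.node (i + 1)))
    (measure_ne_top (volume.restrict (Set.Icc 0 T)) _) (φ.memLp_coef (P := P) 2 i).toLp,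
    hindicator] with s hsum hs
  have hcoef : ∀ᵐ ω ∂P, ∀ i, (φ.memLp_coef (P := P) 2 i).toLp (φ.coef i) ω = φ.coef i ω :=
    ae_all_iff.2 fun i => (φ.memLp_coef 2 i).coeFn_toLp
  rw [curveLp, hsum, Finset.sum_congr rfl fun i _ => hs i]
  filter_upwards [Lp.coeFn_fun_finsetSum (Finset.range φ.n) fun i =>
    (Set.Ioc (φ.node i) (φ.node (i + 1))).indicator
      (fun _ => (φ.memLp_coef (P := P) 2 i).toLp (φ.coef i)) s, hcoef, Lp.coeFn_zero ℝ 2 P]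
    with ω hω hcoefω hzero
  rw [hω, value]
  refine Finset.sum_congr rfl fun i _ => ?_
  by_cases hi : s ∈ Set.Ioc (φ.node i) (φ.node (i + 1))
  · simp only [Set.indicator_of_mem hi, hcoefω]
  · simp only [Set.indicator_of_notMem hi, hzero, Pi.zero_apply]

theorem integralLp_eq_sum (hW : IsWienerProcess P T 𝓕 W) (φ : SimpleProcess 𝓕 T) :
    φ.integralLp hW = ∑ i ∈ Finset.range φ.n, (φ.memLp_term hW i).toLp := by
  have hterm : ∀ᵐ ω ∂P, ∀ i, (φ.memLp_term hW i).toLp _ ω =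
      φ.coef i ω * (W (φ.node (i + 1)) ω - W (φ.node i) ω) :=
    ae_all_iff.2 fun i => (φ.memLp_term hW i).coeFn_toLp
  refine Lp.ext ?_
  filter_upwards [(φ.memLp_integral hW).coeFn_toLp, hterm, Lp.coeFn_fun_finsetSum
    (Finset.range φ.n) fun i => (φ.memLp_term hW i).toLp] with ω hω htermω hsum
  rw [integralLp, hω, hsum, SimpleProcess.integral]
  exact Finset.sum_congr rfl fun i _ => (htermω i).symm

theorem inner_integralLp (hW : IsWienerProcess P T 𝓕 W) (φ ψ : SimpleProcess 𝓕 T) :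
    inner ℝ (φ.integralLp hW) (ψ.integralLp hW) = inner ℝ (φ.curveLp P) (ψ.curveLp P) := by
  obtain ⟨C, hC⟩ := φ.coef_bdd
  obtain ⟨C', hC'⟩ := ψ.coef_bdd
  rw [integralLp_eq_sum, integralLp_eq_sum, curveLp, curveLp, sum_inner, sum_inner]
  refine Finset.sum_congr rfl fun i _ => ?_
  rw [inner_sum, inner_sum]
  refine Finset.sum_congr rfl fun j _ => ?_
  have hsub : Set.Ioc (φ.node i) (φ.node (i + 1)) ∩ Set.Ioc (ψ.node j) (ψ.node (j + 1)) ⊆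
      Set.Icc 0 T := fun s hs =>
    ⟨(φ.node_mem i).1.trans hs.1.1.le, hs.1.2.trans (φ.node_mem (i + 1)).2⟩
  rw [inner_toLp_toLp, hW.integral_mul_increment_mul_mul_increment (φ.node_mem i)
    (φ.node_mem (i + 1)) (φ.node_mono (Nat.le_succ i)) (ψ.node_mem j) (ψ.node_mem (j + 1))
    (ψ.node_mono (Nat.le_succ j)) (φ.coef_meas i) (hC i) (ψ.coef_meas j) (hC' j),
    L2.inner_indicatorConstLp_indicatorConstLp, inner_toLp_toLp,
    measureReal_restrict_apply (measurableSet_Ioc.inter measurableSet_Ioc),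
    Set.inter_eq_left.2 hsub, smul_eq_mul, mul_comm]

theorem norm_integralLp_sub (hW : IsWienerProcess P T 𝓕 W) (φ ψ : SimpleProcess 𝓕 T) :
    ‖φ.integralLp hW - ψ.integralLp hW‖ = ‖φ.curveLp P - ψ.curveLp P‖ := by
  rw [← sq_eq_sq₀ (norm_nonneg _) (norm_nonneg _), ← real_inner_self_eq_norm_sq,
    ← real_inner_self_eq_norm_sq]
  simp only [inner_sub_left, inner_sub_right, inner_integralLp]

theorem enorm_curveLp_sub (φ : SimpleProcess 𝓕 T) :
    ∀ᵐ s ∂volume.restrict (Set.Icc 0 T), ∀ Y : Lp ℝ 2 P,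
      ‖φ.curveLp P s - Y‖ₑ = eLpNorm (fun ω => φ.value s ω - Y ω) 2 P := by
  filter_upwards [φ.coeFn_curveLp (P := P)] with s hs Y
  rw [Lp.enorm_def]
  exact eLpNorm_congr_ae ((Lp.coeFn_sub _ _).trans (hs.sub .rfl))

theorem edist_curveLp_toLp_sq (φ : SimpleProcess 𝓕 T) {Φ : ℝ → Lp ℝ 2 P}
    (hΦ : MemLp Φ 2 (volume.restrict (Set.Icc 0 T))) :
    edist (φ.curveLp P) hΦ.toLp ^ 2 = ∫⁻ s in Set.Icc 0 T,
      eLpNorm (fun ω => φ.value s ω - Φ s ω) 2 P ^ 2 := by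
  rw [Lp.edist_def, eLpNorm_two_sq]
  refine lintegral_congr_ae ?_
  filter_upwards [φ.enorm_curveLp_sub (P := P), hΦ.coeFn_toLp] with s hs hΦs
  rw [Pi.sub_apply, hΦs, hs]

theorem edist_integralLp (hW : IsWienerProcess P T 𝓕 W) (φ : SimpleProcess 𝓕 T) (Y : Lp ℝ 2 P) :
    edist (φ.integralLp hW) Y = eLpNorm (fun ω => φ.integral W ω - Y ω) 2 P := by
  rw [Lp.edist_def]
  exact eLpNorm_congr_ae ((φ.memLp_integral hW).coeFn_toLp.sub .rfl)

theorem memLp_of_lintegral_lt_top (φ : SimpleProcess 𝓕 T) {Φ : ℝ → Lp ℝ 2 P}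
    (hΦ : AEStronglyMeasurable Φ (volume.restrict (Set.Icc 0 T)))
    (hφ : ∫⁻ s in Set.Icc 0 T, eLpNorm (fun ω => φ.value s ω - Φ s ω) 2 P ^ 2 < ∞) :
    MemLp Φ 2 (volume.restrict (Set.Icc 0 T)) := by
  have hcurve : MemLp (φ.curveLp P) 2 (volume.restrict (Set.Icc 0 T)) := Lp.memLp _
  have hdiff : MemLp (⇑(φ.curveLp P) - Φ) 2 (volume.restrict (Set.Icc 0 T)) := by
    refine ⟨hcurve.1.sub hΦ, (ENNReal.pow_lt_top_iff (n := 2)).1 ?_ |>.resolve_right two_ne_zero⟩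
    rw [eLpNorm_two_sq]
    refine hφ.trans_eq' (lintegral_congr_ae ?_)
    filter_upwards [φ.enorm_curveLp_sub (P := P)] with s hs
    rw [Pi.sub_apply, hs]
  simpa using hcurve.sub hdiff

end Lp

end SimpleProcess

theorem IsItoIntegral.extend {t : ℝ} {Φ : ℝ → Lp ℝ 2 P} {Y : Lp ℝ 2 P}
    (hY : IsItoIntegral P 𝓕 W t Φ Y) (ht : t ≤ T) :
    IsItoIntegral P 𝓕 W T ((Set.Icc 0 t).indicator Φ) Y := by
  obtain ⟨hΦ, φ, hφ, hint⟩ := hY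
  have hsub : Set.Icc 0 t ⊆ Set.Icc 0 T := Set.Icc_subset_Icc_right ht
  refine ⟨?_, fun n => (φ n).extend ht, hφ.congr fun n => ?_, hint⟩
  · rwa [aestronglyMeasurable_indicator_iff measurableSet_Icc,
      Measure.restrict_restrict measurableSet_Icc, Set.inter_eq_left.2 hsub]
  rw [← Set.inter_eq_left.2 hsub, ← Measure.restrict_restrict measurableSet_Icc,
    ← lintegral_indicator measurableSet_Icc]
  refine lintegral_congr fun s => ?_
  by_cases hs : s ∈ Set.Icc 0 t
  · simp only [Set.inter_eq_left.2 hsub, Set.indicator_of_mem hs]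
    rfl
  · have hval : ∀ ω, ((φ n).extend ht).value s ω = 0 := (φ n).value_eq_zero hs
    have hzero : eLpNorm (fun ω => -(0 : Lp ℝ 2 P) ω) 2 P = 0 :=
      (eLpNorm_congr_ae (Lp.coeFn_zero ℝ 2 P).neg).trans (by simp)
    simp only [Set.inter_eq_left.2 hsub, Set.indicator_of_notMem hs, hval, zero_sub]
    rw [hzero, zero_pow two_ne_zero]

section Isometry

variable [IsFiniteMeasure P] {Φ Ψ : ℝ → Lp ℝ 2 P} {Y Z : Lp ℝ 2 P}

theorem isItoIntegral_iff (hW : IsWienerProcess P T 𝓕 W) :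
    IsItoIntegral P 𝓕 W T Φ Y ↔ ∃ hΦ : MemLp Φ 2 (volume.restrict (Set.Icc 0 T)),
      ∃ φ : ℕ → SimpleProcess 𝓕 T, Tendsto (fun n => (φ n).curveLp P) atTop (𝓝 hΦ.toLp) ∧
        Tendsto (fun n => (φ n).integralLp hW) atTop (𝓝 Y) := by
  simp only [tendsto_iff_edist_tendsto_0 (α := Lp ℝ 2 P), SimpleProcess.edist_integralLp]
  constructor
  · rintro ⟨hmeas, φ, hφ, hint⟩
    obtain ⟨n, hn⟩ := (hφ.eventually_lt_const ENNReal.zero_lt_top).exists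
    have hΦ := (φ n).memLp_of_lintegral_lt_top hmeas hn
    refine ⟨hΦ, φ, ?_, hint⟩
    rw [tendsto_iff_edist_tendsto_0, ← tendsto_sq_nhds_zero_iff]
    simpa only [SimpleProcess.edist_curveLp_toLp_sq] using hφ
  · rintro ⟨hΦ, φ, hφ, hint⟩
    refine ⟨hΦ.1, φ, ?_, hint⟩
    rw [tendsto_iff_edist_tendsto_0, ← tendsto_sq_nhds_zero_iff] at hφ
    simpa only [SimpleProcess.edist_curveLp_toLp_sq] using hφ

theorem exists_isItoIntegral (hW : IsWienerProcess P T 𝓕 W)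
    (hΦ : MemLp Φ 2 (volume.restrict (Set.Icc 0 T))) {φ : ℕ → SimpleProcess 𝓕 T}
    (hφ : Tendsto (fun n => (φ n).curveLp P) atTop (𝓝 hΦ.toLp)) :
    ∃ Y, IsItoIntegral P 𝓕 W T Φ Y ∧ Tendsto (fun n => (φ n).integralLp hW) atTop (𝓝 Y) := by
  have hcauchy : CauchySeq fun n => (φ n).integralLp hW := by
    have hcurve := hφ.cauchySeq
    simp only [Metric.cauchySeq_iff, dist_eq_norm, SimpleProcess.norm_integralLp_sub]
      at hcurve ⊢
    exact hcurve
  obtain ⟨Y, hY⟩ := cauchySeq_tendsto_of_complete hcauchy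
  exact ⟨Y, (isItoIntegral_iff hW).2 ⟨hΦ, φ, hφ, hY⟩, hY⟩

namespace IsItoIntegral

theorem memLp (hW : IsWienerProcess P T 𝓕 W) (hY : IsItoIntegral P 𝓕 W T Φ Y) :
    MemLp Φ 2 (volume.restrict (Set.Icc 0 T)) :=
  ((isItoIntegral_iff hW).1 hY).1

theorem inner_eq (hW : IsWienerProcess P T 𝓕 W) (hY : IsItoIntegral P 𝓕 W T Φ Y)
    (hZ : IsItoIntegral P 𝓕 W T Ψ Z) :
    inner ℝ Y Z = ∫ s in Set.Icc 0 T, inner ℝ (Φ s) (Ψ s) := by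
  obtain ⟨hΦ, φ, hφ, hφint⟩ := (isItoIntegral_iff hW).1 hY
  obtain ⟨hΨ, ψ, hψ, hψint⟩ := (isItoIntegral_iff hW).1 hZ
  have hlim : inner ℝ Y Z = inner ℝ hΦ.toLp hΨ.toLp :=
    tendsto_nhds_unique (hφint.inner hψint) ((hφ.inner hψ).congr fun n =>
      ((φ n).inner_integralLp hW (ψ n)).symm)
  rw [hlim, L2.inner_def]
  refine integral_congr_ae ?_
  filter_upwards [hΦ.coeFn_toLp, hΨ.coeFn_toLp] with s hs hs'
  rw [hs, hs']

theorem norm_sub_sq_eq (hW : IsWienerProcess P T 𝓕 W) (hY : IsItoIntegral P 𝓕 W T Φ Y)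
    (hZ : IsItoIntegral P 𝓕 W T Ψ Z) : ‖Y - Z‖ ^ 2 = ∫ s in Set.Icc 0 T, ‖Φ s - Ψ s‖ ^ 2 := by
  obtain ⟨hΦ, φ, hφ, hφint⟩ := (isItoIntegral_iff hW).1 hY
  obtain ⟨hΨ, ψ, hψ, hψint⟩ := (isItoIntegral_iff hW).1 hZ
  have hlim : ‖Y - Z‖ = ‖hΦ.toLp - hΨ.toLp‖ :=
    tendsto_nhds_unique (hφint.sub hψint).norm ((hφ.sub hψ).norm.congr fun n =>
      ((φ n).norm_integralLp_sub hW (ψ n)).symm)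
  rw [hlim, ← MemLp.toLp_sub hΦ hΨ, norm_sq_eq_integral]
  refine integral_congr_ae ?_
  filter_upwards [(hΦ.sub hΨ).coeFn_toLp] with s hs
  rw [hs, Pi.sub_apply]

theorem unique (hW : IsWienerProcess P T 𝓕 W) (hY : IsItoIntegral P 𝓕 W T Φ Y)
    (hZ : IsItoIntegral P 𝓕 W T Φ Z) : Y = Z := by
  simpa [sub_eq_zero] using hY.norm_sub_sq_eq hW hZ

theorem aestronglyMeasurable (hW : IsWienerProcess P T 𝓕 W) (hY : IsItoIntegral P 𝓕 W T Φ Y) :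
    AEStronglyMeasurable[𝓕 T] Y P := by
  obtain ⟨-, φ, -, hint⟩ := (isItoIntegral_iff hW).1 hY
  refine (isClosed_aestronglyMeasurable (F := ℝ) (p := 2) (μ := P) (𝓕.le T)).mem_of_tendsto hint
    (.of_forall fun n => ?_)
  exact ⟨(φ n).integral W, ((φ n).measurable_integral hW).stronglyMeasurable,
    ((φ n).memLp_integral hW).coeFn_toLp⟩

end IsItoIntegral

end Isometry

/-! ### Step functions -/

/-- The step function with the value `x i` on `(t i, t (i + 1)]` for `i < n`. -/
def stepFun (t x : ℕ → ℝ) (n : ℕ) (s : ℝ) : ℝ :=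
  ∑ i ∈ Finset.range n, (Set.Ioc (t i) (t (i + 1))).indicator (fun _ => x i) s

theorem stepFun_eq_zero_of_le {t : ℕ → ℝ} {a s : ℝ} (ht : ∀ i, a ≤ t i) (hs : s ≤ a) (x : ℕ → ℝ)
    (n : ℕ) : stepFun t x n s = 0 :=
  Finset.sum_eq_zero fun i _ => Set.indicator_of_notMem
    (fun h => (h.1.trans_le hs).not_ge (ht i)) _

theorem stepFun_eq_of_mem_Ioc {t : ℕ → ℝ} (ht : Monotone t) {n i : ℕ} (hi : i < n) {s : ℝ}
    (hs : s ∈ Set.Ioc (t i) (t (i + 1))) (x : ℕ → ℝ) : stepFun t x n s = x i := by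
  rw [stepFun, Finset.sum_eq_single_of_mem i (Finset.mem_range.2 hi), Set.indicator_of_mem hs]
  exact fun j _ hj => Set.indicator_of_notMem
    (fun h => Set.disjoint_left.1 (ht.pairwise_disjoint_on_Ioc_succ hj) h hs) _

theorem memLp_stepFun {μ : Measure ℝ} [IsFiniteMeasure μ] {p : ℝ≥0∞} (t x : ℕ → ℝ) (n : ℕ) :
    MemLp (stepFun t x n) p μ :=
  memLp_finsetSum _ fun _ _ => (memLp_const _).indicator measurableSet_Ioc

theorem exists_partition_dist_le {E : Type*} [PseudoMetricSpace E] {Φ : ℝ → E} {a b : ℝ}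
    (hab : a ≤ b) (hΦ : ContinuousOn Φ (Set.Icc a b)) {ε : ℝ} (hε : 0 < ε) :
    ∃ (t : ℕ → ℝ) (n : ℕ), Monotone t ∧ (∀ i, t i ∈ Set.Icc a b) ∧ ∀ s ∈ Set.Ioc a b,
      ∃ i < n, s ∈ Set.Ioc (t i) (t (i + 1)) ∧ dist (Φ (t i)) (Φ s) ≤ ε := by
  have hcont : Continuous ((Set.Icc a b).domRestrict Φ) := hΦ.domRestrict
  obtain ⟨t, ht0, htmono, ⟨n, hn⟩, hcover⟩ := exists_monotone_Icc_subset_open_cover_Icc hab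
    (c := fun y : E => (Set.Icc a b).domRestrict Φ ⁻¹' Metric.ball y (ε / 2))
    (fun y => Metric.isOpen_ball.preimage hcont)
    (fun s _ => Set.mem_iUnion.2 ⟨Φ s, Metric.mem_ball_self (half_pos hε)⟩)
  refine ⟨fun i => t i, n, htmono, fun i => (t i).2, fun s hs => ?_⟩
  have hmono : Monotone fun i => (t i : ℝ) := htmono
  have hs' : s ∈ ⋃ i ∈ Set.Ico 0 n, Set.Ioc (t i : ℝ) (t (i + 1)) := by
    have hunion := hmono.biUnion_Ico_Ioc_map_succ 0 n
    rw [ht0, hn n le_rfl] at hunion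
    exact hunion ▸ hs
  simp only [Set.mem_iUnion, Set.mem_Ico, exists_prop] at hs'
  obtain ⟨i, ⟨-, hi⟩, his⟩ := hs'
  obtain ⟨y, hy⟩ := hcover i
  have hleft : dist (Φ (t i)) y < ε / 2 := hy ⟨le_rfl, htmono (Nat.le_succ i)⟩
  have hright : dist (Φ s) y < ε / 2 :=
    @hy ⟨s, Set.Ioc_subset_Icc_self hs⟩ ⟨his.1.le, his.2⟩
  exact ⟨i, hi, his, by linarith [dist_triangle_right (Φ (t i)) (Φ s) y]⟩

theorem exists_pos_forall_eLpNorm_two_le (E : Type*) [NormedAddCommGroup E] (a b : ℝ) {δ : ℝ≥0∞}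
    (hδ : δ ≠ 0) : ∃ ε > 0, ∀ f : ℝ → E,
      (∀ᵐ s ∂volume.restrict (Set.Icc a b), s ∈ Set.Ioc a b → ‖f s‖ ≤ ε) →
        eLpNorm f 2 (volume.restrict (Set.Icc a b)) ≤ δ := by
  have hlim : Tendsto (fun ε => ENNReal.ofReal (b - a) ^ (2⁻¹ : ℝ) * ENNReal.ofReal ε)
      (𝓝[>] 0) (𝓝 0) := by
    have h := ENNReal.Tendsto.const_mul (a := ENNReal.ofReal (b - a) ^ (2⁻¹ : ℝ))
      (ENNReal.tendsto_ofReal (tendsto_id (x := 𝓝 (0 : ℝ)))) (.inr (by simp))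
    simpa using h.mono_left nhdsWithin_le_nhds
  obtain ⟨ε, hle, hε⟩ := ((hlim.eventually_le_const (pos_iff_ne_zero.2 hδ)).and
    self_mem_nhdsWithin).exists
  refine ⟨ε, hε, fun f hf => le_trans ?_ hle⟩
  rw [← restrict_Ioc_eq_restrict_Icc] at hf ⊢
  have h := eLpNorm_le_of_ae_bound (p := 2) ((ae_restrict_mem measurableSet_Ioc).mp hf)
  simpa using h

theorem exists_eLpNorm_sub_stepFun_le {a b : ℝ} (hab : a ≤ b) {g : ℝ → ℝ}
    (hg : MemLp g 2 (volume.restrict (Set.Icc a b))) {δ : ℝ≥0∞} (hδ : δ ≠ 0) :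
    ∃ (t x : ℕ → ℝ) (n : ℕ), Monotone t ∧ (∀ i, t i ∈ Set.Icc a b) ∧
      eLpNorm (g - stepFun t x n) 2 (volume.restrict (Set.Icc a b)) ≤ δ := by
  have hδ2 : δ / 2 ≠ 0 := (ENNReal.half_pos hδ).ne'
  obtain ⟨f, hgf, hf⟩ := hg.exists_boundedContinuous_eLpNorm_sub_le (by simp) hδ2
  obtain ⟨ε, hε, hbound⟩ := exists_pos_forall_eLpNorm_two_le ℝ a b hδ2
  obtain ⟨t, n, ht, htmem, hdist⟩ := exists_partition_dist_le hab f.continuous.continuousOn hε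
  refine ⟨t, fun i => f (t i), n, ht, htmem, ?_⟩
  set ψ : ℝ → ℝ := stepFun t (fun i => f (t i)) n
  have hψ : MemLp ψ 2 (volume.restrict (Set.Icc a b)) := memLp_stepFun _ _ _
  have hfψ : eLpNorm (⇑f - ψ) 2 (volume.restrict (Set.Icc a b)) ≤ δ / 2 := by
    refine hbound _ (.of_forall fun s hs => ?_)
    obtain ⟨i, hi, his, hle⟩ := hdist s hs
    rwa [Pi.sub_apply, show ψ s = f (t i) from stepFun_eq_of_mem_Ioc ht hi his _,
      ← dist_eq_norm, dist_comm]
  calc eLpNorm (g - ψ) 2 (volume.restrict (Set.Icc a b))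
      = eLpNorm ((g - ⇑f) + (⇑f - ψ)) 2 (volume.restrict (Set.Icc a b)) := by
        rw [sub_add_sub_cancel]
    _ ≤ δ / 2 + δ / 2 :=
        (eLpNorm_add_le (hg.1.sub hf.1) (hf.1.sub hψ.1) one_le_two).trans (add_le_add hgf hfψ)
    _ = δ := ENNReal.add_halves δ

/-! ### Existence of Itô integrals -/

theorem exists_bounded_measurable_eLpNorm_sub_le {m : MeasurableSpace Ω} (hm : m ≤ mΩ)
    {Y : Ω → ℝ} (hY : MemLp Y 2 P) (hYm : AEStronglyMeasurable[m] Y P) {δ : ℝ≥0∞} (hδ : δ ≠ 0) :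
    ∃ c : Ω → ℝ, Measurable[m] c ∧ (∃ C, ∀ ω, |c ω| ≤ C) ∧ eLpNorm (c - Y) 2 P ≤ δ := by
  obtain ⟨y, hy, hyY⟩ := hYm
  have hytrim : MemLp y 2 (P.trim hm) :=
    ⟨hy.aestronglyMeasurable, by rw [eLpNorm_trim hm hy]; exact ((memLp_congr_ae hyY).1 hY).2⟩
  obtain ⟨c, hc, -⟩ := hytrim.exists_simpleFunc_eLpNorm_sub_lt (by simp) hδ
  refine ⟨c, c.measurable, c.exists_forall_norm_le, ?_⟩
  rw [eLpNorm_trim hm (hy.sub c.stronglyMeasurable), eLpNorm_sub_comm] at hc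
  exact (eLpNorm_congr_ae ((EventuallyEq.refl _ _).sub hyY)).trans_le hc.le

theorem abs_ite_zero_le_sum {α : Type*} {c : ℕ → α → ℝ} {C : ℕ → ℝ}
    (hC : ∀ i ω, |c i ω| ≤ C i) (n i : ℕ) (ω : α) :
    |if i < n then c i ω else 0| ≤ ∑ j ∈ Finset.range n, |C j| := by
  split_ifs with hi
  · exact ((hC i ω).trans (le_abs_self _)).trans
      (Finset.single_le_sum (f := fun j => |C j|) (fun _ _ => abs_nonneg _)
        (Finset.mem_range.2 hi))
  · simpa using Finset.sum_nonneg fun j _ => abs_nonneg (C j)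

theorem exists_simpleProcess_eLpNorm_sub_le (hT : 0 ≤ T) {Φ : ℝ → Lp ℝ 2 P}
    (hΦ : ContinuousOn Φ (Set.Icc 0 T))
    (hadapted : ∀ s ∈ Set.Icc 0 T, AEStronglyMeasurable[𝓕 s] (Φ s) P) {ε : ℝ} (hε : 0 < ε) :
    ∃ φ : SimpleProcess 𝓕 T, ∀ s ∈ Set.Ioc 0 T,
      eLpNorm (fun ω => φ.value s ω - Φ s ω) 2 P ≤ ENNReal.ofReal ε := by
  obtain ⟨t, n, ht, htmem, hdist⟩ := exists_partition_dist_le hT hΦ (half_pos hε)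
  choose c hcmeas hcbdd hc using fun i => exists_bounded_measurable_eLpNorm_sub_le (𝓕.le (t i))
    (Lp.memLp (Φ (t i))) (hadapted _ (htmem i)) (ENNReal.ofReal_pos.2 (half_pos hε)).ne'
  choose C hC using hcbdd
  let φ : SimpleProcess 𝓕 T :=
    { n := n
      node := t
      node_mono := ht
      node_mem := htmem
      coef := fun i ω => if i < n then c i ω else 0
      coef_meas := fun i => by split_ifs <;> [exact hcmeas i; exact measurable_const]
      coef_bdd := ⟨_, abs_ite_zero_le_sum hC n⟩ }
  refine ⟨φ, fun s hs => ?_⟩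
  obtain ⟨i, hi, his, hle⟩ := hdist s hs
  have hval : φ.value s = c i := by
    funext ω
    exact (stepFun_eq_of_mem_Ioc ht hi his fun j => φ.coef j ω).trans (if_pos hi)
  calc eLpNorm (fun ω => φ.value s ω - Φ s ω) 2 P
      = eLpNorm ((c i - ⇑(Φ (t i))) + (⇑(Φ (t i)) - ⇑(Φ s))) 2 P := by
        rw [hval, sub_add_sub_cancel]; rfl
    _ ≤ eLpNorm (c i - ⇑(Φ (t i))) 2 P + eLpNorm (⇑(Φ (t i)) - ⇑(Φ s)) 2 P :=
        eLpNorm_add_le (((hcmeas i).mono (𝓕.le _) le_rfl).aestronglyMeasurable.sub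
          (Lp.aestronglyMeasurable _)) ((Lp.aestronglyMeasurable _).sub
          (Lp.aestronglyMeasurable _)) one_le_two
    _ ≤ ENNReal.ofReal (ε / 2) + ENNReal.ofReal (ε / 2) := by
        refine add_le_add (hc i) ?_
        rw [← Lp.edist_def, edist_dist]
        exact ENNReal.ofReal_le_ofReal hle
    _ = ENNReal.ofReal ε := by rw [← ENNReal.ofReal_add (by positivity) (by positivity),
        add_halves]

section Existence

variable [IsFiniteMeasure P] {Φ : ℝ → Lp ℝ 2 P}

theorem exists_isItoIntegral_iff (hW : IsWienerProcess P T 𝓕 W)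
    (hΦ : MemLp Φ 2 (volume.restrict (Set.Icc 0 T))) :
    (∃ Y, IsItoIntegral P 𝓕 W T Φ Y) ↔
      hΦ.toLp ∈ closure (Set.range (SimpleProcess.curveLp (𝓕 := 𝓕) (T := T) P)) := by
  refine ⟨fun ⟨Y, hY⟩ => ?_, fun h => ?_⟩
  · obtain ⟨_, φ, hφ, -⟩ := (isItoIntegral_iff hW).1 hY
    exact mem_closure_of_tendsto hφ (.of_forall fun n => ⟨φ n, rfl⟩)
  · obtain ⟨F, hF, hlim⟩ := mem_closure_iff_seq_limit.1 h
    choose φ hφ using hF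
    obtain ⟨Y, hY, -⟩ := exists_isItoIntegral hW hΦ (hlim.congr fun n => (hφ n).symm)
    exact ⟨Y, hY⟩

theorem memLp_restrict_of_continuousOn_of_isCompact {X E : Type*} [TopologicalSpace X]
    [MeasurableSpace X] [OpensMeasurableSpace X] {μ : Measure X} [IsFiniteMeasureOnCompacts μ]
    [NormedAddCommGroup E] {f : X → E} {K : Set X} (hf : ContinuousOn f K) (hK : IsCompact K)
    (hmeas : MeasurableSet K) (p : ℝ≥0∞) : MemLp f p (μ.restrict K) := by
  obtain ⟨C, hC⟩ := hK.exists_bound_of_continuousOn hf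
  have : IsFiniteMeasure (μ.restrict K) := isFiniteMeasure_restrict.2 hK.measure_lt_top.ne
  exact .of_bound (hf.aestronglyMeasurable_of_isCompact hK hmeas) C
    (ae_restrict_of_forall_mem hmeas hC)

theorem exists_isItoIntegral_of_continuousOn (hW : IsWienerProcess P T 𝓕 W) (hT : 0 ≤ T)
    (hΦ : ContinuousOn Φ (Set.Icc 0 T))
    (hadapted : ∀ s ∈ Set.Icc 0 T, AEStronglyMeasurable[𝓕 s] (Φ s) P) :
    ∃ Y, IsItoIntegral P 𝓕 W T Φ Y := by
  have hmem : MemLp Φ 2 (volume.restrict (Set.Icc 0 T)) :=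
    memLp_restrict_of_continuousOn_of_isCompact hΦ isCompact_Icc measurableSet_Icc 2
  refine (exists_isItoIntegral_iff hW hmem).2 (EMetric.mem_closure_iff.2 fun δ hδ => ?_)
  obtain ⟨δ', hδ', hlt⟩ := exists_between hδ
  obtain ⟨ε, hε, hbound⟩ := exists_pos_forall_eLpNorm_two_le (Lp ℝ 2 P) 0 T hδ'.ne'
  obtain ⟨φ, hφ⟩ := exists_simpleProcess_eLpNorm_sub_le hT hΦ hadapted hε
  refine ⟨_, ⟨φ, rfl⟩, lt_of_le_of_lt ?_ hlt⟩
  rw [edist_comm, Lp.edist_def]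
  refine hbound _ ?_
  filter_upwards [φ.enorm_curveLp_sub (P := P), hmem.coeFn_toLp] with s hs hΦs hsT
  rw [Pi.sub_apply, hΦs, ← ENNReal.ofReal_le_ofReal_iff hε.le, ofReal_norm, hs]
  exact hφ s hsT

end Existence

/-! ### Wiener integrals -/

theorem IsWienerProcess.wienerSigma_le (hW : IsWienerProcess P T 𝓕 W) : wienerSigma T W ≤ mΩ :=
  iSup₂_le fun t ht => ((hW.adapted t ht).mono (𝓕.le t) le_rfl).comap_le

section WienerIntegral

variable [IsProbabilityMeasure P] {f g : ℝ → ℝ}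

variable (P T 𝓕 W) in
/-- The Wiener integral `∫_0^T g(s) dW(s)` of a deterministic function. -/
abbrev wienerInt (g : ℝ → ℝ) : Lp ℝ 2 P := itoIntegral P 𝓕 W T fun s => Lp.const 2 P (g s)

theorem norm_lpConst (x : ℝ) : ‖Lp.const 2 P x‖ = |x| := by
  simp [Lp.norm_const]

theorem inner_lpConst (x : ℝ) (Y : Lp ℝ 2 P) : inner ℝ (Lp.const 2 P x) Y = x * ∫ ω, Y ω ∂P := by
  rw [L2.inner_def, ← integral_const_mul]
  refine integral_congr_ae ?_
  filter_upwards [Lp.coeFn_const 2 P x] with ω hω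
  simp only [hω, Function.const_apply, RCLike.inner_apply, conj_trivial, mul_comm]

theorem inner_lpConst_lpConst (x y : ℝ) :
    inner ℝ (Lp.const 2 P x) (Lp.const 2 P y) = x * y := by
  rw [inner_lpConst, integral_congr_ae (Lp.coeFn_const 2 P y)]
  simp

theorem memLp_lpConst {μ : Measure ℝ} (hg : MemLp g 2 μ) :
    MemLp (fun s => Lp.const 2 P (g s)) 2 μ :=
  hg.continuousLinearMap_comp (Lp.constL 2 P ℝ)

theorem exists_isItoIntegral_lpConst (hW : IsWienerProcess P T 𝓕 W) (hT : 0 ≤ T)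
    (hg : MemLp g 2 (volume.restrict (Set.Icc 0 T))) :
    ∃ Y, IsItoIntegral P 𝓕 W T (fun s => Lp.const 2 P (g s)) Y := by
  rw [exists_isItoIntegral_iff hW (memLp_lpConst hg), ← closure_closure]
  refine EMetric.mem_closure_iff.2 fun δ hδ => ?_
  obtain ⟨δ', hδ', hlt⟩ := exists_between hδ
  obtain ⟨f, hfg, hf⟩ := hg.exists_boundedContinuous_eLpNorm_sub_le (by simp) hδ'.ne'
  have hcont : Continuous fun s => Lp.const 2 P (f s) :=
    (Lp.constL 2 P ℝ).continuous.comp f.continuous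
  refine ⟨(memLp_lpConst hf).toLp, (exists_isItoIntegral_iff hW (memLp_lpConst hf)).1
    (exists_isItoIntegral_of_continuousOn hW hT hcont.continuousOn fun s _ =>
      aestronglyMeasurable_const.congr (Lp.coeFn_const 2 P (f s)).symm), lt_of_le_of_lt ?_ hlt⟩
  rw [Lp.edist_toLp_toLp]
  refine (eLpNorm_mono fun s => ?_).trans hfg
  rw [Pi.sub_apply, ← map_sub]
  exact (norm_lpConst _).le

theorem isItoIntegral_wienerInt (hW : IsWienerProcess P T 𝓕 W) (hT : 0 ≤ T)
    (hg : MemLp g 2 (volume.restrict (Set.Icc 0 T))) :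
    IsItoIntegral P 𝓕 W T (fun s => Lp.const 2 P (g s)) (wienerInt P T 𝓕 W g) := by
  have h := exists_isItoIntegral_lpConst hW hT hg
  rw [wienerInt, itoIntegral, dif_pos h]
  exact h.choose_spec

theorem inner_wienerInt (hW : IsWienerProcess P T 𝓕 W) (hT : 0 ≤ T)
    (hf : MemLp f 2 (volume.restrict (Set.Icc 0 T)))
    (hg : MemLp g 2 (volume.restrict (Set.Icc 0 T))) :
    inner ℝ (wienerInt P T 𝓕 W f) (wienerInt P T 𝓕 W g) = ∫ s in Set.Icc 0 T, f s * g s := by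
  simp only [(isItoIntegral_wienerInt hW hT hf).inner_eq hW (isItoIntegral_wienerInt hW hT hg),
    inner_lpConst_lpConst]

theorem IsItoIntegral.eq_wienerInt (hW : IsWienerProcess P T 𝓕 W) (hT : 0 ≤ T)
    (hg : MemLp g 2 (volume.restrict (Set.Icc 0 T))) {Y : Lp ℝ 2 P}
    (hY : IsItoIntegral P 𝓕 W T (fun s => Lp.const 2 P (g s)) Y) : Y = wienerInt P T 𝓕 W g :=
  hY.unique hW (isItoIntegral_wienerInt hW hT hg)

section InnerFamilies

variable {ι E F : Type*} [NormedAddCommGroup E] [InnerProductSpace ℝ E] [NormedAddCommGroup F]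
  [InnerProductSpace ℝ F] {x : ι → E} {y : ι → F}

theorem norm_sub_eq_of_inner_eq (hxy : ∀ i j, inner ℝ (x i) (x j) = inner ℝ (y i) (y j))
    (i j : ι) : ‖x i - x j‖ = ‖y i - y j‖ := by
  simp only [norm_eq_sqrt_real_inner, inner_sub_left, inner_sub_right, hxy]

theorem eq_add_smul_of_inner_eq (hxy : ∀ i j, inner ℝ (x i) (x j) = inner ℝ (y i) (y j))
    {i j k : ι} {c : ℝ} (hk : y k = y i + c • y j) : x k = x i + c • x j := by
  have hinner : inner ℝ (x k - (x i + c • x j)) (x k - (x i + c • x j)) =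
      inner ℝ (y k - (y i + c • y j)) (y k - (y i + c • y j)) := by
    simp only [inner_sub_left, inner_sub_right, inner_add_left, inner_add_right,
      real_inner_smul_left, real_inner_smul_right, hxy]
  rw [hk, sub_self, inner_zero_left, inner_self_eq_zero] at hinner
  exact sub_eq_zero.1 hinner

end InnerFamilies

theorem inner_wienerInt_eq_inner_toLp (hW : IsWienerProcess P T 𝓕 W) (hT : 0 ≤ T)
    (f g : {f : ℝ → ℝ // MemLp f 2 (volume.restrict (Set.Icc 0 T))}) :
    inner ℝ (wienerInt P T 𝓕 W f) (wienerInt P T 𝓕 W g) = inner ℝ f.2.toLp g.2.toLp := by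
  rw [inner_wienerInt hW hT f.2 g.2, inner_toLp_toLp]

theorem edist_wienerInt (hW : IsWienerProcess P T 𝓕 W) (hT : 0 ≤ T)
    (hf : MemLp f 2 (volume.restrict (Set.Icc 0 T)))
    (hg : MemLp g 2 (volume.restrict (Set.Icc 0 T))) :
    edist (wienerInt P T 𝓕 W f) (wienerInt P T 𝓕 W g) =
      eLpNorm (f - g) 2 (volume.restrict (Set.Icc 0 T)) := by
  have hnorm := norm_sub_eq_of_inner_eq (inner_wienerInt_eq_inner_toLp hW hT) ⟨f, hf⟩ ⟨g, hg⟩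
  rw [← Lp.edist_toLp_toLp f g hf hg, edist_dist, edist_dist, dist_eq_norm, dist_eq_norm, hnorm]

theorem wienerInt_add_smul (hW : IsWienerProcess P T 𝓕 W) (hT : 0 ≤ T)
    (hf : MemLp f 2 (volume.restrict (Set.Icc 0 T)))
    (hg : MemLp g 2 (volume.restrict (Set.Icc 0 T))) (c : ℝ) :
    wienerInt P T 𝓕 W (f + c • g) = wienerInt P T 𝓕 W f + c • wienerInt P T 𝓕 W g :=
  eq_add_smul_of_inner_eq (inner_wienerInt_eq_inner_toLp hW hT) (i := ⟨f, hf⟩) (j := ⟨g, hg⟩)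
    (k := ⟨f + c • g, hf.add (hg.const_smul c)⟩) rfl

theorem isItoIntegral_of_value_eq (hW : IsWienerProcess P T 𝓕 W) (φ : SimpleProcess 𝓕 T)
    {Φ : ℝ → Lp ℝ 2 P} (hΦ : AEStronglyMeasurable Φ (volume.restrict (Set.Icc 0 T)))
    (hφ : ∀ s, Φ s =ᵐ[P] φ.value s) : IsItoIntegral P 𝓕 W T Φ (φ.integralLp hW) := by
  have hzero : ∀ s, eLpNorm (fun ω => φ.value s ω - Φ s ω) 2 P = 0 := fun s => by
    refine (eLpNorm_congr_ae (g := 0) ?_).trans eLpNorm_zero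
    filter_upwards [hφ s] with ω hω
    rw [hω, sub_self, Pi.zero_apply]
  refine ⟨hΦ, fun _ => φ, ?_, ?_⟩
  · simp only [hzero]
    simp
  · simp only [← SimpleProcess.edist_integralLp hW, edist_self, tendsto_const_nhds]

theorem wienerInt_stepFun (hW : IsWienerProcess P T 𝓕 W) {t : ℕ → ℝ} (ht : Monotone t)
    (hmem : ∀ i, t i ∈ Set.Icc 0 T) (x : ℕ → ℝ) (n : ℕ) :
    wienerInt P T 𝓕 W (stepFun t x n) =ᵐ[P]
      fun ω => ∑ i ∈ Finset.range n, x i * (W (t (i + 1)) ω - W (t i) ω) := by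
  let φ : SimpleProcess 𝓕 T :=
    { n := n
      node := t
      node_mono := ht
      node_mem := hmem
      coef := fun i _ => if i < n then x i else 0
      coef_meas := fun _ => measurable_const
      coef_bdd := ⟨_, abs_ite_zero_le_sum (fun i _ => le_rfl (a := |x i|)) n⟩ }
  have hvalue : ∀ s ω, φ.value s ω = stepFun t x n s := fun s ω =>
    Finset.sum_congr rfl fun i hi => by simp only [φ, if_pos (Finset.mem_range.1 hi)]
  have hint : φ.integral W = fun ω =>
      ∑ i ∈ Finset.range n, x i * (W (t (i + 1)) ω - W (t i) ω) := funext fun ω =>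
    Finset.sum_congr rfl fun i hi => by simp only [φ, if_pos (Finset.mem_range.1 hi)]
  have hg : MemLp (stepFun t x n) 2 (volume.restrict (Set.Icc 0 T)) := memLp_stepFun ..
  have hφ := isItoIntegral_of_value_eq hW φ (memLp_lpConst (P := P) hg).1 fun s =>
    (Lp.coeFn_const 2 P _).trans (.of_eq (funext fun ω => (hvalue s ω).symm))
  rw [← hφ.eq_wienerInt hW ((hmem 0).1.trans (hmem 0).2) hg, ← hint]
  exact (φ.memLp_integral hW).coeFn_toLp

theorem wienerInt_mem_of_isClosed (hW : IsWienerProcess P T 𝓕 W) {a : ℝ} (ha : a ∈ Set.Icc 0 T)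
    {S : Set (Lp ℝ 2 P)} (hS : IsClosed S)
    (hstep : ∀ (t x : ℕ → ℝ) (n : ℕ), Monotone t → (∀ i, t i ∈ Set.Icc a T) →
      wienerInt P T 𝓕 W (stepFun t x n) ∈ S)
    (hg : MemLp g 2 (volume.restrict (Set.Icc 0 T))) (hg0 : ∀ s ∈ Set.Ico 0 a, g s = 0) :
    wienerInt P T 𝓕 W g ∈ S := by
  rw [← hS.closure_eq]
  refine EMetric.mem_closure_iff.2 fun δ hδ => ?_
  obtain ⟨δ', hδ', hlt⟩ := exists_between hδ
  have hsub : Set.Icc a T ⊆ Set.Icc 0 T := Set.Icc_subset_Icc_left ha.1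
  obtain ⟨t, x, n, ht, hmem, hle⟩ := exists_eLpNorm_sub_stepFun_le ha.2
    (hg.mono_measure (Measure.restrict_mono hsub le_rfl)) hδ'.ne'
  refine ⟨_, hstep t x n ht hmem, lt_of_le_of_lt ?_ hlt⟩
  have hind : g - stepFun t x n =ᵐ[volume.restrict (Set.Icc 0 T)]
      (Set.Icc a T).indicator (g - stepFun t x n) := by
    refine ae_restrict_of_forall_mem measurableSet_Icc fun s hs => ?_
    rcases lt_or_ge s a with hsa | hsa
    · rw [Set.indicator_of_notMem fun h => hsa.not_ge h.1, Pi.sub_apply, hg0 s ⟨hs.1, hsa⟩,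
        stepFun_eq_zero_of_le (fun i => (hmem i).1) hsa.le, sub_zero]
    · rw [Set.indicator_of_mem (show s ∈ Set.Icc a T from ⟨hsa, hs.2⟩)]
  rwa [edist_wienerInt hW (ha.1.trans ha.2) hg (memLp_stepFun ..), eLpNorm_congr_ae hind,
    eLpNorm_indicator_eq_eLpNorm_restrict measurableSet_Icc,
    Measure.restrict_restrict measurableSet_Icc, Set.inter_eq_left.2 hsub]

theorem aestronglyMeasurable_wienerSigma_wienerInt (hW : IsWienerProcess P T 𝓕 W) (hT : 0 ≤ T)
    (hg : MemLp g 2 (volume.restrict (Set.Icc 0 T))) :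
    AEStronglyMeasurable[wienerSigma T W] (wienerInt P T 𝓕 W g) P := by
  refine wienerInt_mem_of_isClosed hW (Set.left_mem_Icc.2 hT)
    (isClosed_aestronglyMeasurable (F := ℝ) (p := 2) (μ := P) hW.wienerSigma_le)
    (fun t x n ht hmem => ?_) hg (fun s hs => absurd hs.1 hs.2.not_ge)
  have hmeas : ∀ i, Measurable[wienerSigma T W] (W (t i)) := fun i =>
    (comap_measurable (W (t i))).mono (le_iSup₂_of_le (t i) (hmem i) le_rfl) le_rfl
  refine ⟨_, Measurable.stronglyMeasurable ?_, wienerInt_stepFun hW ht hmem x n⟩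
  exact Finset.measurable_fun_sum _ fun i _ => ((hmeas _).sub (hmeas _)).const_mul _

theorem aestronglyMeasurable_wienerInt (hW : IsWienerProcess P T 𝓕 W) {a : ℝ}
    (ha : a ∈ Set.Icc 0 T) (hg : MemLp g 2 (volume.restrict (Set.Icc 0 T)))
    (hg0 : ∀ s ∈ Set.Ioc a T, g s = 0) :
    AEStronglyMeasurable[𝓕 a] (wienerInt P T 𝓕 W g) P := by
  have hga := hg.mono_measure (Measure.restrict_mono (Set.Icc_subset_Icc_right ha.2) le_rfl)
  have hI := isItoIntegral_wienerInt (hW.mono ha.2) ha.1 hga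
  have heq : wienerInt P a 𝓕 W g = wienerInt P T 𝓕 W g := by
    rw [← sub_eq_zero, ← norm_eq_zero, ← sq_eq_zero_iff, (hI.extend ha.2).norm_sub_sq_eq hW
      (isItoIntegral_wienerInt hW (ha.1.trans ha.2) hg)]
    refine setIntegral_eq_zero_of_forall_eq_zero fun s hs => ?_
    rcases le_or_gt s a with hsa | hsa
    · simp [hs.1, hsa]
    · simp [hsa.not_ge, hg0 s ⟨hsa, hs.2⟩]
  exact heq ▸ hI.aestronglyMeasurable (hW.mono ha.2)

end WienerIntegral

/-! ### The law of a Wiener integral -/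

theorem lipschitzWith_cexp_mul_I_sub_one :
    LipschitzWith 1 fun y : ℝ => Complex.exp (y * Complex.I) - 1 := by
  refine LipschitzWith.of_dist_le_mul fun x y => ?_
  have hfactor : Complex.exp (x * Complex.I) - 1 - (Complex.exp (y * Complex.I) - 1) =
      Complex.exp (y * Complex.I) * (Complex.exp (Complex.I * (x - y : ℝ)) - 1) := by
    rw [mul_sub, ← Complex.exp_add, mul_one, sub_sub_sub_cancel_right]
    push_cast
    ring_nf
  rw [dist_eq_norm, dist_eq_norm, hfactor, norm_mul, Complex.norm_exp_ofReal_mul_I, one_mul,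
    NNReal.coe_one, one_mul]
  exact Real.norm_exp_I_mul_ofReal_sub_one_le

theorem continuous_setIntegral_comp_of_lipschitzWith [IsFiniteMeasure P] {g : ℝ → ℂ} {K : ℝ≥0}
    (hg : LipschitzWith K g) (hg0 : g 0 = 0) {A : Set Ω} (hA : MeasurableSet A) :
    Continuous fun Y : Lp ℝ 2 P => ∫ ω in A, g (Y ω) ∂P := by
  have hint (Y : Lp ℝ 2 P) : ∫ ω in A, g (Y ω) ∂P =
      inner ℂ (indicatorConstLp 2 hA (measure_ne_top P A) (1 : ℂ)) (hg.compLp hg0 Y) := by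
    rw [L2.inner_indicatorConstLp_one]
    exact setIntegral_congr_ae hA ((hg.coeFn_compLp hg0 Y).mono fun ω hω _ => hω.symm)
  simp only [hint]
  exact continuous_const.inner (hg.continuous_compLp hg0)

theorem continuous_setIntegral_cexp [IsFiniteMeasure P] {A : Set Ω} (hA : MeasurableSet A) :
    Continuous fun Y : Lp ℝ 2 P => ∫ ω in A, Complex.exp (Y ω * Complex.I) ∂P := by
  have hcexp (Y : Lp ℝ 2 P) : ∫ ω in A, Complex.exp (Y ω * Complex.I) ∂P =
      ∫ ω in A, (Complex.exp (Y ω * Complex.I) - 1) ∂P + P.real A := by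
    have hint : IntegrableOn (fun ω => Complex.exp (Y ω * Complex.I)) A P := by
      refine Integrable.of_bound (C := 1) ?_ (.of_forall fun ω => ?_)
      · exact (by fun_prop : Continuous fun y : ℝ => Complex.exp (y * Complex.I)
          ).comp_aestronglyMeasurable (Lp.aestronglyMeasurable Y).restrict
      · rw [Complex.norm_exp_ofReal_mul_I]
    rw [integral_sub hint (integrable_const _)]
    simp
  simp only [hcexp]
  exact (continuous_setIntegral_comp_of_lipschitzWith lipschitzWith_cexp_mul_I_sub_one (by simp)
    hA).add continuous_const

theorem IsWienerProcess.integral_cexp_increment (hW : IsWienerProcess P T 𝓕 W) {a b : ℝ}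
    (ha : a ∈ Set.Icc 0 T) (hb : b ∈ Set.Icc 0 T) (hab : a ≤ b) (x : ℝ) :
    ∫ ω, Complex.exp ((x * (W b ω - W a ω) : ℝ) * Complex.I) ∂P =
      Complex.exp (-(1 / 2 * (x ^ 2 * (b - a)) : ℝ)) := by
  have h := charFun_gaussianReal (μ := 0) (v := Real.toNNReal (b - a)) x
  rw [← hW.law a ha b hb hab, charFun_apply_real, integral_map
    (hW.measurable_increment' ha hb).aemeasurable (by fun_prop),
    Real.coe_toNNReal _ (sub_nonneg.2 hab)] at h
  push_cast at h ⊢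
  rw [h]
  congr 1
  ring

theorem IsWienerProcess.setIntegral_cexp_sum_increment (hW : IsWienerProcess P T 𝓕 W)
    {t : ℕ → ℝ} (ht : Monotone t) (hmem : ∀ i, t i ∈ Set.Icc 0 T) {A : Set Ω}
    (hA : MeasurableSet[𝓕 (t 0)] A) (x : ℕ → ℝ) (n : ℕ) :
    ∫ ω in A, Complex.exp
        ((∑ i ∈ Finset.range n, x i * (W (t (i + 1)) ω - W (t i) ω) : ℝ) * Complex.I) ∂P =
      P.real A * Complex.exp
        (-(1 / 2 * ∑ i ∈ Finset.range n, x i ^ 2 * (t (i + 1) - t i) : ℝ)) := by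
  induction n with
  | zero => simp
  | succ n ih =>
    have hsum : Measurable[𝓕 (t n)] fun ω =>
        ∑ i ∈ Finset.range n, x i * (W (t (i + 1)) ω - W (t i) ω) :=
      Finset.measurable_fun_sum _ fun i hi =>
        (hW.measurable_increment (hmem i) (hmem (i + 1)) (ht (Finset.mem_range.1 hi).le)
          (ht (Finset.mem_range.1 hi))).const_mul (x i)
    have hpast := (Complex.measurable_exp.comp
      ((Complex.measurable_ofReal.comp hsum).mul_const Complex.I)).indicator
        (𝓕.mono (ht n.zero_le) _ hA)
    have hind := (hW.indepFun_increment (hmem n) (hmem (n + 1)) (ht n.le_succ) hpast).comp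
      measurable_id (ψ := fun y : ℝ => Complex.exp ((x n * y : ℝ) * Complex.I)) (by fun_prop)
    have hmul := hind.integral_fun_mul_eq_mul_integral
      (hpast.mono (𝓕.le _) le_rfl).aestronglyMeasurable
      (Measurable.comp (by fun_prop)
        (hW.measurable_increment' (hmem n) (hmem (n + 1)))).aestronglyMeasurable
    simp only [Function.comp_def, id] at hmul
    rw [hW.integral_cexp_increment (hmem n) (hmem (n + 1)) (ht n.le_succ),
      integral_indicator (𝓕.le _ _ hA), ih, mul_assoc, ← Complex.exp_add] at hmul
    rw [← integral_indicator (𝓕.le _ _ hA)]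
    refine Eq.trans (integral_congr_ae (.of_forall fun ω => ?_)) (hmul.trans ?_)
    · by_cases hω : ω ∈ A
      · simp only [Set.indicator_of_mem hω, ← Complex.exp_add, ← add_mul, ← Complex.ofReal_add,
          Finset.sum_range_succ]
      · simp only [Set.indicator_of_notMem hω, zero_mul]
    · rw [Finset.sum_range_succ, mul_add, Complex.ofReal_add, neg_add]

theorem sq_stepFun {t : ℕ → ℝ} (ht : Monotone t) (x : ℕ → ℝ) (n : ℕ) (s : ℝ) :
    stepFun t x n s ^ 2 = stepFun t (x ^ 2) n s := by
  by_cases h : ∃ i < n, s ∈ Set.Ioc (t i) (t (i + 1))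
  · obtain ⟨i, hi, hs⟩ := h
    simp only [stepFun_eq_of_mem_Ioc ht hi hs, Pi.pow_apply]
  · push Not at h
    have hzero (y : ℕ → ℝ) : stepFun t y n s = 0 := Finset.sum_eq_zero fun i hi =>
      Set.indicator_of_notMem (h i (Finset.mem_range.1 hi)) _
    rw [hzero, hzero, zero_pow two_ne_zero]

theorem setIntegral_stepFun {t : ℕ → ℝ} (ht : Monotone t) (hmem : ∀ i, t i ∈ Set.Icc 0 T)
    (x : ℕ → ℝ) (n : ℕ) :
    ∫ s in Set.Icc 0 T, stepFun t x n s = ∑ i ∈ Finset.range n, x i * (t (i + 1) - t i) := by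
  simp only [stepFun]
  rw [integral_finsetSum _ fun i _ => (integrable_const _).indicator measurableSet_Ioc]
  refine Finset.sum_congr rfl fun i _ => ?_
  have hsub : Set.Ioc (t i) (t (i + 1)) ⊆ Set.Icc 0 T :=
    Set.Ioc_subset_Icc_self.trans (Set.Icc_subset_Icc (hmem i).1 (hmem (i + 1)).2)
  rw [integral_indicator measurableSet_Ioc, setIntegral_const,
    measureReal_restrict_apply measurableSet_Ioc, Set.inter_eq_left.2 hsub,
    Real.volume_real_Ioc_of_le (ht i.le_succ), smul_eq_mul, mul_comm]

section GaussianLaw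

variable [IsProbabilityMeasure P] {a : ℝ} {f g h : ℝ → ℝ}

theorem norm_wienerInt_sq (hW : IsWienerProcess P T 𝓕 W) (hT : 0 ≤ T)
    (hg : MemLp g 2 (volume.restrict (Set.Icc 0 T))) :
    ‖wienerInt P T 𝓕 W g‖ ^ 2 = ∫ s in Set.Icc 0 T, g s ^ 2 := by
  rw [← real_inner_self_eq_norm_sq, inner_wienerInt hW hT hg hg]
  simp only [pow_two]

theorem setIntegral_cexp_wienerInt (hW : IsWienerProcess P T 𝓕 W) (ha : a ∈ Set.Icc 0 T)
    (hg : MemLp g 2 (volume.restrict (Set.Icc 0 T))) (hg0 : ∀ s ∈ Set.Ico 0 a, g s = 0)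
    {A : Set Ω} (hA : MeasurableSet[𝓕 a] A) :
    ∫ ω in A, Complex.exp (wienerInt P T 𝓕 W g ω * Complex.I) ∂P =
      P.real A * Complex.exp (-(1 / 2 * ∫ s in Set.Icc 0 T, g s ^ 2 : ℝ)) := by
  have hT := ha.1.trans ha.2
  rw [← norm_wienerInt_sq hW hT hg]
  refine wienerInt_mem_of_isClosed hW ha (S := {Y | ∫ ω in A, Complex.exp (Y ω * Complex.I) ∂P =
    P.real A * Complex.exp (-(1 / 2 * ‖Y‖ ^ 2 : ℝ))}) (isClosed_eq
      (continuous_setIntegral_cexp (𝓕.le _ _ hA)) (by fun_prop)) (fun t x n ht hmem => ?_) hg hg0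
  have hmem₀ (i : ℕ) : t i ∈ Set.Icc 0 T := Set.Icc_subset_Icc_left ha.1 (hmem i)
  rw [Set.mem_ofPred_eq, norm_wienerInt_sq hW hT (memLp_stepFun ..)]
  simp only [sq_stepFun ht, setIntegral_stepFun ht hmem₀, Pi.pow_apply]
  rw [← hW.setIntegral_cexp_sum_increment ht hmem₀ (𝓕.mono (hmem 0).1 _ hA)]
  refine integral_congr_ae (ae_restrict_of_ae ?_)
  filter_upwards [wienerInt_stepFun hW ht hmem₀ x n] with ω hω
  rw [hω]

theorem wienerInt_smul (hW : IsWienerProcess P T 𝓕 W) (hT : 0 ≤ T)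
    (hg : MemLp g 2 (volume.restrict (Set.Icc 0 T))) (c : ℝ) :
    wienerInt P T 𝓕 W (c • g) = c • wienerInt P T 𝓕 W g := by
  have hadd := wienerInt_add_smul hW hT hg hg (c - 1)
  simpa only [sub_smul, one_smul, add_sub_cancel] using hadd

theorem map_restrict_wienerInt (hW : IsWienerProcess P T 𝓕 W) (ha : a ∈ Set.Icc 0 T)
    (hg : MemLp g 2 (volume.restrict (Set.Icc 0 T))) (hg0 : ∀ s ∈ Set.Ico 0 a, g s = 0)
    {A : Set Ω} (hA : MeasurableSet[𝓕 a] A) :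
    (P.restrict A).map (wienerInt P T 𝓕 W g) =
      P A • gaussianReal 0 (∫ s in Set.Icc 0 T, g s ^ 2).toNNReal := by
  have : IsFiniteMeasure (P A • gaussianReal 0 (∫ s in Set.Icc 0 T, g s ^ 2).toNNReal) :=
    ⟨by simp [measure_lt_top]⟩
  refine Measure.ext_of_charFun (funext fun u => ?_)
  have hsmul : ∀ᵐ ω ∂P, wienerInt P T 𝓕 W (u • g) ω = u * wienerInt P T 𝓕 W g ω := by
    rw [wienerInt_smul hW (ha.1.trans ha.2) hg]
    exact Lp.coeFn_smul u _
  calc charFun ((P.restrict A).map (wienerInt P T 𝓕 W g)) u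
      = ∫ ω in A, Complex.exp (wienerInt P T 𝓕 W (u • g) ω * Complex.I) ∂P := by
        rw [charFun_apply_real, integral_map (Lp.stronglyMeasurable _).measurable.aemeasurable
          (by fun_prop)]
        refine integral_congr_ae (ae_restrict_of_ae (hsmul.mono fun ω hω => ?_))
        simp only [hω, Complex.ofReal_mul]
    _ = P.real A * Complex.exp (-(1 / 2 * (u ^ 2 * ∫ s in Set.Icc 0 T, g s ^ 2) : ℝ)) := by
        rw [setIntegral_cexp_wienerInt hW ha (hg.const_smul u) (by simp +contextual [hg0]) hA]
        simp only [Pi.smul_apply, smul_eq_mul, mul_pow, integral_const_mul]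
    _ = charFun (P A • gaussianReal 0 (∫ s in Set.Icc 0 T, g s ^ 2).toNNReal) u := by
        rw [charFun_apply_real, integral_smul_measure, ← charFun_apply_real, charFun_gaussianReal,
          Real.coe_toNNReal _ (integral_nonneg fun _ => sq_nonneg _), Complex.real_smul]
        congr 2
        push_cast
        ring

theorem map_wienerInt (hW : IsWienerProcess P T 𝓕 W) (hT : 0 ≤ T)
    (hg : MemLp g 2 (volume.restrict (Set.Icc 0 T))) :
    P.map (wienerInt P T 𝓕 W g) = gaussianReal 0 (∫ s in Set.Icc 0 T, g s ^ 2).toNNReal := by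
  simpa using map_restrict_wienerInt hW (Set.left_mem_Icc.2 hT) hg
    (fun s hs => absurd hs.1 hs.2.not_ge) MeasurableSet.univ

theorem indepFun_wienerInt (hW : IsWienerProcess P T 𝓕 W) (ha : a ∈ Set.Icc 0 T)
    (hg : MemLp g 2 (volume.restrict (Set.Icc 0 T))) (hg0 : ∀ s ∈ Set.Ico 0 a, g s = 0)
    {Z : Ω → ℝ} (hZ : AEStronglyMeasurable[𝓕 a] Z P) :
    IndepFun Z (wienerInt P T 𝓕 W g) P := by
  obtain ⟨Z', hZ', hZZ'⟩ := hZ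
  refine IndepFun.congr (f := Z') ?_ hZZ'.symm (ae_eq_refl _)
  rw [indepFun_iff_measure_inter_preimage_eq_mul]
  intro s t hs ht
  have hm := (Lp.stronglyMeasurable (wienerInt P T 𝓕 W g)).measurable
  have hlaw := map_restrict_wienerInt hW ha hg hg0 (hZ'.measurable hs)
  rw [← map_wienerInt hW (ha.1.trans ha.2) hg] at hlaw
  have hlaw_t := congrArg (fun μ => μ t) hlaw
  rwa [Measure.smul_apply, smul_eq_mul, Measure.map_apply hm ht, Measure.map_apply hm ht,
    Measure.restrict_apply (hm ht), Set.inter_comm] at hlaw_t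

theorem integrable_exp_mul_wienerInt (hW : IsWienerProcess P T 𝓕 W) (hT : 0 ≤ T)
    (hg : MemLp g 2 (volume.restrict (Set.Icc 0 T))) (c : ℝ) :
    Integrable (fun ω => Real.exp (c * wienerInt P T 𝓕 W g ω)) P := by
  have hint := integrable_exp_mul_gaussianReal (μ := 0)
    (v := (∫ s in Set.Icc 0 T, g s ^ 2).toNNReal) c
  rw [← map_wienerInt hW hT hg] at hint
  exact (integrable_map_measure (by fun_prop)
    (Lp.stronglyMeasurable _).measurable.aemeasurable).1 hint

theorem memLp_exp_wienerInt (hW : IsWienerProcess P T 𝓕 W) (hT : 0 ≤ T)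
    (hg : MemLp g 2 (volume.restrict (Set.Icc 0 T))) :
    MemLp (fun ω => Real.exp (wienerInt P T 𝓕 W g ω)) 2 P := by
  rw [memLp_two_iff_integrable_sq
    (Real.continuous_exp.comp_aestronglyMeasurable (Lp.aestronglyMeasurable _))]
  simpa only [← Real.exp_nat_mul, Nat.cast_ofNat] using integrable_exp_mul_wienerInt hW hT hg 2

theorem integral_exp_wienerInt (hW : IsWienerProcess P T 𝓕 W) (hT : 0 ≤ T)
    (hg : MemLp g 2 (volume.restrict (Set.Icc 0 T))) :
    ∫ ω, Real.exp (wienerInt P T 𝓕 W g ω) ∂P =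
      Real.exp (1 / 2 * ∫ s in Set.Icc 0 T, g s ^ 2) := by
  have hmgf := mgf_gaussianReal (map_wienerInt hW hT hg) 1
  rw [Real.coe_toNNReal _ (integral_nonneg fun _ => sq_nonneg _)] at hmgf
  simp only [mgf, one_mul, zero_add, one_pow, mul_one] at hmgf
  rw [hmgf, one_div_mul_eq_div]

section Past

variable {Z : Ω → ℝ}

theorem integrable_mul_exp_wienerInt (hW : IsWienerProcess P T 𝓕 W) (ha : a ∈ Set.Icc 0 T)
    (hg : MemLp g 2 (volume.restrict (Set.Icc 0 T))) (hg0 : ∀ s ∈ Set.Ico 0 a, g s = 0)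
    (hZ : AEStronglyMeasurable[𝓕 a] Z P) (hZi : Integrable Z P) :
    Integrable (fun ω => Z ω * Real.exp (wienerInt P T 𝓕 W g ω)) P :=
  ((indepFun_wienerInt hW ha hg hg0 hZ).comp measurable_id Real.measurable_exp).integrable_mul hZi
    ((memLp_exp_wienerInt hW (ha.1.trans ha.2) hg).integrable one_le_two)

theorem integral_mul_exp_wienerInt (hW : IsWienerProcess P T 𝓕 W) (ha : a ∈ Set.Icc 0 T)
    (hg : MemLp g 2 (volume.restrict (Set.Icc 0 T))) (hg0 : ∀ s ∈ Set.Ico 0 a, g s = 0)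
    (hZ : AEStronglyMeasurable[𝓕 a] Z P) :
    ∫ ω, Z ω * Real.exp (wienerInt P T 𝓕 W g ω) ∂P =
      (∫ ω, Z ω ∂P) * Real.exp (1 / 2 * ∫ s in Set.Icc 0 T, g s ^ 2) := by
  rw [← integral_exp_wienerInt hW (ha.1.trans ha.2) hg]
  exact ((indepFun_wienerInt hW ha hg hg0 hZ).comp measurable_id
    Real.measurable_exp).integral_fun_mul_eq_mul_integral (hZ.mono (𝓕.le a))
    (Real.continuous_exp.comp_aestronglyMeasurable (Lp.aestronglyMeasurable _))

end Past

end GaussianLaw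

/-! ### Integration by parts against a stochastic exponential -/

theorem hasDerivAt_integral_mul_exp {X Z : Ω → ℝ} (hX : AEStronglyMeasurable X P)
    (hint : ∀ ε : ℝ, Integrable (fun ω => Z ω * Real.exp (ε * X ω)) P) :
    HasDerivAt (fun ε : ℝ => ∫ ω, Z ω * Real.exp (ε * X ω) ∂P) (∫ ω, Z ω * X ω ∂P) 0 := by
  have hZ : AEStronglyMeasurable Z P := by
    simpa only [zero_mul, Real.exp_zero, mul_one] using (hint 0).aestronglyMeasurable
  have hbound (ω : Ω) (ε : ℝ) (hε : ε ∈ Metric.ball 0 1) :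
      ‖Z ω * (Real.exp (ε * X ω) * X ω)‖ ≤
        ‖Z ω * Real.exp (2 * X ω)‖ + ‖Z ω * Real.exp (-2 * X ω)‖ := by
    simp only [norm_mul, Real.norm_eq_abs, Real.abs_exp, ← mul_add]
    refine mul_le_mul_of_nonneg_left ?_ (abs_nonneg _)
    have hε' : |ε| ≤ 1 := by simpa using (Metric.mem_ball.1 hε).le
    calc Real.exp (ε * X ω) * |X ω|
        ≤ Real.exp |X ω| * Real.exp |X ω| := by
          refine mul_le_mul (Real.exp_le_exp.2 ?_)
            ((le_add_of_nonneg_right zero_le_one).trans (Real.add_one_le_exp _))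
            (abs_nonneg _) (Real.exp_nonneg _)
          refine (le_abs_self _).trans ?_
          rw [abs_mul]
          exact mul_le_of_le_one_left (abs_nonneg _) hε'
      _ = Real.exp |2 * X ω| := by
          rw [← Real.exp_add, ← two_mul, abs_mul, abs_two]
      _ ≤ Real.exp (2 * X ω) + Real.exp (-2 * X ω) := by
          rw [neg_mul]
          exact Real.exp_abs_le _
  have hderiv (ω : Ω) (ε : ℝ) : HasDerivAt (fun ε : ℝ => Z ω * Real.exp (ε * X ω))
      (Z ω * (Real.exp (ε * X ω) * X ω)) ε := by
    simpa only [one_mul, id] using (((hasDerivAt_id ε).mul_const (X ω)).exp).const_mul (Z ω)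
  have h := (hasDerivAt_integral_of_dominated_loc_of_deriv_le (x₀ := (0 : ℝ))
    (Metric.ball_mem_nhds _ zero_lt_one) (.of_forall fun ε => (hint ε).aestronglyMeasurable)
    (hint 0) (hZ.mul ((by fun_prop : Continuous fun x : ℝ => Real.exp (0 * x) * x
      ).comp_aestronglyMeasurable hX))
    (.of_forall hbound) ((hint 2).norm.add (hint (-2)).norm)
    (.of_forall fun ω ε _ => hderiv ω ε)).2
  simpa only [zero_mul, Real.exp_zero, one_mul] using h

section StochExp

variable [IsProbabilityMeasure P] {f h : ℝ → ℝ}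

theorem exp_wienerInt_add_smul (hW : IsWienerProcess P T 𝓕 W) (hT : 0 ≤ T)
    (hf : MemLp f 2 (volume.restrict (Set.Icc 0 T)))
    (hh : MemLp h 2 (volume.restrict (Set.Icc 0 T))) (c : ℝ) :
    ∀ᵐ ω ∂P, Real.exp (wienerInt P T 𝓕 W (f + c • h) ω) =
      Real.exp (wienerInt P T 𝓕 W f ω) * Real.exp (c * wienerInt P T 𝓕 W h ω) := by
  rw [wienerInt_add_smul hW hT hf hh]
  filter_upwards [Lp.coeFn_add (wienerInt P T 𝓕 W f) (c • wienerInt P T 𝓕 W h),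
    Lp.coeFn_smul c (wienerInt P T 𝓕 W h)] with ω hadd hsmul
  rw [hadd, Pi.add_apply, hsmul, Pi.smul_apply, smul_eq_mul, Real.exp_add]

theorem hasDerivAt_integral_add_smul_sq {α : Type*} [MeasurableSpace α] {μ : Measure α}
    {f g : α → ℝ} (hf : MemLp f 2 μ) (hg : MemLp g 2 μ) :
    HasDerivAt (fun ε : ℝ => ∫ x, (f + ε • g) x ^ 2 ∂μ) (2 * ∫ x, f x * g x ∂μ) 0 := by
  have hnorm (ε : ℝ) : ∫ x, (f + ε • g) x ^ 2 ∂μ = ‖hf.toLp + ε • hg.toLp‖ ^ 2 := by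
    rw [← hg.toLp_const_smul, ← hf.toLp_add, ← real_inner_self_eq_norm_sq, inner_toLp_toLp]
    simp only [pow_two]
  simp only [hnorm]
  have hline : HasDerivAt (fun ε : ℝ => hf.toLp + ε • hg.toLp) hg.toLp 0 := by
    simpa using ((hasDerivAt_id (0 : ℝ)).smul_const hg.toLp).const_add hf.toLp
  simpa only [zero_smul, add_zero, inner_toLp_toLp] using hline.norm_sq

section Past

variable {a : ℝ} {Z : Ω → ℝ}

theorem exp_wienerInt_mul_exp_ae_eq (hW : IsWienerProcess P T 𝓕 W) (hT : 0 ≤ T)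
    (hf : MemLp f 2 (volume.restrict (Set.Icc 0 T)))
    (hh : MemLp h 2 (volume.restrict (Set.Icc 0 T))) (a ε : ℝ) :
    ∀ᵐ ω ∂P, Real.exp (wienerInt P T 𝓕 W h ω) * Real.exp (ε * wienerInt P T 𝓕 W f ω) =
      Real.exp (wienerInt P T 𝓕 W ((Set.Iio a).indicator h) ω) *
        Real.exp (wienerInt P T 𝓕 W ((Set.Ici a).indicator h + ε • f) ω) := by
  have hsplit : (Set.Iio a).indicator h + (1 : ℝ) • (Set.Ici a).indicator h = h := by
    rw [one_smul, ← Set.compl_Iio]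
    exact Set.indicator_self_add_compl _ _
  have hfuture : MemLp ((Set.Ici a).indicator h) 2 (volume.restrict (Set.Icc 0 T)) :=
    hh.indicator measurableSet_Ici
  have hexp := exp_wienerInt_add_smul hW hT (hh.indicator (measurableSet_Iio (a := a))) hfuture 1
  rw [hsplit] at hexp
  filter_upwards [hexp, exp_wienerInt_add_smul hW hT hfuture hf ε] with ω hω hω'
  rw [hω, hω', one_mul, mul_assoc]

theorem integrable_and_integral_mul_exp_mul_exp_wienerInt (hW : IsWienerProcess P T 𝓕 W)
    (ha : a ∈ Set.Icc 0 T) (hf : MemLp f 2 (volume.restrict (Set.Icc 0 T)))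
    (hf0 : ∀ s ∈ Set.Ico 0 a, f s = 0) (hh : MemLp h 2 (volume.restrict (Set.Icc 0 T)))
    (hZ : AEStronglyMeasurable[𝓕 a] Z P) (hZ2 : MemLp Z 2 P) (ε : ℝ) :
    Integrable (fun ω => Z ω * Real.exp (wienerInt P T 𝓕 W h ω) *
        Real.exp (ε * wienerInt P T 𝓕 W f ω)) P ∧
      ∫ ω, Z ω * Real.exp (wienerInt P T 𝓕 W h ω) * Real.exp (ε * wienerInt P T 𝓕 W f ω) ∂P =
        (∫ ω, Z ω * Real.exp (wienerInt P T 𝓕 W ((Set.Iio a).indicator h) ω) ∂P) *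
          Real.exp (1 / 2 * ∫ s in Set.Icc 0 T, ((Set.Ici a).indicator h + ε • f) s ^ 2) := by
  have hT := ha.1.trans ha.2
  have hpast : MemLp ((Set.Iio a).indicator h) 2 (volume.restrict (Set.Icc 0 T)) :=
    hh.indicator measurableSet_Iio
  have hshift : MemLp ((Set.Ici a).indicator h + ε • f) 2 (volume.restrict (Set.Icc 0 T)) :=
    (hh.indicator measurableSet_Ici).add (hf.const_smul ε)
  have hshift0 : ∀ s ∈ Set.Ico 0 a, ((Set.Ici a).indicator h + ε • f) s = 0 := fun s hs => by
    simp [hf0 s hs, hs.2]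
  have hZpast : AEStronglyMeasurable[𝓕 a]
      (fun ω => Z ω * Real.exp (wienerInt P T 𝓕 W ((Set.Iio a).indicator h) ω)) P :=
    hZ.mul (Real.continuous_exp.comp_aestronglyMeasurable
      (aestronglyMeasurable_wienerInt hW ha hpast fun s hs => by simp [hs.1.le]))
  have hsplit : (fun ω => Z ω * Real.exp (wienerInt P T 𝓕 W ((Set.Iio a).indicator h) ω) *
      Real.exp (wienerInt P T 𝓕 W ((Set.Ici a).indicator h + ε • f) ω)) =ᵐ[P]
      fun ω => Z ω * Real.exp (wienerInt P T 𝓕 W h ω) *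
        Real.exp (ε * wienerInt P T 𝓕 W f ω) := by
    filter_upwards [exp_wienerInt_mul_exp_ae_eq hW hT hf hh a ε] with ω hω
    rw [mul_assoc, mul_assoc, hω]
  refine ⟨(integrable_mul_exp_wienerInt hW ha hshift hshift0 hZpast
    (hZ2.integrable_mul (memLp_exp_wienerInt hW hT hpast))).congr hsplit, ?_⟩
  rw [← integral_mul_exp_wienerInt hW ha hshift hshift0 hZpast, integral_congr_ae hsplit]

/- Both sides are the derivative at `ε = 0` of
`E[Z exp(I(h) + ε I(f))] = E[Z exp(I(h 1_{[0,a)}))] exp(½ ∫ (h 1_{[a,T]} + ε f)²)`. -/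
theorem integral_mul_exp_mul_wienerInt (hW : IsWienerProcess P T 𝓕 W)
    (ha : a ∈ Set.Icc 0 T) (hf : MemLp f 2 (volume.restrict (Set.Icc 0 T)))
    (hf0 : ∀ s ∈ Set.Ico 0 a, f s = 0) (hh : MemLp h 2 (volume.restrict (Set.Icc 0 T)))
    (hZ : AEStronglyMeasurable[𝓕 a] Z P) (hZ2 : MemLp Z 2 P) :
    ∫ ω, Z ω * Real.exp (wienerInt P T 𝓕 W h ω) * wienerInt P T 𝓕 W f ω ∂P =
      (∫ ω, Z ω * Real.exp (wienerInt P T 𝓕 W h ω) ∂P) * ∫ s in Set.Icc 0 T, h s * f s := by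
  have hvalue := integrable_and_integral_mul_exp_mul_exp_wienerInt hW ha hf hf0 hh hZ hZ2
  have hleft := hasDerivAt_integral_mul_exp (Lp.aestronglyMeasurable (wienerInt P T 𝓕 W f))
    fun ε => (hvalue ε).1
  simp only [(hvalue _).2] at hleft
  have hright := ((hasDerivAt_integral_add_smul_sq (hh.indicator (measurableSet_Ici (a := a)))
    hf).const_mul (1 / 2)).exp.const_mul
      (∫ ω, Z ω * Real.exp (wienerInt P T 𝓕 W ((Set.Iio a).indicator h) ω) ∂P)
  have hinner : ∫ s in Set.Icc 0 T, (Set.Ici a).indicator h s * f s =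
      ∫ s in Set.Icc 0 T, h s * f s := by
    refine setIntegral_congr_fun measurableSet_Icc fun s hs => ?_
    by_cases has : s < a
    · simp [hf0 s ⟨hs.1, has⟩]
    · simp [not_lt.1 has]
  have hvalue0 := (hvalue 0).2
  simp only [zero_mul, Real.exp_zero, mul_one] at hvalue0
  rw [hleft.unique hright, hvalue0, hinner]
  ring

end Past

theorem stochExp_eq (h : ℝ → ℝ) (ω : Ω) :
    stochExp P T 𝓕 W h ω = Real.exp (wienerInt P T 𝓕 W h ω) *
      Real.exp (-(1 / 2 * ∫ s in Set.Icc 0 T, |h s| ^ 2)) := by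
  rw [← Real.exp_add, stochExp, sub_eq_add_neg]

theorem memLp_stochExp (hW : IsWienerProcess P T 𝓕 W) (hT : 0 ≤ T)
    (hh : MemLp h 2 (volume.restrict (Set.Icc 0 T))) : MemLp (stochExp P T 𝓕 W h) 2 P :=
  ((memLp_exp_wienerInt hW hT hh).mul_const _).ae_eq (.of_forall fun ω => (stochExp_eq h ω).symm)

theorem aestronglyMeasurable_wienerSigma_stochExp (hW : IsWienerProcess P T 𝓕 W) (hT : 0 ≤ T)
    (hh : MemLp h 2 (volume.restrict (Set.Icc 0 T))) :
    AEStronglyMeasurable[wienerSigma T W] (stochExp P T 𝓕 W h) P :=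
  ((Real.continuous_exp.comp_aestronglyMeasurable
    (aestronglyMeasurable_wienerSigma_wienerInt hW hT hh)).mul_const _).congr
      (.of_forall fun ω => (stochExp_eq h ω).symm)

theorem integral_stochExp (hW : IsWienerProcess P T 𝓕 W) (hT : 0 ≤ T)
    (hh : MemLp h 2 (volume.restrict (Set.Icc 0 T))) : ∫ ω, stochExp P T 𝓕 W h ω ∂P = 1 := by
  simp only [stochExp_eq]
  rw [integral_mul_const, integral_exp_wienerInt hW hT hh, ← Real.exp_add]
  simp only [sq_abs, add_neg_cancel, Real.exp_zero]

theorem integral_mul_increment_mul_stochExp (hW : IsWienerProcess P T 𝓕 W) {a b : ℝ}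
    (ha : a ∈ Set.Icc 0 T) (hb : b ∈ Set.Icc 0 T) (hab : a ≤ b)
    (hh : MemLp h 2 (volume.restrict (Set.Icc 0 T))) {Z : Ω → ℝ}
    (hZ : AEStronglyMeasurable[𝓕 a] Z P) (hZ2 : MemLp Z 2 P) :
    ∫ ω, Z ω * (W b ω - W a ω) * stochExp P T 𝓕 W h ω ∂P =
      (∫ s in Set.Icc 0 T, (Set.Ioc a b).indicator h s) *
        ∫ ω, Z ω * stochExp P T 𝓕 W h ω ∂P := by
  let t : ℕ → ℝ := fun i => if i = 0 then a else b
  have ht : Monotone t := monotone_nat_of_le_succ fun i => by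
    rcases i with _ | i <;> simp [t, hab]
  have hmem (i : ℕ) : t i ∈ Set.Icc 0 T := by
    rcases i with _ | i <;> simp [t, ha.1, ha.2, hb.1, hb.2]
  have hstep (s : ℝ) : h s * stepFun t 1 1 s = (Set.Ioc a b).indicator h s := by
    by_cases hs : s ∈ Set.Ioc a b <;> simp [stepFun, t, hs]
  have hparts := integral_mul_exp_mul_wienerInt hW ha (memLp_stepFun t 1 1)
    (fun s hs => stepFun_eq_zero_of_le (fun i => ht i.zero_le) hs.2.le 1 1) hh hZ hZ2
  simp only [hstep] at hparts
  have hincrement : ∀ᵐ ω ∂P, wienerInt P T 𝓕 W (stepFun t 1 1) ω = W b ω - W a ω := by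
    filter_upwards [wienerInt_stepFun hW ht hmem 1 1] with ω hω
    simpa [t] using hω
  simp only [stochExp_eq, ← mul_assoc, integral_mul_const]
  rw [mul_comm (∫ s in _, _), ← hparts]
  congr 1
  refine integral_congr_ae (hincrement.mono fun ω hω => ?_)
  simp only [hω, mul_right_comm]

theorem SimpleProcess.inner_integralLp_stochExp (hW : IsWienerProcess P T 𝓕 W) (hT : 0 ≤ T)
    (hh : MemLp h 2 (volume.restrict (Set.Icc 0 T))) (φ : SimpleProcess 𝓕 T)
    (hhE : MemLp (fun s => h s • (memLp_stochExp hW hT hh).toLp) 2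
      (volume.restrict (Set.Icc 0 T))) :
    inner ℝ (φ.integralLp hW) (memLp_stochExp hW hT hh).toLp =
      inner ℝ (φ.curveLp P) hhE.toLp := by
  rw [integralLp_eq_sum, curveLp, sum_inner, sum_inner]
  refine Finset.sum_congr rfl fun i _ => ?_
  have hcurve : ∫ s in Set.Ioc (φ.node i) (φ.node (i + 1)), hhE.toLp _ s
      ∂volume.restrict (Set.Icc 0 T) =
      (∫ s in Set.Icc 0 T, (Set.Ioc (φ.node i) (φ.node (i + 1))).indicator h s) •
        (memLp_stochExp hW hT hh).toLp := by
    rw [integral_indicator measurableSet_Ioc, ← integral_smul_const]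
    exact integral_congr_ae (ae_restrict_of_ae hhE.coeFn_toLp)
  rw [inner_toLp_toLp, integral_mul_increment_mul_stochExp hW (φ.node_mem i) (φ.node_mem (i + 1))
    (φ.node_mono i.le_succ) hh (φ.coef_meas i).stronglyMeasurable.aestronglyMeasurable
    (φ.memLp_coef 2 i), L2.inner_indicatorConstLp_eq_inner_setIntegral ℝ, hcurve, inner_smul_right,
    inner_toLp_toLp]

theorem inner_stochExp (hW : IsWienerProcess P T 𝓕 W) (hT : 0 ≤ T)
    (hh : MemLp h 2 (volume.restrict (Set.Icc 0 T))) (Y : Lp ℝ 2 P) :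
    inner ℝ Y (memLp_stochExp hW hT hh).toLp = ∫ ω, Y ω * stochExp P T 𝓕 W h ω ∂P := by
  rw [← inner_toLp_toLp (Lp.memLp Y), Lp.toLp_coeFn]

theorem IsItoIntegral.integral_mul_stochExp (hW : IsWienerProcess P T 𝓕 W) (hT : 0 ≤ T) {t : ℝ}
    (ht : t ≤ T) (hh : MemLp h 2 (volume.restrict (Set.Icc 0 T)))
    {Φ : ℝ → Lp ℝ 2 P} {Y : Lp ℝ 2 P} (hY : IsItoIntegral P 𝓕 W t Φ Y) :
    ∫ ω, Y ω * stochExp P T 𝓕 W h ω ∂P =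
      ∫ s in Set.Icc 0 t, h s * ∫ ω, Φ s ω * stochExp P T 𝓕 W h ω ∂P := by
  have hhE : MemLp (fun s => h s • (memLp_stochExp hW hT hh).toLp) 2
      (volume.restrict (Set.Icc 0 T)) :=
    hh.continuousLinearMap_comp
      ((ContinuousLinearMap.id ℝ ℝ).smulRight (memLp_stochExp hW hT hh).toLp)
  obtain ⟨hΦ, φ, hcurve, hint⟩ := (isItoIntegral_iff hW).1 (hY.extend ht)
  have hlim : inner ℝ Y (memLp_stochExp hW hT hh).toLp = inner ℝ hΦ.toLp hhE.toLp :=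
    tendsto_nhds_unique (hint.inner tendsto_const_nhds)
      ((hcurve.inner tendsto_const_nhds).congr fun n =>
        ((φ n).inner_integralLp_stochExp hW hT hh hhE).symm)
  simp only [← inner_stochExp hW hT hh, hlim]
  rw [L2.inner_def, ← Measure.restrict_restrict_of_subset (Set.Icc_subset_Icc_right ht)]
  refine Eq.trans (integral_congr_ae ?_) (integral_indicator measurableSet_Icc)
  filter_upwards [hΦ.coeFn_toLp, hhE.coeFn_toLp] with s hs hs'
  rw [hs, hs', inner_smul_right]
  by_cases hst : s ∈ Set.Icc 0 t <;> simp [hst]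

end StochExp

/-! ### Iterated Itô integrals -/

section Cube

variable {k : ℕ} {s : ℝ} {f : (Fin (k + 1) → ℝ) → ℝ}

theorem isCompact_cube (T : ℝ) (k : ℕ) : IsCompact (cube T k) :=
  isCompact_univ_pi fun _ => isCompact_Icc

theorem cube_mono (hs : s ≤ T) (k : ℕ) : cube s k ⊆ cube T k :=
  Set.pi_mono fun _ _ => Set.Icc_subset_Icc_right hs

theorem snoc_mem_cube {x : Fin k → ℝ} (hx : x ∈ cube T k) (hs : s ∈ Set.Icc 0 T) :
    (Fin.snoc x s : Fin (k + 1) → ℝ) ∈ cube T (k + 1) := by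
  intro i _
  refine Fin.lastCases ?_ (fun j => ?_) i
  · simpa using hs
  · simpa using hx j trivial

theorem continuousOn_uncurry_snoc (hf : ContinuousOn f (cube T (k + 1))) :
    ContinuousOn (Function.uncurry fun s (x : Fin k → ℝ) => f (Fin.snoc x s))
      (Set.Icc 0 T ×ˢ cube T k) := by
  have hsnoc : Continuous fun p : ℝ × (Fin k → ℝ) => (Fin.snoc p.2 p.1 : Fin (k + 1) → ℝ) :=
    Continuous.finSnoc (A := fun _ => ℝ) continuous_snd continuous_fst
  exact hf.comp hsnoc.continuousOn fun _ h => snoc_mem_cube h.2 h.1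

theorem continuousOn_comp_snoc (hf : ContinuousOn f (cube T (k + 1))) (hs : s ∈ Set.Icc 0 T) :
    ContinuousOn (fun x => f (Fin.snoc x s)) (cube T k) :=
  (continuousOn_uncurry_snoc hf).comp (Continuous.prodMk_right s).continuousOn fun _ hx => ⟨hs, hx⟩

end Cube

theorem IsItoIntegral.norm_sq_eq [IsFiniteMeasure P] (hW : IsWienerProcess P T 𝓕 W)
    {Φ : ℝ → Lp ℝ 2 P} {Y : Lp ℝ 2 P} (hY : IsItoIntegral P 𝓕 W T Φ Y) :
    ‖Y‖ ^ 2 = ∫ s in Set.Icc 0 T, ‖Φ s‖ ^ 2 := by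
  simp only [← real_inner_self_eq_norm_sq, hY.inner_eq hW hY]

section IteratedIto

variable [IsProbabilityMeasure P]

theorem isIteratedIto_iteratedIto_of_exists {k : ℕ} {f : (Fin k → ℝ) → ℝ}
    (h : ∃ Y, IsIteratedIto P 𝓕 W k f T Y) :
    IsIteratedIto P 𝓕 W k f T (iteratedIto P 𝓕 W f T) := by
  rw [iteratedIto, dif_pos h]
  exact h.choose_spec

namespace IsIteratedIto

variable {k : ℕ} {f g : (Fin k → ℝ) → ℝ} {Y Z : Lp ℝ 2 P} {ε M : ℝ}

theorem norm_sub_sq_le (hW : IsWienerProcess P T 𝓕 W) (hT : 0 ≤ T)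
    (hY : IsIteratedIto P 𝓕 W k f T Y) (hZ : IsIteratedIto P 𝓕 W k g T Z)
    (hfg : ∀ x ∈ cube T k, |f x - g x| ≤ ε) : ‖Y - Z‖ ^ 2 ≤ T ^ k * ε ^ 2 := by
  induction k generalizing T Y Z with
  | zero =>
    have hYf : Y = Lp.const 2 P (f Fin.elim0) := hY
    have hZg : Z = Lp.const 2 P (g Fin.elim0) := hZ
    rw [hYf, hZg, ← map_sub, norm_lpConst, pow_zero, one_mul]
    exact pow_le_pow_left₀ (abs_nonneg _) (hfg _ fun i => i.elim0) 2
  | succ k ih =>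
    obtain ⟨Φ, hΦ, hY⟩ := hY
    obtain ⟨Ψ, hΨ, hZ⟩ := hZ
    have hbound : ∀ᵐ s ∂volume.restrict (Set.Icc 0 T), ‖Φ s - Ψ s‖ ^ 2 ≤ T ^ k * ε ^ 2 := by
      filter_upwards [hΦ, hΨ, ae_restrict_mem measurableSet_Icc] with s hΦs hΨs hs
      refine (ih (hW.mono hs.2) hs.1 hΦs hΨs fun x hx =>
        hfg _ (snoc_mem_cube (cube_mono hs.2 k hx) hs)).trans ?_
      gcongr
      exacts [hs.1, hs.2]
    rw [hY.norm_sub_sq_eq hW hZ]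
    refine (integral_mono_of_nonneg (.of_forall fun _ => sq_nonneg _) (integrable_const _)
      hbound).trans_eq ?_
    simp only [integral_const, measureReal_restrict_apply_univ, Real.volume_real_Icc_of_le hT,
      sub_zero, smul_eq_mul]
    ring

theorem norm_sq_le (hW : IsWienerProcess P T 𝓕 W) (hT : 0 ≤ T)
    (hY : IsIteratedIto P 𝓕 W k f T Y) (hf : ∀ x ∈ cube T k, |f x| ≤ M) :
    ‖Y‖ ^ 2 ≤ T ^ k * M ^ 2 := by
  induction k generalizing T Y with
  | zero =>
    have hYf : Y = Lp.const 2 P (f Fin.elim0) := hY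
    rw [hYf, norm_lpConst, pow_zero, one_mul]
    exact pow_le_pow_left₀ (abs_nonneg _) (hf _ fun i => i.elim0) 2
  | succ k ih =>
    obtain ⟨Φ, hΦ, hY⟩ := hY
    have hbound : ∀ᵐ s ∂volume.restrict (Set.Icc 0 T), ‖Φ s‖ ^ 2 ≤ T ^ k * M ^ 2 := by
      filter_upwards [hΦ, ae_restrict_mem measurableSet_Icc] with s hΦs hs
      refine (ih (hW.mono hs.2) hs.1 hΦs fun x hx =>
        hf _ (snoc_mem_cube (cube_mono hs.2 k hx) hs)).trans ?_
      gcongr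
      exacts [hs.1, hs.2]
    rw [hY.norm_sq_eq hW]
    refine (integral_mono_of_nonneg (.of_forall fun _ => sq_nonneg _) (integrable_const _)
      hbound).trans_eq ?_
    simp only [integral_const, measureReal_restrict_apply_univ, Real.volume_real_Icc_of_le hT,
      sub_zero, smul_eq_mul]
    ring

theorem unique (hW : IsWienerProcess P T 𝓕 W) (hT : 0 ≤ T)
    (hY : IsIteratedIto P 𝓕 W k f T Y) (hZ : IsIteratedIto P 𝓕 W k f T Z) : Y = Z := by
  have hle := hY.norm_sub_sq_le hW hT hZ (ε := 0) (by simp)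
  rw [zero_pow two_ne_zero, mul_zero] at hle
  exact sub_eq_zero.1 (norm_eq_zero.1 (sq_eq_zero_iff.1 (hle.antisymm (sq_nonneg _))))

theorem norm_sub_sq_le_mul_sub {t : ℝ} (hW : IsWienerProcess P T 𝓕 W) (ht : t ∈ Set.Icc 0 T)
    (hY : IsIteratedIto P 𝓕 W k f t Y) (hZ : IsIteratedIto P 𝓕 W k f T Z)
    (hf : ∀ x ∈ cube T k, |f x| ≤ M) : ‖Y - Z‖ ^ 2 ≤ T ^ (k - 1) * M ^ 2 * (T - t) := by
  have hT := ht.1.trans ht.2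
  cases k with
  | zero =>
    have hYZ : Y = Z := Eq.trans hY (Eq.symm hZ)
    rw [hYZ, sub_self, norm_zero, zero_pow two_ne_zero]
    exact mul_nonneg (by positivity) (sub_nonneg.2 ht.2)
  | succ k =>
    obtain ⟨Φ, hΦ, hY⟩ := hY
    obtain ⟨Ψ, hΨ, hZ⟩ := hZ
    have hbound : ∀ᵐ s ∂volume.restrict (Set.Icc 0 T), ‖(Set.Icc 0 t).indicator Φ s - Ψ s‖ ^ 2 ≤
        (Set.Ioc t T).indicator (fun _ => T ^ k * M ^ 2) s := by
      rw [ae_restrict_iff' measurableSet_Icc] at hΦ ⊢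
      filter_upwards [hΦ, (ae_restrict_iff' measurableSet_Icc).1 hΨ] with s hΦs hΨs hs
      by_cases hst : s ≤ t
      · rw [Set.indicator_of_mem (show s ∈ Set.Icc 0 t from ⟨hs.1, hst⟩),
          Set.indicator_of_notMem fun h => h.1.not_ge hst,
          (hΦs ⟨hs.1, hst⟩).unique (hW.mono hs.2) hs.1 (hΨs hs), sub_self, norm_zero,
          zero_pow two_ne_zero]
      · rw [Set.indicator_of_notMem fun h => hst h.2, zero_sub, norm_neg,
          Set.indicator_of_mem (show s ∈ Set.Ioc t T from ⟨not_le.1 hst, hs.2⟩)]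
        refine ((hΨs hs).norm_sq_le (hW.mono hs.2) hs.1 fun x hx =>
          hf _ (snoc_mem_cube (cube_mono hs.2 k hx) hs)).trans ?_
        gcongr
        exacts [hs.1, hs.2]
    rw [(hY.extend ht.2).norm_sub_sq_eq hW hZ]
    refine (integral_mono_of_nonneg (.of_forall fun _ => sq_nonneg _)
      ((integrable_const _).indicator measurableSet_Ioc) hbound).trans_eq ?_
    rw [integral_indicator measurableSet_Ioc, setIntegral_const,
      measureReal_restrict_apply measurableSet_Ioc,
      Set.inter_eq_left.2 (Set.Ioc_subset_Icc_self.trans (Set.Icc_subset_Icc_left ht.1)),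
      Real.volume_real_Ioc_of_le ht.2, smul_eq_mul, mul_comm, Nat.add_sub_cancel]

theorem aestronglyMeasurable (hW : IsWienerProcess P T 𝓕 W)
    (hY : IsIteratedIto P 𝓕 W k f T Y) : AEStronglyMeasurable[𝓕 T] Y P := by
  cases k with
  | zero =>
    have hYf : Y = Lp.const 2 P (f Fin.elim0) := hY
    rw [hYf]
    exact aestronglyMeasurable_const.congr (Lp.coeFn_const 2 P _).symm
  | succ k =>
    obtain ⟨Φ, -, hI⟩ := hY
    exact hI.aestronglyMeasurable hW

end IsIteratedIto

theorem continuousOn_iteratedIto (hW : IsWienerProcess P T 𝓕 W) {k : ℕ}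
    {f : (Fin k → ℝ) → ℝ} (hf : ContinuousOn f (cube T k))
    (hex : ∀ t ∈ Set.Icc 0 T, ∃ Y, IsIteratedIto P 𝓕 W k f t Y) :
    ContinuousOn (iteratedIto P 𝓕 W f) (Set.Icc 0 T) := by
  obtain ⟨M, hM⟩ := (isCompact_cube T k).exists_bound_of_continuousOn hf
  intro s hs
  have hle {t t' : ℝ} (ht : t ∈ Set.Icc 0 T) (ht' : t' ∈ Set.Icc 0 T) (htt' : t ≤ t') :
      ‖iteratedIto P 𝓕 W f t - iteratedIto P 𝓕 W f t'‖ ^ 2 ≤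
        T ^ (k - 1) * M ^ 2 * |t - t'| := by
    refine ((isIteratedIto_iteratedIto_of_exists (hex t ht)).norm_sub_sq_le_mul_sub (hW.mono ht'.2)
      ⟨ht.1, htt'⟩ (isIteratedIto_iteratedIto_of_exists (hex t' ht'))
      fun x hx => hM x (cube_mono ht'.2 k hx)).trans ?_
    rw [abs_sub_comm, abs_of_nonneg (sub_nonneg.2 htt')]
    gcongr
    exacts [ht'.1, ht'.2]
  have hle_abs : ∀ t ∈ Set.Icc 0 T, ‖iteratedIto P 𝓕 W f t - iteratedIto P 𝓕 W f s‖ ^ 2 ≤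
      T ^ (k - 1) * M ^ 2 * |t - s| := by
    intro t ht
    rcases le_total t s with hts | hst
    · exact hle ht hs hts
    · rw [norm_sub_rev, abs_sub_comm]
      exact hle hs ht hst
  have hlim : Tendsto (fun t => √(T ^ (k - 1) * M ^ 2 * |t - s|)) (𝓝[Set.Icc 0 T] s) (𝓝 0) := by
    have hcont : Continuous fun t => √(T ^ (k - 1) * M ^ 2 * |t - s|) := by fun_prop
    simpa using (hcont.tendsto s).mono_left nhdsWithin_le_nhds
  refine tendsto_iff_norm_sub_tendsto_zero.2 (squeeze_zero' (.of_forall fun _ => norm_nonneg _)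
    (eventually_mem_nhdsWithin.mono fun t ht => Real.le_sqrt_of_sq_le (hle_abs t ht)) hlim)

theorem continuousOn_iteratedIto_comp_snoc (hW : IsWienerProcess P T 𝓕 W) {k : ℕ}
    {f : (Fin (k + 1) → ℝ) → ℝ} (hf : ContinuousOn f (cube T (k + 1)))
    (hex : ∀ g : (Fin k → ℝ) → ℝ, ContinuousOn g (cube T k) →
      ∀ t ∈ Set.Icc 0 T, ∃ Y, IsIteratedIto P 𝓕 W k g t Y) :
    ContinuousOn (fun s => iteratedIto P 𝓕 W (fun x : Fin k → ℝ => f (Fin.snoc x s)) s)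
      (Set.Icc 0 T) := by
  intro s₀ hs₀
  set F : ℝ → ℝ → Lp ℝ 2 P := fun r t =>
    iteratedIto P 𝓕 W (fun x : Fin k → ℝ => f (Fin.snoc x r)) t with hF
  have hF_spec {r t : ℝ} (hr : r ∈ Set.Icc 0 T) (ht : t ∈ Set.Icc 0 T) :
      IsIteratedIto P 𝓕 W k (fun x => f (Fin.snoc x r)) t (F r t) :=
    isIteratedIto_iteratedIto_of_exists (hex _ (continuousOn_comp_snoc hf hr) t ht)
  have htime : Tendsto (F s₀) (𝓝[Set.Icc 0 T] s₀) (𝓝 (F s₀ s₀)) :=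
    continuousOn_iteratedIto hW (continuousOn_comp_snoc hf hs₀)
      (hex _ (continuousOn_comp_snoc hf hs₀)) s₀ hs₀
  have hkernel : Tendsto (fun s => F s s - F s₀ s) (𝓝[Set.Icc 0 T] s₀) (𝓝 0) := by
    rw [Metric.tendsto_nhds]
    intro ε hε
    obtain ⟨δ, hδ, hδε⟩ : ∃ δ > 0, T ^ k * δ ^ 2 < ε ^ 2 := by
      have hcont : Continuous fun δ : ℝ => T ^ k * δ ^ 2 := by fun_prop
      have hev : ∀ᶠ δ in 𝓝[>] (0 : ℝ), T ^ k * δ ^ 2 < ε ^ 2 :=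
        nhdsWithin_le_nhds (hcont.continuousAt.eventually_lt_const (by simpa using pow_pos hε 2))
      obtain ⟨δ, hlt, hpos⟩ := (hev.and self_mem_nhdsWithin).exists
      exact ⟨δ, hpos, hlt⟩
    obtain ⟨v, hv, hvδ⟩ := (isCompact_cube T k).mem_uniformity_of_prod
      (continuousOn_uncurry_snoc hf) hs₀ (Metric.dist_mem_uniformity hδ)
    filter_upwards [hv, self_mem_nhdsWithin] with s hsv hs
    have hsub := (hF_spec hs hs).norm_sub_sq_le (hW.mono hs.2) hs.1 (hF_spec hs₀ hs)
      fun x hx => (hvδ s hsv x (cube_mono hs.2 k hx)).le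
    rw [dist_zero_right]
    refine lt_of_pow_lt_pow_left₀ 2 hε.le (hsub.trans_lt (lt_of_le_of_lt ?_ hδε))
    gcongr
    exacts [hs.1, hs.2]
  simpa [ContinuousWithinAt, hF] using hkernel.add htime

theorem exists_isIteratedIto (hW : IsWienerProcess P T 𝓕 W) (hT : 0 ≤ T) {k : ℕ}
    {f : (Fin k → ℝ) → ℝ} (hf : ContinuousOn f (cube T k)) :
    ∃ Y, IsIteratedIto P 𝓕 W k f T Y := by
  induction k generalizing T with
  | zero => exact ⟨_, rfl⟩
  | succ k ih =>
    have hex (g : (Fin k → ℝ) → ℝ) (hg : ContinuousOn g (cube T k)) (t : ℝ)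
        (ht : t ∈ Set.Icc 0 T) : ∃ Y, IsIteratedIto P 𝓕 W k g t Y :=
      ih (hW.mono ht.2) ht.1 (hg.mono (cube_mono ht.2 k))
    have hspec (s : ℝ) (hs : s ∈ Set.Icc 0 T) :=
      isIteratedIto_iteratedIto_of_exists (hex _ (continuousOn_comp_snoc hf hs) s hs)
    obtain ⟨Y, hY⟩ := exists_isItoIntegral_of_continuousOn hW hT
      (continuousOn_iteratedIto_comp_snoc hW hf hex)
      fun s hs => (hspec s hs).aestronglyMeasurable (hW.mono hs.2)
    exact ⟨Y, _, ae_restrict_of_forall_mem measurableSet_Icc hspec, hY⟩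

theorem isIteratedIto_iteratedIto (hW : IsWienerProcess P T 𝓕 W) (hT : 0 ≤ T) {k : ℕ}
    {f : (Fin k → ℝ) → ℝ} (hf : ContinuousOn f (cube T k)) :
    IsIteratedIto P 𝓕 W k f T (iteratedIto P 𝓕 W f T) :=
  isIteratedIto_iteratedIto_of_exists (exists_isIteratedIto hW hT hf)

/-- The deterministic iterated integral
`∫_0^t ∫_0^{s_k} ⋯ ∫_0^{s_2} f(s_1, …, s_k) h(s_1) ⋯ h(s_k) ds_1 ⋯ ds_k`, by the same recursion as
`IsIteratedIto`. -/
def iteratedIntegral (h : ℝ → ℝ) : (k : ℕ) → ((Fin k → ℝ) → ℝ) → ℝ → ℝ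
  | 0, f, _ => f Fin.elim0
  | k + 1, f, t => ∫ s in Set.Icc 0 t, h s * iteratedIntegral h k (fun x => f (Fin.snoc x s)) s

theorem IsIteratedIto.integral_mul_stochExp (hW : IsWienerProcess P T 𝓕 W) {h : ℝ → ℝ}
    (hh : MemLp h 2 (volume.restrict (Set.Icc 0 T))) {k : ℕ} {f : (Fin k → ℝ) → ℝ} {t : ℝ}
    {Y : Lp ℝ 2 P} (ht : t ∈ Set.Icc 0 T) (hY : IsIteratedIto P 𝓕 W k f t Y) :
    ∫ ω, Y ω * stochExp P T 𝓕 W h ω ∂P = iteratedIntegral h k f t := by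
  induction k generalizing t Y with
  | zero =>
    have hYf : Y = Lp.const 2 P (f Fin.elim0) := hY
    calc ∫ ω, Y ω * stochExp P T 𝓕 W h ω ∂P
        = ∫ ω, f Fin.elim0 * stochExp P T 𝓕 W h ω ∂P := by
          rw [hYf]
          refine integral_congr_ae ?_
          filter_upwards [Lp.coeFn_const 2 P (f Fin.elim0)] with ω hω
          rw [hω, Function.const_apply]
      _ = f Fin.elim0 := by
          rw [integral_const_mul, integral_stochExp hW (ht.1.trans ht.2) hh, mul_one]
  | succ k ih =>
    obtain ⟨Φ, hΦ, hY⟩ := hY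
    rw [hY.integral_mul_stochExp hW (ht.1.trans ht.2) ht.2 hh]
    refine integral_congr_ae ?_
    filter_upwards [hΦ, ae_restrict_mem measurableSet_Icc] with s hΦs hs
    rw [ih ⟨hs.1, hs.2.trans ht.2⟩ hΦs]

end IteratedIto

end WienerProcess

/-! ### Integrals of symmetric functions over simplices and cubes -/

section SymmetricFunctions

variable {T s : ℝ} {k n : ℕ}

theorem measurableSet_cube (T : ℝ) (k : ℕ) : MeasurableSet (cube T k) :=
  MeasurableSet.univ_pi fun _ => measurableSet_Icc

theorem volume_restrict_cube (T : ℝ) (k : ℕ) :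
    (volume : Measure (Fin k → ℝ)).restrict (cube T k) =
      Measure.pi fun _ => volume.restrict (Set.Icc 0 T) := by
  rw [volume_pi, cube, Measure.restrict_pi_pi]

theorem comp_perm_mem_cube (σ : Equiv.Perm (Fin n)) {y : Fin n → ℝ} :
    y ∘ σ ∈ cube T n ↔ y ∈ cube T n :=
  ⟨fun h i _ => by simpa using h (σ.symm i) trivial, fun h i _ => h (σ i) trivial⟩

theorem setIntegral_preimage_comp_perm (σ : Equiv.Perm (Fin n)) (G : (Fin n → ℝ) → ℝ)
    (S : Set (Fin n → ℝ)) :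
    ∫ y in (fun y : Fin n → ℝ => y ∘ σ) ⁻¹' S, G (y ∘ σ) = ∫ y in S, G y :=
  (volume_preserving_arrowCongr' σ.symm (MeasurableEquiv.refl ℝ)
    (MeasurePreserving.id _)).setIntegral_preimage_emb
      (MeasurableEquiv.arrowCongr' σ.symm (MeasurableEquiv.refl ℝ)).measurableEmbedding G S

/-- The part of the cube `[0,T]^n` where the coordinate `j` is the largest one. Up to null sets, the
cube is the disjoint union of these `n` regions. -/
def maxRegion (T : ℝ) (j : Fin n) : Set (Fin n → ℝ) := {y ∈ cube T n | ∀ i, y i ≤ y j}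

theorem measurableSet_maxRegion (T : ℝ) (j : Fin n) : MeasurableSet (maxRegion T j) := by
  have hinter : maxRegion T j = cube T n ∩ ⋂ i, {y | y i ≤ y j} := by
    ext y
    simp [maxRegion]
  rw [hinter]
  exact (measurableSet_cube T n).inter (.iInter fun i =>
    measurableSet_le (measurable_pi_apply i) (measurable_pi_apply j))

theorem iUnion_maxRegion (T : ℝ) (k : ℕ) :
    ⋃ j : Fin (k + 1), maxRegion T j = cube T (k + 1) := by
  ext y
  refine ⟨fun hy => (Set.mem_iUnion.1 hy).choose_spec.1, fun hy => Set.mem_iUnion.2 ?_⟩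
  obtain ⟨j, hj⟩ := Finite.exists_max y
  exact ⟨j, hy, hj⟩

theorem volume_diagonal {i j : Fin n} (hij : i ≠ j) :
    volume {y : Fin n → ℝ | y i = y j} = 0 := by
  let S : Submodule ℝ (Fin n → ℝ) :=
    LinearMap.ker (LinearMap.proj (R := ℝ) (φ := fun _ : Fin n => ℝ) i - LinearMap.proj j)
  have hS : (S : Set (Fin n → ℝ)) = {y | y i = y j} := by
    ext y
    simp [S, sub_eq_zero]
  rw [← hS]
  refine Measure.addHaar_submodule volume S fun htop => ?_
  have hmem : (Pi.single i 1 : Fin n → ℝ) ∈ S := htop ▸ Submodule.mem_top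
  simp [S, hij.symm] at hmem

theorem aedisjoint_maxRegion (T : ℝ) {i j : Fin n} (hij : i ≠ j) :
    AEDisjoint volume (maxRegion T i) (maxRegion T j) :=
  measure_mono_null (fun _ hy => le_antisymm (hy.2.2 i) (hy.1.2 j)) (volume_diagonal hij)

theorem setIntegral_maxRegion {G : (Fin n → ℝ) → ℝ}
    (hsymm : ∀ σ : Equiv.Perm (Fin n), ∀ y ∈ cube T n, G (y ∘ σ) = G y) (i j : Fin n) :
    ∫ y in maxRegion T i, G y = ∫ y in maxRegion T j, G y := by
  let σ := Equiv.swap i j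
  have hpre : (fun y : Fin n → ℝ => y ∘ σ) ⁻¹' maxRegion T j = maxRegion T i := by
    ext y
    refine and_congr (comp_perm_mem_cube σ) ⟨fun h l => ?_, fun h l => ?_⟩
    · simpa [σ] using h (σ.symm l)
    · simpa [σ] using h (σ l)
  rw [← setIntegral_preimage_comp_perm σ G (maxRegion T j), hpre]
  exact setIntegral_congr_fun (measurableSet_maxRegion T i) fun y hy => (hsymm σ y hy.1).symm

theorem snoc_mem_maxRegion {x : Fin k → ℝ} :
    (Fin.snoc x s : Fin (k + 1) → ℝ) ∈ maxRegion T (Fin.last k) ↔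
      s ∈ Set.Icc 0 T ∧ x ∈ cube s k := by
  constructor
  · rintro ⟨hcube, hmax⟩
    have hs : s ∈ Set.Icc 0 T := by simpa using hcube (Fin.last k) trivial
    refine ⟨hs, fun i _ => ⟨?_, ?_⟩⟩
    · simpa using (hcube i.castSucc trivial).1
    · simpa using hmax i.castSucc
  · rintro ⟨hs, hx⟩
    refine ⟨snoc_mem_cube (cube_mono hs.2 k hx) hs, fun i => ?_⟩
    refine Fin.lastCases ?_ (fun j => ?_) i
    · simp
    · simpa using (hx j trivial).2

theorem setIntegral_maxRegion_last {G : (Fin (k + 1) → ℝ) → ℝ}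
    (hG : IntegrableOn G (cube T (k + 1))) :
    ∫ y in maxRegion T (Fin.last k), G y =
      ∫ s in Set.Icc 0 T, ∫ x in cube s k, G (Fin.snoc x s) := by
  let e := (MeasurableEquiv.piFinSuccAbove (fun _ : Fin (k + 1) => ℝ) (Fin.last k)).symm
  have he : MeasurePreserving e volume volume :=
    (volume_preserving_piFinSuccAbove (fun _ : Fin (k + 1) => ℝ) (Fin.last k)).symm _
  have he_apply (s : ℝ) (x : Fin k → ℝ) : e (s, x) = Fin.snoc x s := Fin.insertNth_last' s x
  have hmeas := measurableSet_maxRegion T (Fin.last k)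
  have hint : Integrable (fun z => (maxRegion T (Fin.last k)).indicator G (e z)) :=
    he.integrable_comp_of_integrable
      ((hG.mono_set fun y hy => hy.1).integrable_indicator hmeas)
  have hsection (s : ℝ) : ∫ x, (maxRegion T (Fin.last k)).indicator G (Fin.snoc x s) =
      (Set.Icc 0 T).indicator (fun s => ∫ x in cube s k, G (Fin.snoc x s)) s := by
    by_cases hs : s ∈ Set.Icc 0 T
    · rw [Set.indicator_of_mem hs, ← integral_indicator (measurableSet_cube s k)]
      congr 1 with x
      by_cases hx : x ∈ cube s k
      · rw [Set.indicator_of_mem hx, Set.indicator_of_mem (snoc_mem_maxRegion.2 ⟨hs, hx⟩)]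
      · rw [Set.indicator_of_notMem hx,
          Set.indicator_of_notMem fun h => hx (snoc_mem_maxRegion.1 h).2]
    · rw [Set.indicator_of_notMem hs]
      exact integral_eq_zero_of_ae (.of_forall fun x =>
        Set.indicator_of_notMem (fun h => hs (snoc_mem_maxRegion.1 h).1) _)
  rw [← integral_indicator hmeas, ← he.integral_comp', Measure.volume_eq_prod,
    integral_prod _ hint, ← integral_indicator measurableSet_Icc]
  simp only [he_apply, hsection]

theorem setIntegral_cube_succ {G : (Fin (k + 1) → ℝ) → ℝ}
    (hG : IntegrableOn G (cube T (k + 1)))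
    (hsymm : ∀ σ : Equiv.Perm (Fin (k + 1)), ∀ y ∈ cube T (k + 1), G (y ∘ σ) = G y) :
    ∫ y in cube T (k + 1), G y =
      (k + 1) * ∫ s in Set.Icc 0 T, ∫ x in cube s k, G (Fin.snoc x s) :=
  calc ∫ y in cube T (k + 1), G y
      = ∑ j : Fin (k + 1), ∫ y in maxRegion T j, G y := by
        rw [← iUnion_maxRegion, integral_iUnion_ae
          (fun j => (measurableSet_maxRegion T j).nullMeasurableSet)
          (fun i j hij => aedisjoint_maxRegion T hij) (by rwa [iUnion_maxRegion]), tsum_fintype]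
    _ = ∑ _j : Fin (k + 1), ∫ y in maxRegion T (Fin.last k), G y :=
        Finset.sum_congr rfl fun j _ => setIntegral_maxRegion hsymm j _
    _ = (k + 1) * ∫ s in Set.Icc 0 T, ∫ x in cube s k, G (Fin.snoc x s) := by
        simp [setIntegral_maxRegion_last hG]

theorem integrableOn_mul_prod {h : ℝ → ℝ} (hh : IntegrableOn h (Set.Icc 0 T))
    {f : (Fin k → ℝ) → ℝ} (hf : ContinuousOn f (cube T k)) :
    IntegrableOn (fun x => f x * ∏ j, h (x j)) (cube T k) := by
  obtain ⟨M, hM⟩ := (isCompact_cube T k).exists_bound_of_continuousOn hf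
  have hprod : IntegrableOn (fun x : Fin k → ℝ => ∏ j, h (x j)) (cube T k) := by
    rw [IntegrableOn, volume_restrict_cube]
    exact Integrable.fintype_prod fun _ => hh
  exact hprod.bdd_mul (hf.aestronglyMeasurable (measurableSet_cube T k))
    (ae_restrict_of_forall_mem (measurableSet_cube T k) hM)

theorem exists_snoc_comp_perm_eq (σ : Equiv.Perm (Fin k)) (x : Fin k → ℝ) (s : ℝ) :
    ∃ τ : Equiv.Perm (Fin (k + 1)),
      (Fin.snoc (x ∘ σ) s : Fin (k + 1) → ℝ) = (Fin.snoc x s : Fin (k + 1) → ℝ) ∘ τ := by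
  let e : Fin (k + 1) ≃ Option (Fin k) := finSuccEquivLast
  refine ⟨(e.trans (Equiv.optionCongr σ)).trans e.symm, ?_⟩
  funext i
  refine Fin.lastCases ?_ (fun j => ?_) i
  · simp [e]
  · simp [e]

theorem iteratedIntegral_eq_setIntegral_cube {h : ℝ → ℝ} (hh : IntegrableOn h (Set.Icc 0 T))
    {f : (Fin k → ℝ) → ℝ} (hf : ContinuousOn f (cube T k))
    (hsymm : ∀ σ : Equiv.Perm (Fin k), ∀ x ∈ cube T k, f (x ∘ σ) = f x) :
    iteratedIntegral h k f T =
      (k.factorial : ℝ)⁻¹ * ∫ x in cube T k, f x * ∏ j, h (x j) := by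
  induction k generalizing T with
  | zero =>
    have hcube : cube T 0 = Set.univ := Set.eq_univ_of_forall fun x i => i.elim0
    simp [iteratedIntegral, hcube, Measure.volume_pi_eq_dirac Fin.elim0]
  | succ k ih =>
    have hsymm_mul (σ : Equiv.Perm (Fin (k + 1))) (y : Fin (k + 1) → ℝ)
        (hy : y ∈ cube T (k + 1)) :
        f (y ∘ σ) * ∏ j, h ((y ∘ σ) j) = f y * ∏ j, h (y j) := by
      rw [hsymm σ y hy, ← Equiv.prod_comp σ fun j => h (y j)]
      rfl
    have hinner : ∀ s ∈ Set.Icc 0 T,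
        h s * iteratedIntegral h k (fun x => f (Fin.snoc x s)) s = (k.factorial : ℝ)⁻¹ *
          ∫ x in cube s k, f (Fin.snoc x s) * ∏ j, h ((Fin.snoc x s : Fin (k + 1) → ℝ) j) := by
      intro s hs
      rw [ih (hh.mono_set (Set.Icc_subset_Icc_right hs.2))
        ((continuousOn_comp_snoc hf hs).mono (cube_mono hs.2 k)) fun σ x hx => ?_]
      · simp only [Fin.prod_univ_castSucc, Fin.snoc_castSucc, Fin.snoc_last, ← mul_assoc,
          integral_mul_const]
        ring
      · obtain ⟨τ, hτ⟩ := exists_snoc_comp_perm_eq σ x s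
        rw [hτ, hsymm τ _ (snoc_mem_cube (cube_mono hs.2 k hx) hs)]
    rw [setIntegral_cube_succ (integrableOn_mul_prod hh hf) hsymm_mul, Nat.factorial_succ,
      iteratedIntegral, setIntegral_congr_fun measurableSet_Icc hinner, integral_const_mul]
    push_cast
    field_simp

end SymmetricFunctions

/-! ### The tensor product cosine basis -/

section CosineBasis

variable {T : ℝ} {k : ℕ}

theorem integral_cos_pi_int_mul_div (hT : 0 < T) (m : ℤ) :
    ∫ t in Set.Icc 0 T, Real.cos (Real.pi * m * t / T) = if m = 0 then T else 0 := by
  rw [integral_Icc_eq_integral_Ioc, ← intervalIntegral.integral_of_le hT.le]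
  split_ifs with hm
  · simp [hm]
  · have hfreq : Real.pi * m / T ≠ 0 :=
      div_ne_zero (mul_ne_zero Real.pi_ne_zero (Int.cast_ne_zero.2 hm)) hT.ne'
    have hcos (t : ℝ) : Real.cos (Real.pi * m * t / T) = Real.cos (Real.pi * m / T * t) := by
      congr 1
      ring
    simp only [hcos]
    rw [intervalIntegral.integral_comp_mul_left (fun x => Real.cos x) hfreq, integral_cos,
      div_mul_cancel₀ _ hT.ne', mul_comm, Real.sin_int_mul_pi]
    simp

/-- The norming constants of the cosine basis. -/
def cosConst (T : ℝ) (n : ℕ) : ℝ := if n = 0 then 1 / √T else √(2 / T)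

theorem cosConst_pos (hT : 0 < T) (n : ℕ) : 0 < cosConst T n := by
  unfold cosConst
  split_ifs <;> positivity

theorem cosConst_sq (hT : 0 < T) (n : ℕ) : cosConst T n ^ 2 = if n = 0 then 1 / T else 2 / T := by
  unfold cosConst
  split_ifs
  · rw [div_pow, one_pow, Real.sq_sqrt hT.le]
  · exact Real.sq_sqrt (by positivity)

theorem cosBasis_eq_cosConst_mul_cos (T : ℝ) (n : ℕ) (t : ℝ) :
    cosBasis T n t = cosConst T n * Real.cos (Real.pi * n * t / T) := by
  unfold cosBasis cosConst
  split_ifs with hn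
  · simp [hn]
  · rfl

theorem cosBasis_mul_cosBasis (T : ℝ) (n m : ℕ) (t : ℝ) :
    cosBasis T n t * cosBasis T m t = cosConst T n * cosConst T m / 2 *
      (Real.cos (Real.pi * ((n - m : ℤ) : ℝ) * t / T) +
        Real.cos (Real.pi * ((n + m : ℤ) : ℝ) * t / T)) := by
  have hsub : Real.pi * ((n - m : ℤ) : ℝ) * t / T =
      Real.pi * n * t / T - Real.pi * m * t / T := by
    push_cast
    ring
  have hadd : Real.pi * ((n + m : ℤ) : ℝ) * t / T =
      Real.pi * n * t / T + Real.pi * m * t / T := by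
    push_cast
    ring
  rw [cosBasis_eq_cosConst_mul_cos, cosBasis_eq_cosConst_mul_cos, hsub, hadd, Real.cos_sub,
    Real.cos_add]
  ring

theorem integral_cosBasis_mul_cosBasis (hT : 0 < T) (n m : ℕ) :
    ∫ t in Set.Icc 0 T, cosBasis T n t * cosBasis T m t = if n = m then 1 else 0 := by
  have hint (m : ℤ) : IntegrableOn (fun t : ℝ => Real.cos (Real.pi * m * t / T)) (Set.Icc 0 T) :=
    (by fun_prop : Continuous fun t : ℝ => Real.cos (Real.pi * m * t / T)
      ).continuousOn.integrableOn_compact isCompact_Icc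
  simp only [cosBasis_mul_cosBasis]
  rw [integral_const_mul, integral_add (hint _) (hint _), integral_cos_pi_int_mul_div hT,
    integral_cos_pi_int_mul_div hT]
  by_cases hnm : n = m
  · subst hnm
    rw [← pow_two, cosConst_sq hT, sub_self, if_pos rfl, if_pos rfl]
    by_cases hn : n = 0
    · simp only [hn, if_true, Nat.cast_zero, add_zero]
      field_simp
      norm_num
    · rw [if_neg hn, if_neg (by omega)]
      field_simp
      ring
  · simp [hnm, sub_eq_zero, show ¬((n : ℤ) + m = 0) by omega]

/-- The element `m_{i_1} ⊗ ⋯ ⊗ m_{i_k}` of the tensor product cosine basis. -/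
def tensorBasis (T : ℝ) (i : Fin k → ℕ) (x : Fin k → ℝ) : ℝ :=
  ∏ j, cosBasis T (i j) (x j)

theorem continuous_tensorBasis (T : ℝ) (i : Fin k → ℕ) : Continuous (tensorBasis T i) :=
  continuous_finsetProd _ fun j _ => (cosBasis_continuous T (i j)).comp (continuous_apply j)

theorem memLp_of_continuousOn_cube {f : (Fin k → ℝ) → ℝ} (hf : ContinuousOn f (cube T k)) :
    MemLp f 2 (volume.restrict (cube T k)) :=
  memLp_restrict_of_continuousOn_of_isCompact hf (isCompact_cube T k) (measurableSet_cube T k) 2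

theorem setIntegral_cube_prod (T : ℝ) (u : Fin k → ℝ → ℝ) :
    ∫ x in cube T k, ∏ j, u j (x j) = ∏ j, ∫ t in Set.Icc 0 T, u j t := by
  rw [volume_restrict_cube, integral_fintype_prod_eq_prod]

theorem setIntegral_tensorBasis_mul_tensorBasis (hT : 0 < T) (i i' : Fin k → ℕ) :
    ∫ x in cube T k, tensorBasis T i x * tensorBasis T i' x = if i = i' then 1 else 0 := by
  simp only [tensorBasis, ← Finset.prod_mul_distrib]
  rw [setIntegral_cube_prod T fun j t => cosBasis T (i j) t * cosBasis T (i' j) t]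
  simp only [integral_cosBasis_mul_cosBasis hT]
  split_ifs with h
  · simp [h]
  · obtain ⟨j, hj⟩ := Function.ne_iff.1 h
    exact Finset.prod_eq_zero (Finset.mem_univ j) (if_neg hj)

/-- The products `∏_j cos (π m_j x_j / T)` of cosines as continuous functions on the cube. Allowing
negative frequencies makes the product of two of them a combination of such products. -/
def cosProd (T : ℝ) (m : Fin k → ℤ) : C(cube T k, ℝ) :=
  ContinuousMap.restrict (cube T k) ⟨fun x => ∏ j, Real.cos (Real.pi * m j * x j / T),
    continuous_finsetProd _ fun j _ => by fun_prop⟩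

theorem cosProd_apply (m : Fin k → ℤ) (x : cube T k) :
    cosProd T m x = ∏ j, Real.cos (Real.pi * m j * x.1 j / T) := rfl

theorem cosProd_zero : cosProd T (0 : Fin k → ℤ) = 1 := by
  ext x
  simp [cosProd_apply]

theorem cosProd_single (j : Fin k) (x : cube T k) :
    cosProd T (Pi.single j 1) x = Real.cos (Real.pi * x.1 j / T) := by
  rw [cosProd_apply, Finset.prod_eq_single j (fun l _ hl => by simp [hl]) (by simp)]
  simp

theorem cosProd_mul_cosProd (m m' : Fin k → ℤ) :
    cosProd T m * cosProd T m' =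
      ∑ ε : Fin k → Bool, (1 / 2 : ℝ) ^ k •
        cosProd T fun j => if ε j then m j + m' j else m j - m' j := by
  have hcos (u v : ℤ) (y : ℝ) : Real.cos (Real.pi * u * y / T) * Real.cos (Real.pi * v * y / T) =
      ∑ b : Bool, 1 / 2 * Real.cos (Real.pi * ((if b then u + v else u - v : ℤ) : ℝ) * y / T) := by
    have hadd : Real.pi * ((u + v : ℤ) : ℝ) * y / T =
        Real.pi * u * y / T + Real.pi * v * y / T := by
      push_cast
      ring
    have hsub : Real.pi * ((u - v : ℤ) : ℝ) * y / T =
        Real.pi * u * y / T - Real.pi * v * y / T := by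
      push_cast
      ring
    rw [Fintype.sum_bool, if_pos rfl, if_neg Bool.false_ne_true, hadd, hsub, Real.cos_add,
      Real.cos_sub]
    ring
  ext x
  simp only [ContinuousMap.mul_apply, ContinuousMap.sum_apply, ContinuousMap.smul_apply,
    smul_eq_mul, cosProd_apply, ← Finset.prod_mul_distrib, hcos, Fintype.prod_sum]
  simp only [Finset.prod_mul_distrib, Finset.prod_const, Finset.card_univ, Fintype.card_fin]

/-- The span of the products of cosines, as an algebra of continuous functions on the cube: the
object of the Stone–Weierstrass theorem. -/
def cosAlgebra (T : ℝ) (k : ℕ) : Subalgebra ℝ C(cube T k, ℝ) :=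
  (Submodule.span ℝ (Set.range (cosProd T (k := k)))).toSubalgebra
    (Submodule.subset_span ⟨0, cosProd_zero⟩) fun p q hp hq => by
      induction hp, hq using Submodule.span_induction₂ with
      | mem_mem p q hp hq =>
        obtain ⟨m, rfl⟩ := hp
        obtain ⟨m', rfl⟩ := hq
        rw [cosProd_mul_cosProd]
        exact Submodule.sum_mem _ fun ε _ =>
          Submodule.smul_mem _ _ (Submodule.subset_span ⟨_, rfl⟩)
      | zero_left => simp
      | zero_right => simp
      | add_left p q r _ _ _ hp hq => simpa only [add_mul] using Submodule.add_mem _ hp hq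
      | add_right p q r _ _ _ hp hq => simpa only [mul_add] using Submodule.add_mem _ hp hq
      | smul_left c p q _ _ hp => simpa only [smul_mul_assoc] using Submodule.smul_mem _ c hp
      | smul_right c p q _ _ hp => simpa only [mul_smul_comm] using Submodule.smul_mem _ c hp

theorem separatesPoints_cosAlgebra (hT : 0 < T) : (cosAlgebra T k).SeparatesPoints := by
  intro x y hxy
  obtain ⟨j, hj⟩ : ∃ j, x.1 j ≠ y.1 j := Function.ne_iff.1 fun h => hxy (Subtype.ext h)
  refine ⟨_, ⟨cosProd T (Pi.single j 1), Submodule.subset_span ⟨_, rfl⟩, rfl⟩, fun hcos => hj ?_⟩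
  have hangle (z : cube T k) : Real.pi * z.1 j / T ∈ Set.Icc 0 Real.pi := by
    have hz := z.2 j trivial
    refine ⟨div_nonneg (mul_nonneg Real.pi_pos.le hz.1) hT.le, ?_⟩
    rw [div_le_iff₀ hT]
    exact mul_le_mul_of_nonneg_left hz.2 Real.pi_pos.le
  have hcos_eq : Real.cos (Real.pi * x.1 j / T) = Real.cos (Real.pi * y.1 j / T) := by
    rw [← cosProd_single, ← cosProd_single]
    exact hcos
  have hangle_eq := Real.injOn_cos (hangle x) (hangle y) hcos_eq
  field_simp at hangle_eq
  exact hangle_eq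

/-- The tensor product cosine basis as continuous functions on the cube. -/
def tensorBasisC (T : ℝ) (i : Fin k → ℕ) : C(cube T k, ℝ) :=
  ContinuousMap.restrict (cube T k) ⟨tensorBasis T i, continuous_tensorBasis T i⟩

theorem tensorBasisC_natAbs (m : Fin k → ℤ) :
    tensorBasisC T (fun j => (m j).natAbs) =
      (∏ j, cosConst T (m j).natAbs) • cosProd T m := by
  ext x
  have hcos (j : Fin k) : Real.cos (Real.pi * (m j).natAbs * x.1 j / T) =
      Real.cos (Real.pi * m j * x.1 j / T) := by
    rw [Nat.cast_natAbs, Int.cast_abs]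
    rcases abs_choice (m j : ℝ) with h | h
    · rw [h]
    · rw [h, mul_neg, neg_mul, neg_div, Real.cos_neg]
  change tensorBasis T _ x.1 = _
  simp only [tensorBasis, cosBasis_eq_cosConst_mul_cos, hcos, Finset.prod_mul_distrib,
    ContinuousMap.smul_apply, cosProd_apply, smul_eq_mul]

theorem dense_span_tensorBasisC (hT : 0 < T) :
    Dense (Submodule.span ℝ (Set.range (tensorBasisC T (k := k))) : Set C(cube T k, ℝ)) := by
  have : CompactSpace (cube T k) := isCompact_iff_compactSpace.1 (isCompact_cube T k)
  have hdense : Dense (cosAlgebra T k : Set C(cube T k, ℝ)) := by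
    rw [dense_iff_closure_eq, ← Subalgebra.topologicalClosure_coe,
      ContinuousMap.subalgebra_topologicalClosure_eq_top_of_separatesPoints _
        (separatesPoints_cosAlgebra hT), Algebra.coe_top]
  have hspan : Submodule.span ℝ (Set.range (cosProd T (k := k))) ≤
      Submodule.span ℝ (Set.range (tensorBasisC T)) := by
    rw [Submodule.span_le]
    rintro _ ⟨m, rfl⟩
    have hconst : ∏ j, cosConst T (m j).natAbs ≠ 0 :=
      Finset.prod_ne_zero_iff.2 fun j _ => (cosConst_pos hT _).ne'
    rw [← inv_smul_smul₀ hconst (cosProd T m), ← tensorBasisC_natAbs]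
    exact Submodule.smul_mem _ _ (Submodule.subset_span ⟨_, rfl⟩)
  exact hdense.mono hspan

theorem exists_forall_abs_sub_sum_tensorBasis_lt (hT : 0 < T) {g : (Fin k → ℝ) → ℝ}
    (hg : ContinuousOn g (cube T k)) {ε : ℝ} (hε : 0 < ε) :
    ∃ a : (Fin k → ℕ) →₀ ℝ, ∀ x ∈ cube T k,
      |g x - ∑ i ∈ a.support, a i * tensorBasis T i x| < ε := by
  have : CompactSpace (cube T k) := isCompact_iff_compactSpace.1 (isCompact_cube T k)
  let G : C(cube T k, ℝ) := ⟨(cube T k).domRestrict g, hg.domRestrict⟩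
  obtain ⟨p, hp, hGp⟩ := Metric.mem_closure_iff.1 (dense_span_tensorBasisC hT G) ε hε
  obtain ⟨a, rfl⟩ := Finsupp.mem_span_range_iff_exists_finsupp.1 hp
  refine ⟨a, fun x hx => ?_⟩
  have hx_lt := (ContinuousMap.dist_apply_le_dist (f := G) ⟨x, hx⟩).trans_lt hGp
  rw [Real.dist_eq] at hx_lt
  simpa [Finsupp.sum, tensorBasisC, G] using hx_lt

/-- The tensor product cosine basis in `L₂([0,T]^k)`. -/
def tensorBasisLp (T : ℝ) (i : Fin k → ℕ) :
    Lp ℝ 2 ((volume : Measure (Fin k → ℝ)).restrict (cube T k)) :=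
  (memLp_of_continuousOn_cube (continuous_tensorBasis T i).continuousOn).toLp

theorem inner_toLp_tensorBasisLp {f : (Fin k → ℝ) → ℝ}
    (hf : MemLp f 2 (volume.restrict (cube T k))) (i : Fin k → ℕ) :
    inner ℝ (hf.toLp f) (tensorBasisLp T i) = kernelCoef T f i := by
  rw [tensorBasisLp, inner_toLp_toLp]
  rfl

theorem orthonormal_tensorBasisLp (hT : 0 < T) (k : ℕ) :
    Orthonormal ℝ (tensorBasisLp T (k := k)) := by
  rw [orthonormal_iff_ite]
  intro i i'
  rw [tensorBasisLp, tensorBasisLp, inner_toLp_toLp, setIntegral_tensorBasis_mul_tensorBasis hT]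

theorem exists_mem_span_tensorBasisLp_norm_sub_le (hT : 0 < T) {g : (Fin k → ℝ) → ℝ}
    (hg : Continuous g) {ε : ℝ} (hε : 0 < ε) :
    ∃ p ∈ Submodule.span ℝ (Set.range (tensorBasisLp T (k := k))),
      ‖(memLp_of_continuousOn_cube hg.continuousOn).toLp - p‖ ≤ ε := by
  have : IsFiniteMeasure ((volume : Measure (Fin k → ℝ)).restrict (cube T k)) :=
    isFiniteMeasure_restrict.2 (isCompact_cube T k).measure_lt_top.ne
  set c : ℝ :=
    measureUnivNNReal ((volume : Measure (Fin k → ℝ)).restrict (cube T k)) ^ (2 : ℝ≥0∞).toReal⁻¹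
  have hc : 0 ≤ c := by positivity
  obtain ⟨a, ha⟩ := exists_forall_abs_sub_sum_tensorBasis_lt hT hg.continuousOn
    (div_pos hε (add_pos_of_nonneg_of_pos hc one_pos))
  refine ⟨∑ i ∈ a.support, a i • tensorBasisLp T i, Submodule.sum_mem _ fun i _ =>
    Submodule.smul_mem _ _ (Submodule.subset_span ⟨i, rfl⟩), ?_⟩
  have hbasis : ∀ᵐ x ∂volume.restrict (cube T k), ∀ i ∈ a.support,
      (a i • tensorBasisLp T i) x = a i * tensorBasis T i x := by
    refine (eventually_all_finset a.support).2 fun i _ => ?_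
    filter_upwards [Lp.coeFn_smul (a i) (tensorBasisLp T i),
      (memLp_of_continuousOn_cube (continuous_tensorBasis T i).continuousOn).coeFn_toLp]
      with x hsmul hx
    rw [hsmul, Pi.smul_apply, tensorBasisLp, hx, smul_eq_mul]
  refine (Lp.norm_le_of_ae_bound (C := ε / (c + 1)) (by positivity) ?_).trans ?_
  · filter_upwards [hbasis, ae_restrict_mem (measurableSet_cube T k),
      Lp.coeFn_sub (memLp_of_continuousOn_cube hg.continuousOn).toLp
        (∑ i ∈ a.support, a i • tensorBasisLp T i),
      Lp.coeFn_fun_finsetSum a.support fun i => a i • tensorBasisLp T i,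
      (memLp_of_continuousOn_cube hg.continuousOn).coeFn_toLp] with x hx hxcube hsub hsum hgx
    rw [hsub, Pi.sub_apply, hsum, hgx, Finset.sum_congr rfl hx]
    exact (ha x hxcube).le
  · rw [mul_div_assoc', div_le_iff₀ (by positivity)]
    nlinarith

theorem topologicalClosure_span_tensorBasisLp (hT : 0 < T) (k : ℕ) :
    (Submodule.span ℝ (Set.range (tensorBasisLp T (k := k)))).topologicalClosure = ⊤ := by
  rw [← Submodule.dense_iff_topologicalClosure_eq_top]
  intro F
  rw [Metric.mem_closure_iff]
  intro ε hε
  obtain ⟨g, -, hFg, hg, hg2⟩ := (Lp.memLp F).exists_hasCompactSupport_eLpNorm_sub_le (by simp)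
    (ENNReal.ofReal_pos.2 (half_pos (half_pos hε))).ne'
  obtain ⟨p, hp, hgp⟩ := exists_mem_span_tensorBasisLp_norm_sub_le hT hg (half_pos hε)
  have hFg' : ‖F - hg2.toLp‖ ≤ ε / 2 / 2 := by
    rw [show F - hg2.toLp = ((Lp.memLp F).sub hg2).toLp by
      rw [MemLp.toLp_sub (Lp.memLp F) hg2, Lp.toLp_coeFn], Lp.norm_toLp]
    exact ENNReal.toReal_le_of_le_ofReal (by positivity) hFg
  refine ⟨p, hp, ?_⟩
  rw [dist_eq_norm]
  linarith [norm_sub_le_norm_sub_add_norm_sub F hg2.toLp p]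

theorem hasSum_kernelCoef_mul_kernelCoef (hT : 0 < T) {f g : (Fin k → ℝ) → ℝ}
    (hf : MemLp f 2 (volume.restrict (cube T k))) (hg : MemLp g 2 (volume.restrict (cube T k))) :
    HasSum (fun i => kernelCoef T f i * kernelCoef T g i) (∫ x in cube T k, f x * g x) := by
  let b := HilbertBasis.mk (orthonormal_tensorBasisLp hT k)
    (topologicalClosure_span_tensorBasisLp hT k).ge
  have hb (i : Fin k → ℕ) : b i = tensorBasisLp T i := by rw [HilbertBasis.coe_mk]
  have hsum := b.hasSum_inner_mul_inner (hf.toLp f) (hg.toLp g)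
  simpa only [hb, inner_toLp_toLp, inner_toLp_tensorBasisLp,
    real_inner_comm (hg.toLp g) (tensorBasisLp T _)] using hsum

end CosineBasis

/-! ### Duality of the Sobolev norms -/

section Duality

variable {T : ℝ} {k : ℕ}

/-- The coefficients of a function on `[0,T]` in the cosine basis. -/
def cosCoef (T : ℝ) (h : ℝ → ℝ) (n : ℕ) : ℝ := ∫ t in Set.Icc 0 T, h t * cosBasis T n t

theorem kernelCoef_prod (T : ℝ) (h : ℝ → ℝ) (i : Fin k → ℕ) :
    kernelCoef T (fun x => ∏ j, h (x j)) i = ∏ j, cosCoef T h (i j) := by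
  simp only [kernelCoef, cosCoef, ← Finset.prod_mul_distrib]
  rw [setIntegral_cube_prod T fun j t => h t * cosBasis T (i j) t]

theorem memLp_prod {h : ℝ → ℝ} (hh : MemLp h 2 (volume.restrict (Set.Icc 0 T))) (k : ℕ) :
    MemLp (fun x : Fin k → ℝ => ∏ j, h (x j)) 2 (volume.restrict (cube T k)) := by
  rw [volume_restrict_cube]
  have hprod : Integrable (fun x : Fin k → ℝ => ∏ j, h (x j))
      (Measure.pi fun _ => volume.restrict (Set.Icc 0 T)) :=
    Integrable.fintype_prod (f := fun _ => h) fun _ => hh.integrable one_le_two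
  rw [memLp_two_iff_integrable_sq hprod.1]
  simp only [← Finset.prod_pow]
  exact Integrable.fintype_prod (f := fun _ t => h t ^ 2) fun _ => hh.integrable_sq

theorem tsum_prod_eq_tsum_pow {α : Type*} (a : α → ℝ≥0∞) (k : ℕ) :
    ∑' i : Fin k → α, ∏ j, a (i j) = (∑' n, a n) ^ k := by
  induction k with
  | zero => simp
  | succ k ih =>
    calc ∑' i : Fin (k + 1) → α, ∏ j, a (i j)
        = ∑' p : α × (Fin k → α), a p.1 * ∏ j, a (p.2 j) := by
          rw [← (Fin.consEquiv fun _ : Fin (k + 1) => α).tsum_eq]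
          exact tsum_congr fun p => by simp [Fin.prod_univ_succ, Fin.consEquiv]
      _ = (∑' n, a n) ^ (k + 1) := by
          rw [ENNReal.tsum_prod (f := fun n (i : Fin k → α) => a n * ∏ j, a (i j))]
          simp only [ENNReal.tsum_mul_left, ih, ENNReal.tsum_mul_right]
          rw [pow_succ']

theorem kernelNormSq_prod (T s : ℝ) (h : ℝ → ℝ) (k : ℕ) :
    kernelNormSq T s (fun x : Fin k → ℝ => ∏ j, h (x j)) = sobolevNormSq T s h ^ k := by
  rw [sobolevNormSq, ← tsum_prod_eq_tsum_pow, kernelNormSq]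
  refine tsum_congr fun i => ?_
  rw [kernelCoef_prod, ← Finset.prod_pow, ← Finset.prod_mul_distrib,
    ENNReal.ofReal_prod_of_nonneg fun j _ =>
      mul_nonneg (Real.rpow_nonneg (eigenvalue_pos _).le _) (sq_nonneg _)]
  rfl

theorem sum_le_toReal_tsum_ofReal {ι : Type*} {a : ι → ℝ} (ha : ∀ i, 0 ≤ a i)
    (hsum : ∑' i, ENNReal.ofReal (a i) ≠ ∞) (s : Finset ι) :
    ∑ i ∈ s, a i ≤ (∑' i, ENNReal.ofReal (a i)).toReal := by
  rw [← ENNReal.ofReal_le_iff_le_toReal hsum, ENNReal.ofReal_sum_of_nonneg fun i _ => ha i]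
  exact ENNReal.sum_le_tsum s

theorem prod_eigenvalue_rpow_pos (s : ℝ) (i : Fin k → ℕ) : 0 < ∏ j, eigenvalue (i j) ^ s :=
  Finset.prod_pos fun _ _ => Real.rpow_pos_of_pos (eigenvalue_pos _) _

theorem prod_eigenvalue_rpow_mul_neg (s : ℝ) (i : Fin k → ℕ) :
    (∏ j, eigenvalue (i j) ^ s) * ∏ j, eigenvalue (i j) ^ (-s) = 1 := by
  simp only [Real.rpow_neg (eigenvalue_pos _).le, Finset.prod_inv_distrib]
  exact mul_inv_cancel₀ (prod_eigenvalue_rpow_pos s i).ne'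

theorem sq_setIntegral_mul_le (hT : 0 < T) (q : ℝ) {f g : (Fin k → ℝ) → ℝ}
    (hf : MemLp f 2 (volume.restrict (cube T k))) (hg : MemLp g 2 (volume.restrict (cube T k)))
    (hfq : kernelNormSq T q f ≠ ∞) (hgq : kernelNormSq T (-q) g ≠ ∞) :
    (∫ x in cube T k, f x * g x) ^ 2 ≤
      (kernelNormSq T q f).toReal * (kernelNormSq T (-q) g).toReal := by
  have hterm_nonneg (s : ℝ) (u : (Fin k → ℝ) → ℝ) (i : Fin k → ℕ) :
      0 ≤ (∏ j, eigenvalue (i j) ^ s) * kernelCoef T u i ^ 2 :=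
    mul_nonneg (prod_eigenvalue_rpow_pos s i).le (sq_nonneg _)
  refine le_of_tendsto ((hasSum_kernelCoef_mul_kernelCoef hT hf hg).pow 2) (.of_forall fun s => ?_)
  calc (∑ i ∈ s, kernelCoef T f i * kernelCoef T g i) ^ 2
      ≤ (∑ i ∈ s, (∏ j, eigenvalue (i j) ^ q) * kernelCoef T f i ^ 2) *
          ∑ i ∈ s, (∏ j, eigenvalue (i j) ^ (-q)) * kernelCoef T g i ^ 2 := by
        refine Finset.sum_sq_le_sum_mul_sum_of_sq_le_mul s (fun i _ => hterm_nonneg _ _ i)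
          (fun i _ => hterm_nonneg _ _ i) fun i _ => le_of_eq ?_
        rw [mul_mul_mul_comm, prod_eigenvalue_rpow_mul_neg, one_mul, mul_pow]
    _ ≤ (kernelNormSq T q f).toReal * (kernelNormSq T (-q) g).toReal :=
        mul_le_mul (sum_le_toReal_tsum_ofReal (hterm_nonneg _ _) hfq s)
          (sum_le_toReal_tsum_ofReal (hterm_nonneg _ _) hgq s)
          (Finset.sum_nonneg fun i _ => hterm_nonneg _ _ i) ENNReal.toReal_nonneg

end Duality

/-! ### The functional given by the stochastic exponential -/

section Pairing

variable {T p q : ℝ} {h : ℝ → ℝ}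

theorem kernelNorm_sq (T s : ℝ) {k : ℕ} (f : (Fin k → ℝ) → ℝ) :
    kernelNorm T s f ^ 2 = (kernelNormSq T s f).toReal :=
  Real.sq_sqrt ENNReal.toReal_nonneg

/-- The functional `f ↦ (1 / k!) ⟨f, h ⊗ ⋯ ⊗ h⟩` on the kernels in `k` variables. -/
def kernelPairing (q : ℝ) (hh : MemLp h 2 (volume.restrict (Set.Icc 0 T))) (k : ℕ) :
    smoothKernel T q k →ₗ[ℝ] ℝ where
  toFun f := (k.factorial : ℝ)⁻¹ * ∫ x in cube T k, f.1 x * ∏ j, h (x j)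
  map_add' f g := by
    have hint (f : smoothKernel T q k) :
        IntegrableOn (fun x => f.1 x * ∏ j, h (x j)) (cube T k) :=
      integrableOn_mul_prod (hh.integrable one_le_two) f.2.1.continuousOn
    rw [← mul_add, ← integral_add (hint f) (hint g)]
    simp only [Submodule.coe_add, Pi.add_apply, add_mul]
  map_smul' c f := by
    rw [RingHom.id_apply, smul_eq_mul, mul_left_comm c, ← integral_const_mul c]
    simp only [Submodule.coe_smul, Pi.smul_apply, smul_eq_mul, mul_assoc]

theorem sq_kernelPairing_le (hT : 0 < T) (hh : MemLp h 2 (volume.restrict (Set.Icc 0 T)))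
    (hhq : sobolevNormSq T (-q) h ≠ ∞) {k : ℕ} (f : smoothKernel T q k) :
    kernelPairing q hh k f ^ 2 ≤
      (sobolevNormSq T (-q) h).toReal ^ k * (kernelNorm T q f.1 ^ 2 / (k.factorial : ℝ) ^ 2) := by
  have hdual := sq_setIntegral_mul_le hT q
    (memLp_of_continuousOn_cube f.2.1.continuousOn) (memLp_prod hh k) f.2.2.2.ne
    (by rw [kernelNormSq_prod]; exact ENNReal.pow_ne_top hhq)
  rw [kernelNormSq_prod, ENNReal.toReal_pow, ← kernelNorm_sq] at hdual
  calc kernelPairing q hh k f ^ 2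
      = (∫ x in cube T k, f.1 x * ∏ j, h (x j)) ^ 2 / (k.factorial : ℝ) ^ 2 := by
        change ((k.factorial : ℝ)⁻¹ * ∫ x in cube T k, f.1 x * ∏ j, h (x j)) ^ 2 = _
        rw [mul_pow, inv_pow, inv_mul_eq_div]
    _ ≤ kernelNorm T q f.1 ^ 2 * (sobolevNormSq T (-q) h).toReal ^ k / (k.factorial : ℝ) ^ 2 := by
        gcongr
    _ = _ := by ring

end Pairing

namespace SimpleElement

section Pairing

variable {T p q : ℝ} {h : ℝ → ℝ}

theorem kernel_of_notMem {η : SimpleElement T p q} {k : ℕ} (hk : k ∉ η.support) :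
    η.kernel k = 0 := by
  classical
  exact DFinsupp.notMem_support_iff.1 hk

theorem normSq_eq_sum (η : SimpleElement T p q) {s : Finset ℕ} (hs : η.support ⊆ s) :
    η.normSq = ∑ k ∈ s,
      (2 : ℝ) ^ ((k : ℝ) * p) / (k.factorial : ℝ) ^ 2 * kernelNorm T q (η.kernel k).1 ^ 2 :=
  Finset.sum_subset hs fun k _ hk => by simp [kernelNorm_of_notMem hk]

/-- The functional `η ↦ ∑_k (1 / k!) ⟨η_k, h ⊗ ⋯ ⊗ h⟩` on the finite chaos expansions. -/
def pairing (p q : ℝ) (hh : MemLp h 2 (volume.restrict (Set.Icc 0 T))) :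
    SimpleElement T p q →ₗ[ℝ] ℝ :=
  (DFinsupp.lsum ℕ fun k => kernelPairing q hh k : (Π₀ k, smoothKernel T q k) →ₗ[ℝ] ℝ)

theorem pairing_eq_sum (hh : MemLp h 2 (volume.restrict (Set.Icc 0 T)))
    (η : SimpleElement T p q) {s : Finset ℕ} (hs : η.support ⊆ s) :
    pairing p q hh η = ∑ k ∈ s, kernelPairing q hh k (η.kernel k) := by
  classical
  have hsupport : pairing p q hh η = ∑ k ∈ η.support, kernelPairing q hh k (η.kernel k) :=
    DFinsupp.sumAddHom_apply (fun k => (kernelPairing q hh k).toAddMonoidHom) _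
  rw [hsupport]
  exact Finset.sum_subset hs fun k _ hk => by rw [kernel_of_notMem hk, map_zero]

theorem integral_toLp_mul_stochExp {Ω : Type*} [mΩ : MeasurableSpace Ω] {P : Measure Ω}
    [IsProbabilityMeasure P] {𝓕 : Filtration ℝ mΩ} {W : ℝ → Ω → ℝ}
    (hW : IsWienerProcess P T 𝓕 W) (hT : 0 ≤ T)
    (hh : MemLp h 2 (volume.restrict (Set.Icc 0 T))) (η : SimpleElement T p q) :
    ∫ ω, η.toLp P 𝓕 W ω * stochExp P T 𝓕 W h ω ∂P = pairing p q hh η := by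
  rw [← inner_stochExp hW hT hh, toLp, sum_inner, pairing_eq_sum hh η subset_rfl]
  refine Finset.sum_congr rfl fun k _ => ?_
  have hcont := (η.kernel k).2.1.continuousOn
  rw [inner_stochExp hW hT hh, (isIteratedIto_iteratedIto hW hT hcont).integral_mul_stochExp hW hh
    (Set.right_mem_Icc.2 hT), iteratedIntegral_eq_setIntegral_cube (hh.integrable one_le_two) hcont
    (η.kernel k).2.2.1]
  rfl

theorem two_rpow_natCast_mul (p : ℝ) (k : ℕ) : (2 : ℝ) ^ ((k : ℝ) * p) = ((2 : ℝ) ^ p) ^ k := by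
  rw [mul_comm, Real.rpow_mul zero_le_two, Real.rpow_natCast]

theorem sq_pairing_le (hT : 0 < T) (hh : MemLp h 2 (volume.restrict (Set.Icc 0 T)))
    (hlt : sobolevNormSq T (-q) h < ENNReal.ofReal ((2 : ℝ) ^ p)) (η : SimpleElement T p q) :
    pairing p q hh η ^ 2 ≤ (1 - (sobolevNormSq T (-q) h).toReal / 2 ^ p)⁻¹ * η.normSq := by
  have hhq := hlt.ne_top
  set r := (sobolevNormSq T (-q) h).toReal / (2 : ℝ) ^ p with hr
  have hr0 : 0 ≤ r := by positivity
  have hr1 : r < 1 := by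
    rw [hr, div_lt_one (by positivity)]
    exact (ENNReal.lt_ofReal_iff_toReal_lt hhq).1 hlt
  have hgeom : ∑ k ∈ η.support, r ^ k ≤ (1 - r)⁻¹ := by
    rw [← tsum_geometric_of_lt_one hr0 hr1]
    exact (summable_geometric_of_lt_one hr0 hr1).sum_le_tsum _ fun k _ => pow_nonneg hr0 k
  calc pairing p q hh η ^ 2
      ≤ (∑ k ∈ η.support, r ^ k) * η.normSq := by
        rw [pairing_eq_sum hh η subset_rfl]
        refine Finset.sum_sq_le_sum_mul_sum_of_sq_le_mul _ (fun k _ => pow_nonneg hr0 k)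
          (fun k _ => by positivity) fun k _ => (sq_kernelPairing_le hT hh hhq _).trans_eq ?_
        rw [two_rpow_natCast_mul, hr, div_pow]
        field_simp
    _ ≤ (1 - r)⁻¹ * η.normSq :=
        mul_le_mul_of_nonneg_right hgeom (Finset.sum_nonneg fun k _ => by positivity)

theorem exists_norm_pairing_le (hT : 0 < T) (hh : MemLp h 2 (volume.restrict (Set.Icc 0 T)))
    (hlt : sobolevNormSq T (-q) h < ENNReal.ofReal ((2 : ℝ) ^ p)) :
    ∃ C, ∀ η : SimpleElement T p q, ‖pairing p q hh η‖ ≤ C * ‖η‖ := by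
  refine ⟨√(1 - (sobolevNormSq T (-q) h).toReal / 2 ^ p)⁻¹, fun η => ?_⟩
  have hnormSq : 0 ≤ η.normSq := Finset.sum_nonneg fun k _ => by positivity
  rw [norm_def, ← Real.sqrt_mul' _ hnormSq, Real.norm_eq_abs]
  exact Real.abs_le_sqrt (sq_pairing_le hT hh hlt η)

end Pairing

end SimpleElement

/-! ### Test elements -/

section TestElement

variable {T q : ℝ} {g h : ℝ → ℝ}

/-- The kernel `g ⊗ ⋯ ⊗ g`. -/
def tensorKernel (hg : ContDiff ℝ ((⊤ : ℕ∞) : WithTop ℕ∞) g) (hgq : sobolevNormSq T q g ≠ ∞)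
    (k : ℕ) : smoothKernel T q k :=
  ⟨fun x => ∏ j, g (x j),
    (contDiff_prod fun j _ => hg.comp (contDiff_apply ℝ ℝ j)).contDiffOn,
    fun σ x _ => Equiv.prod_comp σ fun j => g (x j),
    by rw [kernelNormSq_prod]; exact (ENNReal.pow_ne_top hgq).lt_top⟩

theorem sq_kernelNorm_tensorKernel (hg : ContDiff ℝ ((⊤ : ℕ∞) : WithTop ℕ∞) g)
    (hgq : sobolevNormSq T q g ≠ ∞) (k : ℕ) :
    kernelNorm T q (tensorKernel hg hgq k).1 ^ 2 = (sobolevNormSq T q g).toReal ^ k := by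
  rw [kernelNorm_sq, ← ENNReal.toReal_pow, ← kernelNormSq_prod]
  rfl

theorem kernelPairing_tensorKernel (hg : ContDiff ℝ ((⊤ : ℕ∞) : WithTop ℕ∞) g)
    (hgq : sobolevNormSq T q g ≠ ∞) (hh : MemLp h 2 (volume.restrict (Set.Icc 0 T))) (k : ℕ) :
    kernelPairing q hh k (tensorKernel hg hgq k) =
      (k.factorial : ℝ)⁻¹ * (∫ t in Set.Icc 0 T, g t * h t) ^ k := by
  change (k.factorial : ℝ)⁻¹ * ∫ x in cube T k, (∏ j, g (x j)) * ∏ j, h (x j) = _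
  simp only [← Finset.prod_mul_distrib]
  rw [setIntegral_cube_prod T fun _ t => g t * h t, Finset.prod_const, Finset.card_univ,
    Fintype.card_fin]

/-- The element of the chaos with the kernels `k! 2^{-kp} g ⊗ ⋯ ⊗ g`, `k < K`. The coefficients are
those for which the pairing with `h` and the squared norm become the same geometric sum if
`⟨g, h⟩ = ‖g‖_q²`. -/
def testElement (p : ℝ) (hg : ContDiff ℝ ((⊤ : ℕ∞) : WithTop ℕ∞) g)
    (hgq : sobolevNormSq T q g ≠ ∞) (K : ℕ) : SimpleElement T p q :=
  DFinsupp.mk (β := fun k => smoothKernel T q k) (Finset.range K) fun k =>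
    ((k.1.factorial : ℝ) / ((2 : ℝ) ^ p) ^ k.1) • tensorKernel hg hgq k.1

theorem support_testElement_subset (p : ℝ) (hg : ContDiff ℝ ((⊤ : ℕ∞) : WithTop ℕ∞) g)
    (hgq : sobolevNormSq T q g ≠ ∞) (K : ℕ) :
    (testElement p hg hgq K).support ⊆ Finset.range K := by
  classical
  exact DFinsupp.support_mk_subset

theorem kernel_testElement (p : ℝ) (hg : ContDiff ℝ ((⊤ : ℕ∞) : WithTop ℕ∞) g)
    (hgq : sobolevNormSq T q g ≠ ∞) {K k : ℕ} (hk : k ∈ Finset.range K) :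
    (testElement p hg hgq K).kernel k =
      ((k.factorial : ℝ) / ((2 : ℝ) ^ p) ^ k) • tensorKernel hg hgq k :=
  DFinsupp.mk_of_mem hk

theorem pairing_testElement (p : ℝ) (hg : ContDiff ℝ ((⊤ : ℕ∞) : WithTop ℕ∞) g)
    (hgq : sobolevNormSq T q g ≠ ∞) (hh : MemLp h 2 (volume.restrict (Set.Icc 0 T))) (K : ℕ) :
    (testElement p hg hgq K).pairing p q hh =
      ∑ k ∈ Finset.range K, ((∫ t in Set.Icc 0 T, g t * h t) / 2 ^ p) ^ k := by
  rw [SimpleElement.pairing_eq_sum hh _ (support_testElement_subset p hg hgq K)]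
  refine Finset.sum_congr rfl fun k hk => ?_
  rw [kernel_testElement p hg hgq hk, map_smul, kernelPairing_tensorKernel, smul_eq_mul, div_pow]
  field_simp

theorem normSq_testElement (p : ℝ) (hg : ContDiff ℝ ((⊤ : ℕ∞) : WithTop ℕ∞) g)
    (hgq : sobolevNormSq T q g ≠ ∞) (K : ℕ) :
    (testElement p hg hgq K).normSq =
      ∑ k ∈ Finset.range K, ((sobolevNormSq T q g).toReal / 2 ^ p) ^ k := by
  rw [SimpleElement.normSq_eq_sum _ (support_testElement_subset p hg hgq K)]
  refine Finset.sum_congr rfl fun k hk => ?_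
  rw [kernel_testElement p hg hgq hk, kernelNorm_smul, mul_pow, sq_abs,
    sq_kernelNorm_tensorKernel, SimpleElement.two_rpow_natCast_mul, div_pow _ _ k]
  field_simp

theorem geom_sum_le_of_abs_pairing_le {p : ℝ} (hg : ContDiff ℝ ((⊤ : ℕ∞) : WithTop ℕ∞) g)
    (hgq : sobolevNormSq T q g ≠ ∞) (hh : MemLp h 2 (volume.restrict (Set.Icc 0 T)))
    (hgh : ∫ t in Set.Icc 0 T, g t * h t = (sobolevNormSq T q g).toReal) {C : ℝ}
    (hC : ∀ η : SimpleElement T p q, |η.pairing p q hh| ≤ C * ‖η‖) (K : ℕ) :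
    ∑ k ∈ Finset.range K, ((sobolevNormSq T q g).toReal / 2 ^ p) ^ k ≤ C ^ 2 := by
  have hle := hC (testElement p hg hgq K)
  rw [pairing_testElement, SimpleElement.norm_def, normSq_testElement, hgh] at hle
  set A := ∑ k ∈ Finset.range K, ((sobolevNormSq T q g).toReal / 2 ^ p) ^ k
  have hA : 0 ≤ A := Finset.sum_nonneg fun k _ => by positivity
  rcases hA.eq_or_lt with hA0 | hA_pos
  · rw [← hA0]
    exact sq_nonneg C
  · refine (Real.sqrt_le_iff.1 (le_of_mul_le_mul_right ?_ (Real.sqrt_pos.2 hA_pos))).2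
    rw [Real.mul_self_sqrt hA]
    exact (le_abs_self A).trans hle

theorem le_one_sub_inv_of_forall_geom_sum_le {r B : ℝ} (hr : 0 ≤ r)
    (hB : ∀ K, ∑ k ∈ Finset.range K, r ^ k ≤ B) : r ≤ 1 - B⁻¹ := by
  have hpow (k : ℕ) : 0 ≤ r ^ k := pow_nonneg hr k
  have hr1 : r < 1 := by
    rw [← Real.norm_of_nonneg hr, ← summable_geometric_iff_norm_lt_one]
    exact summable_of_sum_range_le hpow hB
  have htsum : (1 - r)⁻¹ ≤ B := by
    rw [← tsum_geometric_of_lt_one hr hr1]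
    exact Real.tsum_le_of_sum_range_le hpow hB
  linarith [inv_le_of_inv_le₀ (sub_pos.2 hr1) htsum]

end TestElement

/-! ### Truncated cosine expansions -/

section Truncation

variable {T : ℝ}

theorem contDiff_cosBasis (T : ℝ) (n : ℕ) {m : WithTop ℕ∞} : ContDiff ℝ m (cosBasis T n) := by
  simp only [funext (cosBasis_eq_cosConst_mul_cos T n)]
  fun_prop

/-- The truncation of `Λ^{-q} h` to the first `N` basis functions. -/
def truncation (T q : ℝ) (h : ℝ → ℝ) (N : ℕ) (t : ℝ) : ℝ :=
  ∑ n ∈ Finset.range N, eigenvalue n ^ (-q) * cosCoef T h n * cosBasis T n t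

theorem contDiff_truncation (T q : ℝ) (h : ℝ → ℝ) (N : ℕ) {m : WithTop ℕ∞} :
    ContDiff ℝ m (truncation T q h N) :=
  ContDiff.sum fun n _ => contDiff_const.mul (contDiff_cosBasis T n)

theorem setIntegral_truncation_mul (q : ℝ) (h : ℝ → ℝ) {u : ℝ → ℝ} (N : ℕ)
    (hu : IntegrableOn u (Set.Icc 0 T)) :
    ∫ t in Set.Icc 0 T, truncation T q h N t * u t =
      ∑ n ∈ Finset.range N, eigenvalue n ^ (-q) * cosCoef T h n * cosCoef T u n := by
  have hint (n : ℕ) : IntegrableOn (fun t => u t * cosBasis T n t) (Set.Icc 0 T) :=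
    hu.mul_continuousOn (cosBasis_continuous T n).continuousOn isCompact_Icc
  have hexpand (t : ℝ) : truncation T q h N t * u t = ∑ n ∈ Finset.range N,
      eigenvalue n ^ (-q) * cosCoef T h n * (u t * cosBasis T n t) := by
    rw [truncation, Finset.sum_mul]
    exact Finset.sum_congr rfl fun n _ => by ring
  simp only [hexpand]
  rw [integral_finsetSum _ fun n _ => (hint n).const_mul _]
  exact Finset.sum_congr rfl fun n _ => integral_const_mul _ _

theorem cosCoef_truncation (hT : 0 < T) (q : ℝ) (h : ℝ → ℝ) (N n : ℕ) :
    cosCoef T (truncation T q h N) n =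
      if n ∈ Finset.range N then eigenvalue n ^ (-q) * cosCoef T h n else 0 := by
  have hcoef (m : ℕ) : cosCoef T (cosBasis T n) m = if n = m then 1 else 0 :=
    integral_cosBasis_mul_cosBasis hT n m
  rw [cosCoef, setIntegral_truncation_mul q h N
    ((cosBasis_continuous T n).continuousOn.integrableOn_compact isCompact_Icc)]
  simp only [hcoef, mul_ite, mul_one, mul_zero, Finset.sum_ite_eq]

theorem sobolevNormSq_eq_tsum_cosCoef (T s : ℝ) (h : ℝ → ℝ) :
    sobolevNormSq T s h = ∑' n, ENNReal.ofReal (eigenvalue n ^ s * cosCoef T h n ^ 2) := rfl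

theorem eigenvalue_rpow_mul_sq_nonneg (s c : ℝ) (n : ℕ) : 0 ≤ eigenvalue n ^ s * c ^ 2 :=
  mul_nonneg (Real.rpow_nonneg (eigenvalue_pos n).le _) (sq_nonneg c)

theorem sobolevNormSq_truncation (hT : 0 < T) (q : ℝ) (h : ℝ → ℝ) (N : ℕ) :
    sobolevNormSq T q (truncation T q h N) =
      ENNReal.ofReal (∑ n ∈ Finset.range N, eigenvalue n ^ (-q) * cosCoef T h n ^ 2) := by
  simp only [sobolevNormSq_eq_tsum_cosCoef, cosCoef_truncation hT]
  rw [tsum_eq_sum (s := Finset.range N) fun n hn => by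
      rw [if_neg hn, zero_pow two_ne_zero, mul_zero, ENNReal.ofReal_zero],
    ENNReal.ofReal_sum_of_nonneg fun n _ => eigenvalue_rpow_mul_sq_nonneg (-q) _ n]
  refine Finset.sum_congr rfl fun n hn => ?_
  rw [if_pos hn, mul_pow, pow_two (eigenvalue n ^ (-q)), ← mul_assoc, ← mul_assoc,
    ← Real.rpow_add (eigenvalue_pos n), add_neg_cancel, Real.rpow_zero, one_mul]

theorem setIntegral_truncation_mul_self {h : ℝ → ℝ} (hT : 0 < T) (q : ℝ) (N : ℕ)
    (hh : IntegrableOn h (Set.Icc 0 T)) :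
    ∫ t in Set.Icc 0 T, truncation T q h N t * h t =
      (sobolevNormSq T q (truncation T q h N)).toReal := by
  rw [setIntegral_truncation_mul q h N hh, sobolevNormSq_truncation hT, ENNReal.toReal_ofReal
    (Finset.sum_nonneg fun n _ => eigenvalue_rpow_mul_sq_nonneg (-q) _ n)]
  exact Finset.sum_congr rfl fun n _ => by ring

theorem sobolevNormSq_neg_eq_iSup (hT : 0 < T) (q : ℝ) (h : ℝ → ℝ) :
    sobolevNormSq T (-q) h = ⨆ N, sobolevNormSq T q (truncation T q h N) := by
  rw [sobolevNormSq_eq_tsum_cosCoef, ENNReal.tsum_eq_iSup_nat]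
  refine iSup_congr fun N => ?_
  rw [sobolevNormSq_truncation hT,
    ENNReal.ofReal_sum_of_nonneg fun n _ => eigenvalue_rpow_mul_sq_nonneg (-q) _ n]

theorem sobolevNormSq_lt_of_abs_pairing_le {p q : ℝ} (hT : 0 < T) {h : ℝ → ℝ}
    (hh : MemLp h 2 (volume.restrict (Set.Icc 0 T))) {C : ℝ}
    (hC : ∀ η : SimpleElement T p q, |η.pairing p q hh| ≤ C * ‖η‖) :
    sobolevNormSq T (-q) h < ENNReal.ofReal ((2 : ℝ) ^ p) := by
  have h2p : (0 : ℝ) < 2 ^ p := by positivity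
  have htop (N : ℕ) : sobolevNormSq T q (truncation T q h N) ≠ ∞ := by
    rw [sobolevNormSq_truncation hT]
    exact ENNReal.ofReal_ne_top
  have hgeom (N : ℕ) := geom_sum_le_of_abs_pairing_le (contDiff_truncation T q h N) (htop N) hh
    (setIntegral_truncation_mul_self hT q N (hh.integrable one_le_two)) hC
  have hC_pos : 0 < C ^ 2 := by
    have hone_le := hgeom 0 1
    rw [Finset.sum_range_one, pow_zero] at hone_le
    linarith
  have hbound (N : ℕ) : sobolevNormSq T q (truncation T q h N) ≤
      ENNReal.ofReal ((1 - (C ^ 2)⁻¹) * 2 ^ p) := by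
    have hle := le_one_sub_inv_of_forall_geom_sum_le (by positivity) (hgeom N)
    rw [← ENNReal.ofReal_toReal (htop N)]
    exact ENNReal.ofReal_le_ofReal ((div_le_iff₀ h2p).1 hle)
  calc sobolevNormSq T (-q) h ≤ ENNReal.ofReal ((1 - (C ^ 2)⁻¹) * 2 ^ p) := by
        rw [sobolevNormSq_neg_eq_iSup hT]
        exact iSup_le hbound
    _ < ENNReal.ofReal ((2 : ℝ) ^ p) :=
        (ENNReal.ofReal_lt_ofReal_iff h2p).2
          (mul_lt_of_lt_one_left h2p (sub_lt_self 1 (inv_pos.2 hC_pos)))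

end Truncation

end

end WienerChaos

theorem mainTheorem3 {Ω : Type*} [mΩ : MeasurableSpace Ω] (P : Measure Ω) [IsProbabilityMeasure P]
    (T : ℝ) (hT : 0 < T) (𝓕 : Filtration ℝ mΩ) (W : ℝ → Ω → ℝ)
    (hW : WienerChaos.IsWienerProcess P T 𝓕 W)
    (h : ℝ → ℝ) (hh : MemLp h 2 (volume.restrict (Set.Ioo 0 T))) (p q : ℝ) :
    WienerChaos.MemDual P T 𝓕 W p q (WienerChaos.stochExp P T 𝓕 W h) ↔
      WienerChaos.sobolevNormSq T (-q) h < ENNReal.ofReal ((2 : ℝ) ^ p) := by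
  rw [Measure.restrict_congr_set Ioo_ae_eq_Icc] at hh
  have hpair := fun η : WienerChaos.SimpleElement T p q =>
    WienerChaos.SimpleElement.integral_toLp_mul_stochExp hW hT.le hh η
  constructor
  · rintro ⟨-, -, ℓ, hℓ⟩
    refine WienerChaos.sobolevNormSq_lt_of_abs_pairing_le hT hh (C := ‖ℓ‖) fun η => ?_
    rw [← hpair η, ← hℓ η, ← Real.norm_eq_abs, ← UniformSpace.Completion.norm_coe η]
    exact ℓ.le_opNorm _
  · intro hlt
    obtain ⟨C, hC⟩ := WienerChaos.SimpleElement.exists_norm_pairing_le hT hh hlt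
    let ψ : WienerChaos.SimpleElement T p q →L[ℝ] ℝ :=
      (WienerChaos.SimpleElement.pairing p q hh).mkContinuous C hC
    refine ⟨WienerChaos.memLp_stochExp hW hT.le hh,
      WienerChaos.aestronglyMeasurable_wienerSigma_stochExp hW hT.le hh,
      ψ.extend UniformSpace.Completion.toComplL, fun η => ?_⟩
    rw [hpair η]
    exact ContinuousLinearMap.extend_eq ψ UniformSpace.Completion.denseRange_coe
      (UniformSpace.Completion.isUniformInducing_coe _) η
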